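/- **Setting.** $G=\mathrm{SL}(2,\mathbb R)$, $K=\mathrm{SO}(2)$, $U=\mathrm{SU}(2)$, $M=\{\pm1\}\subset K$, $\mathfrak g=\mathfrak{sl}(2,\mathbb R)$ with basis $(E,F,H)$, $\theta=i(E-F)$; $\zeta_n(e^{is\theta})=e^{ins}$; for $\varepsilon\in\{\pm1\}$, $\mathbb Z^\varepsilon$ is the set of integers with the parity of $(\varepsilon-1)/2$ and $\mathcal O^\varepsilon(K)=\mathrm{span}_{\mathbb C}(\zeta_n:n\in\mathbb Z^\varepsilon)$. All algebras are unital. $\mathbb A$ is the $*$-algebra of real analytic functions $\mathbb R_+^*\times\mathbb R\to\mathbb C$, $\mathbb F$ its fraction field, $(\kappa,\tau)$ the coordinates, and $\eta\in\mathbb A$ the element with $\kappa^\tau-\kappa^{-\tau}=\tau\eta$; so $\eta(q,0)=2\log q$. For an involutive field $F\supset\mathbb C$ and $q\in F^*$ with a self-adjoint square root and not a root of unity, put $[n]_q=(q^n-q^{-n})/(q-q^{-1})$. Then ${}_FU_q(\mathfrak g)$ is the universal $(F,*)$-algebra on $\theta_q=\theta_q^*$, $X_q$, $Z_q=Z_q^*$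 with $$X_qZ_q=q^2Z_qX_q,\quad X_qX_q^*+q^2Z_q^2=1=X_q^*X_q+q^{-2}Z_q^2,\quad qX_q\theta_q-q^{-1}\theta_qX_q=[2]_qZ_q,\quad Z_q\theta_q-\theta_qZ_q=X_q-X_q^*.$$ For $\lambda\in F^*$, ${}_F\mathrm{ind}_q(\varepsilon,\lambda)$ is the ${}_FU_q(\mathfrak g)$-module with underlying space ${}_F\mathcal O^\varepsilon_q(K)$, which has basis $(\zeta_{q,n})_{n\in\mathbb Z^\varepsilon}$, and action $$\theta_q\zeta_{q,n}=[n]_q\zeta_{q,n},\qquad \bigl(q^{-1}X_q+qX_q^*+(q^n-q^{-n})Z_q\bigr)\zeta_{q,n}=(\lambda+\lambda^{-1})\zeta_{q,n},$$ $$\bigl(q^{\pm n}X_q-q^{\mp n}X_q^*\mp[2]_qZ_q\bigr)\zeta_{q,n}=(\lambda q^{1\pm n}-\lambda^{-1}q^{-1\mp n})\zeta_{q,n\pm2}.$$ The field is omitted from the notation when $F=\mathbb C$. Write $\zeta_{1,n}=\zeta_n$ and $\mathcal O_1^\varepsilon(K)=\mathcal O^\varepsilon(K)$. ${}_{\mathbb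 A}U(\mathfrak g)$ is the $(\mathbb A,*)$-subalgebra of ${}_{\mathbb F}U_{\kappa^\tau}(\mathfrak g)$ generated by $\theta_{\mathbb A}=\theta_{\kappa^\tau}$, $x_{\mathbb A}=\eta^{-1}(X_{\kappa^\tau}-1)$, $z_{\mathbb A}=\eta^{-1}Z_{\kappa^\tau}$. **Target algebras.** For a real Lie algebra $\mathfrak a$, $U(\mathfrak a)$ is the complexified enveloping algebra, with $*$ making $\mathfrak a$ skew-adjoint. $\mathfrak g_0=\mathfrak k\ltimes\mathfrak g/\mathfrak k$ is the Lie algebra of the Cartan motion group; put $\delta X=\frac12H\bmod\mathfrak k$, $\delta Z=i(E\bmod\mathfrak k)$. $U(\mathfrak g_0^\star)$ is the universal $*$-algebra generated by $\theta=\theta^*$ and the commutative $*$-algebra $\mathcal O(K\backslash U)$ (universal on $X$, $Z=Z^*$ with $XX^*+Z^2=1$), subject to $[\theta,T]=0$, $[\theta,T^\pm]=\pm2T^\pm$, where $T=X+X^*$, $T^\pm=X-X^*\mp2Z$. **Classical modules**, all on $\mathcal O^\varepsilon(K)$, for $\mu\in\mathbb C$. * $\mathrm{ind}(\varepsilon,\mu)$: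 the $U(\mathfrak g)$-module of $K$-finite functions $f$ on $G$ with $f(pg)=\chi(p)f(g)$ for upper triangular $p$ with upper left entry $a$, where $\chi(p)=|a|^{\mu+1}$ if $a>0$ and $\varepsilon|a|^{\mu+1}$ if $a<0$; $\mathfrak g$ acts by differentiating right translations, and $f$ is identified with $f|_K$. * $\mathrm{ind}(p_\mu,M,\varepsilon)$: the $U(\mathfrak g_0)$-module on which $\mathfrak k$ acts by differentiating right translations and $v\in\mathfrak g/\mathfrak k$ acts by $(v\psi)(k)=\chi(\mathrm{Ad}(k)v)\psi(k)$, $\chi$ being the $\mathbb R$-linear map $\mathfrak g/\mathfrak k\to\mathbb C$ with complex-linear extension $\delta X\mapsto\mu/2$, $\delta Z\mapsto0$. * $\mathrm{ind}(p^\star_\mu,M,\varepsilon)$, $\mu\ne0$: the $U(\mathfrak g^\star_0)$-module on which $\theta$ acts by differentiating right translations and $f\in\mathcal O(K\backslash U)$ acts by $(f\psi)(k)=f(p^\star_\mu\cdot k)\psi(k)$, $p^\star_\mu$ being the point of the complexified sphere $K\backslash U$ (a character of $\mathcal O(K\backslash U)$) with $X=\mu$, $X^*=\mu^{-1}$, $Z=0$.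 Here $K$ acts on points by $p\cdot k=k^{-1}pk$, a point with coordinates $X=x$, $X^*=x'$, $Z=z$ being identified with the matrix $\begin{pmatrix}z&ix'\\-ix&-z\end{pmatrix}$. **Specializations.** Let $\varphi_{q,t}:\mathbb A\to\mathbb C$ be evaluation at $(q,t)$. A specialization of an $(\mathbb A,*)$-algebra $B$ at $(q,t)$ is a universal $\varphi_{q,t}$-linear unital $*$-morphism $\varphi_B:B\to B_\varphi$ to a complex $*$-algebra. A specialization of a $B$-module is then a universal $\varphi_B$-linear map from it to a $B_\varphi$-module. **Proposition.** Let $\varepsilon\in\{\pm1\}$ and let $\lambda\in\mathbb A^\times$ satisfy $\lambda(1,t)=1$ for all $t\in\mathbb R$. The $\mathbb A$-span ${}_{\mathbb A}\mathcal O^\varepsilon(K)$ of the vectors $\zeta_{\kappa^\tau,n}$, $n\in\mathbb Z^\varepsilon$, is stable under ${}_{\mathbb A}U(\mathfrak g)$ in ${}_{\mathbb F}\mathrm{ind}_{\kappa^\tau}(\varepsilon,\lambda)$; let ${}_{\mathbb A}\mathrm{ind}(\varepsilon,\lambda)$ be the resulting module. For every $(q,t)\in\mathbb R_+^*\times\mathbb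 R$ there is a specialization $\mathrm{ev}_{q,t}:{}_{\mathbb A}U(\mathfrak g)\to U_{q,t}(\mathfrak g)$ of ${}_{\mathbb A}U(\mathfrak g)$ at $(q,t)$, given by the table below. There is a unique $U_{q,t}(\mathfrak g)$-module $\mathrm{ind}_{q,t}(\varepsilon,\lambda)$ with underlying space $\mathcal O^\varepsilon_{q^t}(K)$ such that the $\varphi_{q,t}$-linear map $\mathrm{ev}^\varepsilon_{q,t}:{}_{\mathbb A}\mathrm{ind}(\varepsilon,\lambda)\to\mathrm{ind}_{q,t}(\varepsilon,\lambda)$, $\zeta_{\kappa^\tau,n}\mapsto\zeta_{q^t,n}$, is a specialization with respect to $\mathrm{ev}_{q,t}$. This module is the one in the last column. | $(q,t)$ | $U_{q,t}(\mathfrak g)$ | $\mathrm{ev}_{q,t}(x_{\mathbb A}),\ \mathrm{ev}_{q,t}(z_{\mathbb A}),\ \mathrm{ev}_{q,t}(\theta_{\mathbb A})$ | $\mathrm{ind}_{q,t}(\varepsilon,\lambda)$ | |---|---|---|---| | $q\ne1,\ t\ne0$ | $U_{q^t}(\mathfrak g)$ | $\eta(q,t)^{-1}(X_{q^t}-1),\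 \eta(q,t)^{-1}Z_{q^t},\ \theta_{q^t}$ | $\mathrm{ind}_{q^t}(\varepsilon,\lambda(q,t))$ | | $q=1,\ t\ne0$ | $U(\mathfrak g)$ | $tH/2,\ itE,\ \theta$ | $\mathrm{ind}(\varepsilon,t^{-1}\partial_\kappa\lambda(1,t))$ | | $q\ne1,\ t=0$ | $U(\mathfrak g_0^\star)$ | $(2\log q)^{-1}(X-1),\ (2\log q)^{-1}Z,\ \theta$ | $\mathrm{ind}(p^\star_{\lambda(q,0)},M,\varepsilon)$ | | $q=1,\ t=0$ | $U(\mathfrak g_0)$ | $\delta X,\ \delta Z,\ \theta$ | $\mathrm{ind}(p_{\partial_\kappa\lambda(1,0)},M,\varepsilon)$ | -/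

import Mathlib

set_option linter.unusedSimpArgs false
set_option linter.unusedSectionVars false

universe w

noncomputable section

namespace QMackey

open scoped TensorProduct

/-! ### The ring of analytic functions on the parameter space -/

/-- The parameter space `ℝ₊* × ℝ`, with points `(q, t)`. -/
def Base : Type := {p : ℝ × ℝ // 0 < p.1}

/-- Extension by zero to `ℝ × ℝ` of a function on the parameter space. -/
def extend (f : Base → ℂ) (p : ℝ × ℝ) : ℂ := by
  classical exact if h : 0 < p.1 then f ⟨p, h⟩ else 0

theorem extend_of_pos (f : Base → ℂ) {p : ℝ × ℝ} (h : 0 < p.1) : extend f p = f ⟨p, h⟩ := by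
  simp [extend, h]

theorem extend_val (f : Base → ℂ) (p : Base) : extend f p.1 = f p := extend_of_pos f p.2

/-- The domain `ℝ₊* × ℝ` as an open subset of `ℝ × ℝ`. -/
def domain : Set (ℝ × ℝ) := {p | 0 < p.1}

theorem isOpen_domain : IsOpen domain := isOpen_lt continuous_const continuous_fst

theorem isPreconnected_domain : IsPreconnected domain := by
  have : domain = Set.Ioi (0 : ℝ) ×ˢ (Set.univ : Set ℝ) := by
    ext p; simp [domain]
  rw [this]
  exact isPreconnected_Ioi.prod isPreconnected_univ

/-- Real analyticity of a complex-valued function on the parameter space. -/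
def IsAnalytic (f : Base → ℂ) : Prop := AnalyticOnNhd ℝ (extend f) domain

theorem isAnalytic_of_eqOn {f : Base → ℂ} {g : ℝ × ℝ → ℂ} (hg : AnalyticOnNhd ℝ g domain)
    (h : ∀ p : Base, f p = g p.1) : IsAnalytic f :=
  hg.congr isOpen_domain fun p hp => by rw [extend_of_pos f hp]; exact (h ⟨p, hp⟩).symm

/-- The `*`-algebra `𝔸` of real analytic complex-valued functions on `ℝ₊* × ℝ`, with pointwise
operations and pointwise complex conjugation as involution. -/
def analyticFunctions : StarSubalgebra ℂ (Base → ℂ) where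
  carrier := {f | IsAnalytic f}
  mul_mem' {f g} hf hg := isAnalytic_of_eqOn (AnalyticOnNhd.mul hf hg) fun p => by
    simp [extend_val]
  add_mem' {f g} hf hg := isAnalytic_of_eqOn (AnalyticOnNhd.add hf hg) fun p => by
    simp [extend_val]
  algebraMap_mem' c := isAnalytic_of_eqOn (g := fun _ => c) (fun _ _ => analyticAt_const)
    fun p => rfl
  star_mem' {f} hf := isAnalytic_of_eqOn (g := fun p => Complex.conjCLE (extend f p))
    (fun p hp => (Complex.conjCLE.toContinuousLinearMap.analyticAt _).comp (hf p hp))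
    fun p => by simp [extend_val]

/-- The `*`-algebra `𝔸`. -/
abbrev AA : Type := analyticFunctions

instance : IsDomain AA := by
  have h0 : Nontrivial AA := ⟨⟨0, 1, fun h => by
    have := congrFun (congrArg Subtype.val h) (⟨(1, 0), by norm_num⟩ : Base)
    exact zero_ne_one (α := ℂ) this⟩⟩
  have h1 : NoZeroDivisors AA := ⟨by
    intro f g hfg
    by_contra! hne
    obtain ⟨hf, hg⟩ := hne
    obtain ⟨p, hp⟩ : ∃ p, f.1 p ≠ 0 := by
      by_contra! h
      exact hf (Subtype.ext (funext h))
    have hc : ContinuousAt (extend f.1) p.1 := (f.2 p.1 p.2).continuousAt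
    have hev : ∀ᶠ x in nhds p.1, extend f.1 x ≠ 0 :=
      hc.eventually_ne (by rw [extend_of_pos _ p.2]; exact hp)
    have hg0 : extend g.1 =ᶠ[nhds p.1] 0 := by
      filter_upwards [hev, isOpen_domain.mem_nhds p.2] with x hx hx'
      have := congrFun (congrArg Subtype.val hfg) (⟨x, hx'⟩ : Base)
      rw [extend_of_pos _ hx'] at hx ⊢
      exact (mul_eq_zero.mp this).resolve_left hx
    have := AnalyticOnNhd.eqOn_zero_of_preconnected_of_eventuallyEq_zero g.2
      isPreconnected_domain p.2 hg0
    exact hg (Subtype.ext (funext fun x => by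
      have h := this x.2
      rw [extend_of_pos _ x.2] at h
      exact h))⟩
  exact NoZeroDivisors.to_isDomain _

/-- Evaluation of `𝔸` at a point `(q, t)`. -/
def evalAt (q t : ℝ) (hq : 0 < q) : AA →+* ℂ :=
  (Pi.evalRingHom (fun _ : Base => ℂ) ⟨(q, t), hq⟩).comp
    (analyticFunctions.subtype : AA →⋆ₐ[ℂ] (Base → ℂ)).toAlgHom.toRingHom

/-- The value at `(q, t)` of the partial derivative of `f ∈ 𝔸` in the first coordinate. -/
def partialQ (f : AA) (q t : ℝ) : ℂ := deriv (fun s : ℝ => extend f.1 (s, t)) q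

/-- The function `(q, t) ↦ q ^ (c t)`, as an element of `𝔸`. -/
def powA (c : ℝ) : AA := ⟨fun p => ((p.1.1 ^ (c * p.1.2) : ℝ) : ℂ),
  isAnalytic_of_eqOn (g := fun p => ((Real.exp (Real.log p.1 * (c * p.2)) : ℝ) : ℂ))
    (fun p hp => by
      have h1 : AnalyticAt ℝ (fun p : ℝ × ℝ => Real.log p.1) p :=
        (analyticAt_log hp).comp analyticAt_fst
      exact (Complex.ofRealCLM.analyticAt _).comp
        ((h1.mul (analyticAt_const.mul analyticAt_snd)).rexp))
    fun p => by rw [Real.rpow_def_of_pos p.2]⟩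

/-- The second coordinate function `τ`. -/
def tauA : AA := ⟨fun p => ((p.1.2 : ℝ) : ℂ),
  isAnalytic_of_eqOn (g := fun p => ((p.2 : ℝ) : ℂ))
    (fun _ _ => (Complex.ofRealCLM.analyticAt _).comp analyticAt_snd) fun _ => rfl⟩

/-- `(q ^ t - q ^ (-t)) / t`, extended by its limit `2 log q` at `t = 0`. -/
def etaFun (q t : ℝ) : ℝ := if t = 0 then 2 * Real.log q else (q ^ t - q ^ (-t)) / t

theorem analyticAt_dslope_sinh (x : ℝ) : AnalyticAt ℝ (dslope Real.sinh 0) x := by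
  by_cases hx : x = 0
  · subst hx
    obtain ⟨p, hp⟩ := (Real.analyticAt_sinh : AnalyticAt ℝ Real.sinh 0)
    exact ⟨_, hp.has_fpower_series_dslope_fslope⟩
  · have : AnalyticAt ℝ (fun y => Real.sinh y / y) x := Real.analyticAt_sinh.div analyticAt_id hx
    refine this.congr ?_
    filter_upwards [isOpen_ne.mem_nhds hx] with y hy
    rw [dslope_of_ne _ hy]
    simp [slope_def_field]

/-- The element `η ∈ 𝔸`. -/
def etaA : AA := ⟨fun p => (etaFun p.1.1 p.1.2 : ℂ),
  isAnalytic_of_eqOn (g := fun p =>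
      ((2 * Real.log p.1 * dslope Real.sinh 0 (p.2 * Real.log p.1) : ℝ) : ℂ))
    (fun p hp => by
      have h1 : AnalyticAt ℝ (fun p : ℝ × ℝ => Real.log p.1) p :=
        (analyticAt_log hp).comp analyticAt_fst
      exact (Complex.ofRealCLM.analyticAt _).comp
        ((analyticAt_const.mul h1).mul
          ((analyticAt_dslope_sinh _).comp (analyticAt_snd.mul h1))))
    fun p => by
      congr 1
      unfold etaFun
      split_ifs with h
      · simp [h]
      · rw [Real.rpow_def_of_pos p.2, Real.rpow_def_of_pos p.2]
        by_cases hl : Real.log p.1.1 = 0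
        · simp [hl]
        · rw [dslope_of_ne _ (mul_ne_zero h hl), slope_def_field, Real.sinh_eq]
          simp only [Real.sinh_zero, sub_zero]
          field_simp⟩

/-- The defining property of `η`: `ϙ^τ - ϙ^(-τ) = τ η`. -/
theorem tauA_mul_etaA : powA 1 - powA (-1) = tauA * etaA := by
  apply Subtype.ext
  funext p
  show ((p.1.1 ^ (1 * p.1.2) : ℝ) : ℂ) - ((p.1.1 ^ (-1 * p.1.2) : ℝ) : ℂ)
    = ((p.1.2 : ℝ) : ℂ) * (etaFun p.1.1 p.1.2 : ℂ)
  rw [← Complex.ofReal_sub, ← Complex.ofReal_mul]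
  congr 1
  unfold etaFun
  split_ifs with h
  · simp [h]
  · field_simp

/-- The involution of the fraction field of a commutative `*`-domain. -/
instance fractionRingStarRing (A : Type) [CommRing A] [IsDomain A] [StarRing A] :
    StarRing (FractionRing A) where
  star := IsLocalization.map (M := nonZeroDivisors A) (T := nonZeroDivisors A) (FractionRing A)
    (starRingEnd A) (fun x hx => by
      rw [mem_nonZeroDivisors_iff_ne_zero] at hx
      simpa [mem_nonZeroDivisors_iff_ne_zero, starRingEnd_apply] using hx)
  star_involutive x := by
    obtain ⟨a, s, rfl⟩ := IsLocalization.exists_mk'_eq (nonZeroDivisors A) x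
    simp
  star_mul x y := by
    rw [mul_comm x y]
    exact map_mul (IsLocalization.map (M := nonZeroDivisors A) (FractionRing A)
      (starRingEnd A) _ : FractionRing A →+* FractionRing A) y x
  star_add x y := map_add (IsLocalization.map (M := nonZeroDivisors A) (FractionRing A)
      (starRingEnd A) _ : FractionRing A →+* FractionRing A) x y

theorem star_algebraMap_fractionRing (A : Type) [CommRing A] [IsDomain A] [StarRing A] (a : A) :
    star (algebraMap A (FractionRing A) a) = algebraMap A (FractionRing A) (star a) :=
  IsLocalization.map_eq _ a

instance (A : Type) [CommRing A] [IsDomain A] [StarRing A] : StarModule A (FractionRing A) :=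
  ⟨fun a x => by
    rw [Algebra.smul_def, Algebra.smul_def, star_mul', star_algebraMap_fractionRing]⟩

/-- The fraction field `𝔽` of `𝔸`. -/
abbrev FF : Type := FractionRing AA

/-! ### Unital `*`-algebras given by generators and relations -/

section StarPresented

open MulOpposite

variable {R S : Type} [CommRing R] [StarRing R]

/-- The opposite of an `R`-algebra, with scalars acting through the involution of `R`. -/
abbrev conjOpAlgebra (R B : Type) [CommRing R] [StarRing R] [Ring B] [Algebra R B] :
    Algebra R Bᵐᵒᵖ :=
  ((algebraMap R Bᵐᵒᵖ).comp (starRingEnd R)).toAlgebra' fun c x => by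
    exact Algebra.commutes (starRingEnd R c) x

/-- The involution of the free unital `(R, *)`-algebra on `S`, realized as the free algebra on
`S ⊕ S`: `inl s` is the generator `s` and `inr s` its adjoint. It is the unique conjugate-linear
antimultiplicative map exchanging `inl s` and `inr s`. -/
def freeStar (R S : Type) [CommRing R] [StarRing R] :
    FreeAlgebra R (S ⊕ S) →+* (FreeAlgebra R (S ⊕ S))ᵐᵒᵖ :=
  letI := conjOpAlgebra R (FreeAlgebra R (S ⊕ S))
  (FreeAlgebra.lift R fun s => op (FreeAlgebra.ι R s.swap)).toRingHom

theorem freeStar_ι (s : S ⊕ S) :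
    freeStar R S (FreeAlgebra.ι R s) = op (FreeAlgebra.ι R s.swap) := by
  let := conjOpAlgebra R (FreeAlgebra R (S ⊕ S))
  exact FreeAlgebra.lift_ι_apply (R := R) _ s

theorem freeStar_algebraMap (r : R) :
    freeStar R S (algebraMap R _ r) = op (algebraMap R _ (star r)) := by
  let := conjOpAlgebra R (FreeAlgebra R (S ⊕ S))
  exact AlgHom.commutes
    (FreeAlgebra.lift R fun s : S ⊕ S => op (FreeAlgebra.ι R s.swap)) r

theorem freeStar_freeStar (a : FreeAlgebra R (S ⊕ S)) :
    unop (freeStar R S (unop (freeStar R S a))) = a := by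
  induction a using FreeAlgebra.induction with
  | grade0 r => simp [freeStar_algebraMap]
  | grade1 s => simp [freeStar_ι]
  | mul a b ha hb => simp [ha, hb]
  | add a b ha hb => simp [ha, hb]

/-- The closure of a set of relations under the involution. -/
inductive StarRel (rel : FreeAlgebra R (S ⊕ S) → FreeAlgebra R (S ⊕ S) → Prop) :
    FreeAlgebra R (S ⊕ S) → FreeAlgebra R (S ⊕ S) → Prop
  | of {a b} : rel a b → StarRel rel a b
  | star {a b} : rel a b → StarRel rel (unop (freeStar R S a)) (unop (freeStar R S b))

/-- The universal unital `(R, *)`-algebra with generators `S` subject to the relations `rel`. -/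
def StarPresented (rel : FreeAlgebra R (S ⊕ S) → FreeAlgebra R (S ⊕ S) → Prop) : Type :=
  RingQuot (StarRel rel)

namespace StarPresented

variable (rel : FreeAlgebra R (S ⊕ S) → FreeAlgebra R (S ⊕ S) → Prop)

instance : Ring (StarPresented rel) := inferInstanceAs (Ring (RingQuot (StarRel rel)))

instance {A : Type} [CommRing A] [Algebra A R] : Algebra A (StarPresented rel) :=
  inferInstanceAs (Algebra A (RingQuot (StarRel rel)))

instance {A : Type} [CommRing A] [Algebra A R] : IsScalarTower A R (StarPresented rel) :=
  IsScalarTower.of_algebraMap_eq fun _ => rfl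

/-- The quotient map from the free algebra. -/
def mk : FreeAlgebra R (S ⊕ S) →ₐ[R] StarPresented rel := RingQuot.mkAlgHom R (StarRel rel)

/-- The generator `s`. -/
def gen (s : S) : StarPresented rel := mk rel (FreeAlgebra.ι R (Sum.inl s))

variable {rel}

theorem mk_eq {a b : FreeAlgebra R (S ⊕ S)} (h : StarRel rel a b) : mk rel a = mk rel b :=
  RingQuot.mkAlgHom_rel R h

theorem mk_surjective : Function.Surjective (mk rel) := RingQuot.mkAlgHom_surjective R _

/-- The (non-involutive) universal property. -/
def lift {B : Type} [Ring B] [Algebra R B] (f : S ⊕ S → B)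
    (hf : ∀ ⦃a b⦄, StarRel rel a b → FreeAlgebra.lift R f a = FreeAlgebra.lift R f b) :
    StarPresented rel →ₐ[R] B :=
  RingQuot.liftAlgHom R ⟨FreeAlgebra.lift R f, hf⟩

theorem lift_mk {B : Type} [Ring B] [Algebra R B] (f : S ⊕ S → B)
    (hf : ∀ ⦃a b⦄, StarRel rel a b → FreeAlgebra.lift R f a = FreeAlgebra.lift R f b)
    (a : FreeAlgebra R (S ⊕ S)) : lift f hf (mk rel a) = FreeAlgebra.lift R f a :=
  RingQuot.liftAlgHom_mkAlgHom_apply R _ _ a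

variable (rel) in
/-- The involution as a ring morphism to the opposite ring. -/
def starHom : StarPresented rel →+* (StarPresented rel)ᵐᵒᵖ :=
  RingQuot.lift (r := StarRel rel) ⟨((mk rel).toRingHom.op).comp (freeStar R S), by
    intro a b h
    show op (mk rel (unop (freeStar R S a))) = op (mk rel (unop (freeStar R S b)))
    congr 1
    cases h with
    | of h => exact mk_eq (StarRel.star h)
    | star h =>
      rw [freeStar_freeStar, freeStar_freeStar]
      exact mk_eq (StarRel.of h)⟩

theorem starHom_mk (a : FreeAlgebra R (S ⊕ S)) :
    starHom rel (mk rel a) = op (mk rel (unop (freeStar R S a))) := by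
  have : mk rel a = RingQuot.mkRingHom (StarRel rel) a := by
    rw [← RingQuot.mkAlgHom_coe R]; rfl
  rw [this]
  exact RingQuot.lift_mkRingHom_apply _ _ _

instance : StarRing (StarPresented rel) where
  star x := unop (starHom rel x)
  star_involutive x := by
    obtain ⟨a, rfl⟩ := mk_surjective x
    simp [starHom_mk, freeStar_freeStar]
  star_mul x y := by simp
  star_add x y := by simp

theorem star_mk (a : FreeAlgebra R (S ⊕ S)) :
    star (mk rel a) = mk rel (unop (freeStar R S a)) :=
  congrArg unop (starHom_mk a)

theorem star_algebraMap (r : R) :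
    star (algebraMap R (StarPresented rel) r) = algebraMap R (StarPresented rel) (star r) := by
  rw [← AlgHom.commutes (mk rel), star_mk, freeStar_algebraMap]
  exact AlgHom.commutes (mk rel) _

instance {A : Type} [CommRing A] [StarRing A] [Algebra A R] [StarModule A R] :
    StarModule A (StarPresented rel) :=
  ⟨fun a x => by
    have h : star (algebraMap A R a) = algebraMap A R (star a) := by
      rw [Algebra.algebraMap_eq_smul_one, star_smul, star_one, ← Algebra.algebraMap_eq_smul_one]
    rw [Algebra.smul_def, Algebra.smul_def, IsScalarTower.algebraMap_apply A R (StarPresented rel),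
      IsScalarTower.algebraMap_apply A R (StarPresented rel), star_mul, star_algebraMap, h]
    exact (Algebra.commutes _ _).symm⟩

end StarPresented

end StarPresented

/-! ### The quantized enveloping algebra of `sl(2, ℝ)` and its induced modules -/

/-- Names for the generators `X`, `Z` and `θ`. -/
inductive Gen : Type
  | X
  | Z
  | θ

section Relations

variable (F : Type) [CommRing F]

/-- The generator `X` of the free `*`-algebra. -/
abbrev fX : FreeAlgebra F (Gen ⊕ Gen) := FreeAlgebra.ι F (Sum.inl Gen.X)
/-- The adjoint of the generator `X` in the free `*`-algebra. -/
abbrev fXs : FreeAlgebra F (Gen ⊕ Gen) := FreeAlgebra.ι F (Sum.inr Gen.X)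
/-- The generator `Z` of the free `*`-algebra. -/
abbrev fZ : FreeAlgebra F (Gen ⊕ Gen) := FreeAlgebra.ι F (Sum.inl Gen.Z)
/-- The adjoint of the generator `Z` in the free `*`-algebra. -/
abbrev fZs : FreeAlgebra F (Gen ⊕ Gen) := FreeAlgebra.ι F (Sum.inr Gen.Z)
/-- The generator `θ` of the free `*`-algebra. -/
abbrev fθ : FreeAlgebra F (Gen ⊕ Gen) := FreeAlgebra.ι F (Sum.inl Gen.θ)
/-- The adjoint of the generator `θ` in the free `*`-algebra. -/
abbrev fθs : FreeAlgebra F (Gen ⊕ Gen) := FreeAlgebra.ι F (Sum.inr Gen.θ)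

end Relations

/-- An admissible deformation parameter in an involutive field `F`: a non-zero element with a
self-adjoint square root which is not a root of unity. -/
structure QParam (F : Type) [Field F] [StarRing F] where
  val : F
  exists_sqrt : ∃ r : F, star r = r ∧ r ^ 2 = val
  ne_zero : val ≠ 0
  not_root : ∀ n : ℕ, 0 < n → val ^ n ≠ 1

section Quantum

variable {F : Type} [Field F] [CharZero F] [StarRing F]

/-- The `q`-integer `[n]_q`. -/
def qInt (q : F) (n : ℤ) : F := (q - q⁻¹)⁻¹ * (q ^ n - q ^ (-n))

/-- The defining relations of `U_q(𝔤)`. -/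
inductive UqRel (q : F) : FreeAlgebra F (Gen ⊕ Gen) → FreeAlgebra F (Gen ⊕ Gen) → Prop
  | Z_star : UqRel q (fZs F) (fZ F)
  | XZ : UqRel q (fX F * fZ F) (q ^ 2 • (fZ F * fX F))
  | XXs : UqRel q (fX F * fXs F + q ^ 2 • fZ F ^ 2) 1
  | XsX : UqRel q (fXs F * fX F + (q⁻¹) ^ 2 • fZ F ^ 2) 1
  | θ_star : UqRel q (fθs F) (fθ F)
  | Xθ : UqRel q (q • (fX F * fθ F) - q⁻¹ • (fθ F * fX F)) (qInt q 2 • fZ F)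
  | Zθ : UqRel q (fZ F * fθ F - fθ F * fZ F) (fX F - fXs F)

/-- The quantized enveloping `*`-algebra `U_q(𝔤)` of `𝔤 = sl(2, ℝ)` over `F`. -/
abbrev Uq (q : QParam F) : Type := StarPresented (UqRel q.val)

namespace Uq

variable (q : QParam F)

/-- The generator `X_q`. -/
abbrev X : Uq q := StarPresented.gen _ Gen.X
/-- The generator `Z_q`. -/
abbrev Z : Uq q := StarPresented.gen _ Gen.Z
/-- The generator `θ_q`. -/
abbrev θ : Uq q := StarPresented.gen _ Gen.θ

/-- The element `T_{q,n} = q⁻¹ X + q X* + (qⁿ - q⁻ⁿ) Z`. -/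
def T (n : ℤ) : Uq q :=
  q.val⁻¹ • X q + q.val • star (X q) + (q.val ^ n - q.val ^ (-n)) • Z q

/-- The element `T⁺_{q,n} = qⁿ X - q⁻ⁿ X* - [2]_q Z`. -/
def Tplus (n : ℤ) : Uq q :=
  q.val ^ n • X q - q.val ^ (-n) • star (X q) - qInt q.val 2 • Z q

/-- The element `T⁻_{q,n} = q⁻ⁿ X - qⁿ X* + [2]_q Z`. -/
def Tminus (n : ℤ) : Uq q :=
  q.val ^ (-n) • X q - q.val ^ n • star (X q) + qInt q.val 2 • Z q

end Uq

/-- The set `ℤ^ε` of the integers having the same parity as `(ε - 1) / 2`. -/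
def ZPar (ε : ℤˣ) : Type := {n : ℤ // n ≡ ((ε : ℤ) - 1) / 2 [ZMOD 2]}

/-- The shift `n ↦ n + 2 m` of `ℤ^ε`. -/
def ZPar.shift {ε : ℤˣ} (n : ZPar ε) (m : ℤ) : ZPar ε :=
  ⟨n.1 + 2 * m, by
    have h := n.2
    unfold Int.ModEq at h ⊢
    omega⟩

/-- The space `𝒪_q^ε(K)`: the vector space with basis `(ζ_{q,n})`, `n ∈ ℤ^ε`. -/
abbrev OqK (F : Type) [Field F] (ε : ℤˣ) : Type := ZPar ε →₀ F

/-- The basis vector `ζ_{q,n}`. -/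
abbrev zetaq (F : Type) [Field F] {ε : ℤˣ} (n : ZPar ε) : OqK F ε := Finsupp.single n 1

namespace IndQ

variable (q : F) (ε : ℤˣ) (l : F)

/-- The operator on `𝒪_q^ε(K)` mapping `ζ_n` to `a n ζ_{n+2} + b n ζ_n + c n ζ_{n-2}`. -/
def tri (a b c : ℤ → F) : Module.End F (OqK F ε) :=
  Finsupp.linearCombination F fun n : ZPar ε =>
    a n.1 • zetaq F (n.shift 1) + b n.1 • zetaq F n + c n.1 • zetaq F (n.shift (-1))

/-- `{n} = qⁿ + q⁻ⁿ`. -/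
def br (n : ℤ) : F := q ^ n + q ^ (-n)

/-- The coefficient of `T_n ζ_n`. -/
def kap : F := l + l⁻¹

/-- The coefficient of `T⁺_n ζ_n`. -/
def kapP (n : ℤ) : F := l * q ^ (1 + n) - l⁻¹ * q ^ (-1 - n)

/-- The coefficient of `T⁻_n ζ_n`. -/
def kapM (n : ℤ) : F := l * q ^ (1 - n) - l⁻¹ * q ^ (-1 + n)

/-- The action of `X_q`, obtained by inverting the linear system defining `T_n, T⁺_n, T⁻_n`. -/
def opX : Module.End F (OqK F ε) :=
  tri ε (fun n => q ^ (n + 1) * kapP q l n / (br q n * br q (n + 1)))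
    (fun n => br q 1 * kap l / (br q (n + 1) * br q (n - 1)))
    (fun n => q ^ (1 - n) * kapM q l n / (br q n * br q (n - 1)))

/-- The action of `X_q*`. -/
def opXs : Module.End F (OqK F ε) :=
  tri ε (fun n => -(q ^ (-n - 1) * kapP q l n) / (br q n * br q (n + 1)))
    (fun n => br q 1 * kap l / (br q (n + 1) * br q (n - 1)))
    (fun n => -(q ^ (n - 1) * kapM q l n) / (br q n * br q (n - 1)))

/-- The action of `Z_q`. -/
def opZ : Module.End F (OqK F ε) :=
  tri ε (fun n => -kapP q l n / (br q n * br q (n + 1)))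
    (fun n => (q ^ n - q ^ (-n)) * kap l / (br q (n + 1) * br q (n - 1)))
    (fun n => kapM q l n / (br q n * br q (n - 1)))

/-- The action of `θ_q`. -/
def opθ : Module.End F (OqK F ε) := tri ε 0 (fun n => qInt q n) 0

end IndQ

namespace IndQ


theorem tri_zetaq (ε : ℤˣ) (a b c : ℤ → F) (n : ZPar ε) :
    tri ε a b c (zetaq F n)
      = a n.1 • zetaq F (n.shift 1) + b n.1 • zetaq F n + c n.1 • zetaq F (n.shift (-1)) := by
  rw [tri, Finsupp.linearCombination_single, one_smul]

theorem end_ext {ε : ℤˣ} {f g : Module.End F (OqK F ε)}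
    (h : ∀ n : ZPar ε, f (zetaq F n) = g (zetaq F n)) : f = g :=
  Finsupp.lhom_ext' fun n => LinearMap.ext_ring (h n)

theorem shift_val {ε : ℤˣ} (n : ZPar ε) (m : ℤ) : (n.shift m).1 = n.1 + 2 * m := rfl

theorem shift_shift {ε : ℤˣ} (n : ZPar ε) (m k : ℤ) : (n.shift m).shift k = n.shift (m + k) :=
  Subtype.ext (by simp only [shift_val]; ring)

theorem shift_zero {ε : ℤˣ} (n : ZPar ε) : n.shift 0 = n :=
  Subtype.ext (by simp only [shift_val]; ring)

theorem tri_mul (ε : ℤˣ) (a b c a' b' c' : ℤ → F) (n : ZPar ε) :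
    (tri ε a b c * tri ε a' b' c') (zetaq F n)
      = (a (n.1 + 2) * a' n.1) • zetaq F (n.shift 2)
        + (b (n.1 + 2) * a' n.1 + a n.1 * b' n.1) • zetaq F (n.shift 1)
        + (c (n.1 + 2) * a' n.1 + b n.1 * b' n.1 + a (n.1 - 2) * c' n.1) • zetaq F n
        + (c n.1 * b' n.1 + b (n.1 - 2) * c' n.1) • zetaq F (n.shift (-1))
        + (c (n.1 - 2) * c' n.1) • zetaq F (n.shift (-2)) := by
  rw [Module.End.mul_apply, tri_zetaq, map_add, map_add, map_smul, map_smul, map_smul,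
    tri_zetaq, tri_zetaq, tri_zetaq]
  simp only [shift_shift, shift_val]
  have e1 : n.1 + 2 * (1 : ℤ) = n.1 + 2 := by ring
  have e2 : n.1 + 2 * (-1 : ℤ) = n.1 - 2 := by ring
  have e3 : (1 : ℤ) + 1 = 2 := by norm_num
  have e4 : (-1 : ℤ) + 1 = 0 := by norm_num
  have e5 : (1 : ℤ) + -1 = 0 := by norm_num
  have e6 : (-1 : ℤ) + -1 = -2 := by norm_num
  rw [e1, e2, e3, e4, e5, e6, shift_zero]
  module

variable (q : QParam F) (ε : ℤˣ) (l : F)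

theorem zpow_ne_neg_one (n : ℤ) : q.val ^ n ≠ -1 := by
  intro h
  have h2 : q.val ^ (2 * n) = 1 := by
    rw [mul_comm, zpow_mul, h]; norm_num
  have key : ∀ m : ℤ, q.val ^ m = 1 → m = 0 := by
    intro m hm
    rcases lt_trichotomy m 0 with h' | h' | h'
    · exfalso
      refine q.not_root m.natAbs (Int.natAbs_pos.mpr h'.ne) ?_
      have h3 : ((m.natAbs : ℕ) : ℤ) = -m := by omega
      rw [← zpow_natCast, h3, zpow_neg, hm, inv_one]
    · exact h'
    · exfalso
      refine q.not_root m.natAbs (Int.natAbs_pos.mpr h'.ne') ?_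
      have h3 : ((m.natAbs : ℕ) : ℤ) = m := by omega
      rw [← zpow_natCast, h3, hm]
  have h0 : n = 0 := by have := key _ h2; omega
  rw [h0, zpow_zero] at h
  have : (2 : F) = 0 := by linear_combination h
  exact two_ne_zero this

theorem sq_add_one_ne_zero (n : ℤ) : (q.val ^ n) ^ 2 + 1 ≠ 0 := by
  intro h
  apply zpow_ne_neg_one q (n * 2)
  rw [zpow_mul]
  have : (q.val ^ n) ^ (2 : ℤ) = (q.val ^ n) ^ 2 := by norm_cast
  rw [this]
  linear_combination h

theorem sq_sub_one_ne_zero : q.val ^ 2 - 1 ≠ 0 := fun h =>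
  q.not_root 2 (by norm_num) (by linear_combination h)

theorem sub_inv_ne_zero : q.val - q.val⁻¹ ≠ 0 := by
  intro h
  have h0 := q.ne_zero
  apply q.not_root 2 (by norm_num)
  field_simp at h
  linear_combination h

theorem br_ne_zero (n : ℤ) : br q.val n ≠ 0 := by
  have h0 : q.val ^ n ≠ 0 := zpow_ne_zero _ q.ne_zero
  have h1 := sq_add_one_ne_zero q n
  intro h
  apply h1
  unfold br at h
  rw [zpow_neg] at h
  field_simp at h
  simpa using h

end IndQ

namespace IndQ

/-- A combination of the vectors `ζ_{n+4}, …, ζ_{n-4}`. -/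
def pen {ε : ℤˣ} (n : ZPar ε) (a b c d e : F) : OqK F ε :=
  a • zetaq F (n.shift 2) + b • zetaq F (n.shift 1) + c • zetaq F n
    + d • zetaq F (n.shift (-1)) + e • zetaq F (n.shift (-2))

theorem pen_sub {ε : ℤˣ} (n : ZPar ε) (a b c d e a' b' c' d' e' : F) :
    pen n a b c d e - pen n a' b' c' d' e'
      = pen n (a - a') (b - b') (c - c') (d - d') (e - e') := by
  unfold pen; module

theorem pen_add {ε : ℤˣ} (n : ZPar ε) (a b c d e a' b' c' d' e' : F) :
    pen n a b c d e + pen n a' b' c' d' e'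
      = pen n (a + a') (b + b') (c + c') (d + d') (e + e') := by
  unfold pen; module

theorem smul_pen {ε : ℤˣ} (n : ZPar ε) (r a b c d e : F) :
    r • pen n a b c d e = pen n (r * a) (r * b) (r * c) (r * d) (r * e) := by
  unfold pen; module

theorem tri_pen (ε : ℤˣ) (a b c : ℤ → F) (n : ZPar ε) :
    tri ε a b c (zetaq F n) = pen n 0 (a n.1) (b n.1) (c n.1) 0 := by
  rw [tri_zetaq]; unfold pen; module

theorem tri_mul_pen (ε : ℤˣ) (a b c a' b' c' : ℤ → F) (n : ZPar ε) :
    (tri ε a b c * tri ε a' b' c') (zetaq F n)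
      = pen n (a (n.1 + 2) * a' n.1) (b (n.1 + 2) * a' n.1 + a n.1 * b' n.1)
        (c (n.1 + 2) * a' n.1 + b n.1 * b' n.1 + a (n.1 - 2) * c' n.1)
        (c n.1 * b' n.1 + b (n.1 - 2) * c' n.1) (c (n.1 - 2) * c' n.1) := by
  rw [tri_mul]; rfl

theorem one_pen {ε : ℤˣ} (n : ZPar ε) :
    (1 : Module.End F (OqK F ε)) (zetaq F n) = pen n 0 0 1 0 0 := by
  rw [Module.End.one_apply]; unfold pen; module

theorem br1 (q : F) (n : ℤ) : br q (n + 2 + 1) = br q (n + 3) := by congr 1; ring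
theorem br2 (q : F) (n : ℤ) : br q (n + 2 - 1) = br q (n + 1) := by congr 1; ring
theorem br3 (q : F) (n : ℤ) : br q (n - 2 + 1) = br q (n - 1) := by congr 1; ring
theorem br4 (q : F) (n : ℤ) : br q (n - 2 - 1) = br q (n - 3) := by congr 1; ring

/-- The operators satisfy the defining relations of `U_q(𝔤)` and their adjoints. -/
theorem op_relations (q : QParam F) (ε : ℤˣ) {l : F} (hl : l ≠ 0) :
    (opX q.val ε l * opZ q.val ε l = q.val ^ 2 • (opZ q.val ε l * opX q.val ε l)) ∧
    (opZ q.val ε l * opXs q.val ε l = q.val ^ 2 • (opXs q.val ε l * opZ q.val ε l)) ∧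
    (opX q.val ε l * opXs q.val ε l + q.val ^ 2 • (opZ q.val ε l * opZ q.val ε l) = 1) ∧
    (opXs q.val ε l * opX q.val ε l + (q.val⁻¹) ^ 2 • (opZ q.val ε l * opZ q.val ε l) = 1) ∧
    (q.val • (opX q.val ε l * opθ q.val ε) - q.val⁻¹ • (opθ q.val ε * opX q.val ε l)
      = qInt q.val 2 • opZ q.val ε l) ∧
    (q.val • (opθ q.val ε * opXs q.val ε l) - q.val⁻¹ • (opXs q.val ε l * opθ q.val ε)
      = qInt q.val 2 • opZ q.val ε l) ∧
    (opZ q.val ε l * opθ q.val ε - opθ q.val ε * opZ q.val ε l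
      = opX q.val ε l - opXs q.val ε l) := by
  refine ⟨?_, ?_, ?_, ?_, ?_, ?_, ?_⟩ <;>
  · refine end_ext fun n => ?_
    simp only [LinearMap.add_apply, LinearMap.sub_apply, LinearMap.smul_apply]
    simp only [opX, opZ, opXs, opθ, tri_mul_pen, tri_pen, one_pen, smul_pen, pen_add, pen_sub]
    obtain ⟨n, hn⟩ := n
    have hq := q.ne_zero
    have hs := sub_inv_ne_zero q
    have hs2 := sq_sub_one_ne_zero q
    have hA : q.val ^ n ≠ 0 := zpow_ne_zero _ hq
    have b0 := br_ne_zero q n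
    have b1 := br_ne_zero q (n + 1)
    have b2 := br_ne_zero q (n - 1)
    have b3 := br_ne_zero q (n + 2)
    have b4 := br_ne_zero q (n - 2)
    have b5 := br_ne_zero q (n + 3)
    have b6 := br_ne_zero q (n - 3)
    congr 1 <;>
    · simp only [br1, br2, br3, br4, qInt, Pi.zero_apply]
      try field_simp
      try simp only [br, kapP, kapM, kap, zpow_add₀ hq, zpow_sub₀ hq, zpow_neg,
        zpow_ofNat, neg_sub, neg_add]
      try generalize q.val ^ n = A at *
      generalize q.val = Q at *
      try field_simp
      try ring

end IndQ

theorem QParam.star_val {F : Type} [Field F] [StarRing F] (q : QParam F) : star q.val = q.val := by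
  obtain ⟨r, hr, h⟩ := q.exists_sqrt
  rw [← h, star_pow, hr]

theorem QParam.star_qInt {F : Type} [Field F] [StarRing F] (q : QParam F) (n : ℤ) :
    star (qInt q.val n) = qInt q.val n := by
  simp [qInt, q.star_val]

open MulOpposite in
theorem unop_freeStar_smul {R S : Type} [CommRing R] [StarRing R] (r : R)
    (a : FreeAlgebra R (S ⊕ S)) :
    unop (freeStar R S (r • a)) = star r • unop (freeStar R S a) := by
  rw [Algebra.smul_def, map_mul, freeStar_algebraMap, unop_mul, unop_op, Algebra.smul_def]
  exact (Algebra.commutes _ _).symm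

namespace IndQ

/-- The images of the generators and of their adjoints. -/
def opGen (q l : F) (ε : ℤˣ) : Gen ⊕ Gen → Module.End F (OqK F ε)
  | Sum.inl Gen.X => opX q ε l
  | Sum.inr Gen.X => opXs q ε l
  | Sum.inl Gen.Z => opZ q ε l
  | Sum.inr Gen.Z => opZ q ε l
  | Sum.inl Gen.θ => opθ q ε
  | Sum.inr Gen.θ => opθ q ε

theorem opGen_rel (q : QParam F) (ε : ℤˣ) {l : F} (hl : l ≠ 0) ⦃a b : FreeAlgebra F (Gen ⊕ Gen)⦄
    (h : StarRel (UqRel q.val) a b) :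
    FreeAlgebra.lift F (opGen q.val l ε) a = FreeAlgebra.lift F (opGen q.val l ε) b := by
  obtain ⟨h1, h1s, h2, h3, h4, h4s, h5⟩ := op_relations q ε hl
  have g1 : opGen q.val l ε (Sum.inl Gen.X) = opX q.val ε l := rfl
  have g2 : opGen q.val l ε (Sum.inr Gen.X) = opXs q.val ε l := rfl
  have g3 : opGen q.val l ε (Sum.inl Gen.Z) = opZ q.val ε l := rfl
  have g4 : opGen q.val l ε (Sum.inr Gen.Z) = opZ q.val ε l := rfl
  have g5 : opGen q.val l ε (Sum.inl Gen.θ) = opθ q.val ε := rfl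
  have g6 : opGen q.val l ε (Sum.inr Gen.θ) = opθ q.val ε := rfl
  generalize opGen q.val l ε = o at *
  set x := opX q.val ε l
  set y := opXs q.val ε l
  set z := opZ q.val ε l
  set t := opθ q.val ε
  clear_value x y z t
  cases h with
  | of h =>
    cases h <;> simp only [map_mul, map_add, map_sub, map_smul, map_one, FreeAlgebra.lift_ι_apply,
      g1, g2, g3, g4, g5, g6, pow_two z, map_pow]
    exacts [h1, h2, h3, h4, h5]
  | star h =>
    cases h <;> simp only [map_mul, map_add, map_sub, map_one, FreeAlgebra.lift_ι_apply,
      g1, g2, g3, g4, g5, g6, pow_two z, map_pow, unop_freeStar_smul, MulOpposite.unop_mul,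
      MulOpposite.unop_add, MulOpposite.unop_sub, MulOpposite.unop_one, MulOpposite.unop_pow,
      MulOpposite.unop_op, freeStar_ι, Sum.swap_inl, Sum.swap_inr, star_pow, star_inv₀,
      q.star_val, q.star_qInt, map_smul]
    exacts [h1s, h2, h3, h4s, by rw [← neg_sub, h5]; abel]

end IndQ

/-- The `U_q(𝔤)`-module `ind_q(ε, λ)`, `λ ∈ F*`, realized on `𝒪_q^ε(K)`. Its action is given by the
formulas of `indQ_θ`, `indQ_T`, `indQ_Tplus` and `indQ_Tminus`, which determine it. -/
def indQ (q : QParam F) (ε : ℤˣ) (l : Fˣ) : Uq q →ₐ[F] Module.End F (OqK F ε) :=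
  StarPresented.lift (IndQ.opGen q.val l ε) (IndQ.opGen_rel q ε l.ne_zero)

section IndQFormulas

variable (q : QParam F) (ε : ℤˣ) (l : Fˣ)

theorem indQ_X : indQ q ε l (Uq.X q) = IndQ.opX q.val ε l := by
  unfold indQ Uq.X StarPresented.gen
  rw [StarPresented.lift_mk, FreeAlgebra.lift_ι_apply]
  rfl

theorem indQ_star_X : indQ q ε l (star (Uq.X q)) = IndQ.opXs q.val ε l := by
  unfold indQ Uq.X StarPresented.gen
  rw [StarPresented.star_mk, StarPresented.lift_mk, freeStar_ι, MulOpposite.unop_op,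
    FreeAlgebra.lift_ι_apply]
  rfl

theorem indQ_Z : indQ q ε l (Uq.Z q) = IndQ.opZ q.val ε l := by
  unfold indQ Uq.Z StarPresented.gen
  rw [StarPresented.lift_mk, FreeAlgebra.lift_ι_apply]
  rfl

/-- `θ ζ_n = [n]_q ζ_n`. -/
theorem indQ_θ (n : ZPar ε) :
    indQ q ε l (Uq.θ q) (zetaq F n) = qInt q.val n.1 • zetaq F n := by
  have : indQ q ε l (Uq.θ q) = IndQ.opθ q.val ε := by
    unfold indQ Uq.θ StarPresented.gen
    rw [StarPresented.lift_mk, FreeAlgebra.lift_ι_apply]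
    rfl
  rw [this, IndQ.opθ, IndQ.tri_zetaq]
  simp only [Pi.zero_apply]
  module

/-- `T_n ζ_n = (λ + λ⁻¹) ζ_n`. -/
theorem indQ_T (n : ZPar ε) :
    indQ q ε l (Uq.T q n.1) (zetaq F n) = ((l : F) + (l : F)⁻¹) • zetaq F n := by
  have e : ∀ c : F, c • zetaq F n = IndQ.pen n 0 0 c 0 0 := fun c => by unfold IndQ.pen; module
  rw [Uq.T, map_add, map_add, map_smul, map_smul, map_smul, indQ_X, indQ_star_X, indQ_Z, e]
  simp only [LinearMap.add_apply, LinearMap.sub_apply, LinearMap.smul_apply, IndQ.opX, IndQ.opXs,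
    IndQ.opZ, IndQ.tri_pen, IndQ.smul_pen, IndQ.pen_add, IndQ.pen_sub]
  obtain ⟨n, hn⟩ := n
  have hq := q.ne_zero
  have hl := l.ne_zero
  have hs := IndQ.sub_inv_ne_zero q
  have hs2 := IndQ.sq_sub_one_ne_zero q
  have hA : q.val ^ n ≠ 0 := zpow_ne_zero _ hq
  have b0 := IndQ.br_ne_zero q n
  have b1 := IndQ.br_ne_zero q (n + 1)
  have b2 := IndQ.br_ne_zero q (n - 1)
  generalize (l : F) = l at *
  congr 1 <;>
  · simp only [qInt]
    try field_simp
    try simp only [IndQ.br, IndQ.kapP, IndQ.kapM, IndQ.kap, zpow_add₀ hq, zpow_sub₀ hq, zpow_neg,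
      zpow_ofNat, neg_sub, neg_add]
    try generalize q.val ^ n = A at *
    generalize q.val = Q at *
    try field_simp
    try ring

/-- `T⁺_n ζ_n = (λ q^(1+n) - λ⁻¹ q^(-1-n)) ζ_{n+2}`. -/
theorem indQ_Tplus (n : ZPar ε) :
    indQ q ε l (Uq.Tplus q n.1) (zetaq F n)
      = ((l : F) * q.val ^ (1 + n.1) - (l : F)⁻¹ * q.val ^ (-1 - n.1)) • zetaq F (n.shift 1) := by
  have e : ∀ c : F, c • zetaq F (n.shift 1) = IndQ.pen n 0 c 0 0 0 := fun c => by unfold IndQ.pen; module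
  rw [Uq.Tplus, map_sub, map_sub, map_smul, map_smul, map_smul, indQ_X, indQ_star_X, indQ_Z, e]
  simp only [LinearMap.add_apply, LinearMap.sub_apply, LinearMap.smul_apply, IndQ.opX, IndQ.opXs,
    IndQ.opZ, IndQ.tri_pen, IndQ.smul_pen, IndQ.pen_add, IndQ.pen_sub]
  obtain ⟨n, hn⟩ := n
  have hq := q.ne_zero
  have hl := l.ne_zero
  have hs := IndQ.sub_inv_ne_zero q
  have hs2 := IndQ.sq_sub_one_ne_zero q
  have hA : q.val ^ n ≠ 0 := zpow_ne_zero _ hq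
  have b0 := IndQ.br_ne_zero q n
  have b1 := IndQ.br_ne_zero q (n + 1)
  have b2 := IndQ.br_ne_zero q (n - 1)
  generalize (l : F) = l at *
  congr 1 <;>
  · simp only [qInt]
    try field_simp
    try simp only [IndQ.br, IndQ.kapP, IndQ.kapM, IndQ.kap, zpow_add₀ hq, zpow_sub₀ hq, zpow_neg,
      zpow_ofNat, neg_sub, neg_add]
    try generalize q.val ^ n = A at *
    generalize q.val = Q at *
    try field_simp
    try ring

/-- `T⁻_n ζ_n = (λ q^(1-n) - λ⁻¹ q^(-1+n)) ζ_{n-2}`. -/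
theorem indQ_Tminus (n : ZPar ε) :
    indQ q ε l (Uq.Tminus q n.1) (zetaq F n)
      = ((l : F) * q.val ^ (1 - n.1) - (l : F)⁻¹ * q.val ^ (-1 + n.1)) •
        zetaq F (n.shift (-1)) := by
  have e : ∀ c : F, c • zetaq F (n.shift (-1)) = IndQ.pen n 0 0 0 c 0 := fun c => by unfold IndQ.pen; module
  rw [Uq.Tminus, map_add, map_sub, map_smul, map_smul, map_smul, indQ_X, indQ_star_X, indQ_Z, e]
  simp only [LinearMap.add_apply, LinearMap.sub_apply, LinearMap.smul_apply, IndQ.opX, IndQ.opXs,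
    IndQ.opZ, IndQ.tri_pen, IndQ.smul_pen, IndQ.pen_add, IndQ.pen_sub]
  obtain ⟨n, hn⟩ := n
  have hq := q.ne_zero
  have hl := l.ne_zero
  have hs := IndQ.sub_inv_ne_zero q
  have hs2 := IndQ.sq_sub_one_ne_zero q
  have hA : q.val ^ n ≠ 0 := zpow_ne_zero _ hq
  have b0 := IndQ.br_ne_zero q n
  have b1 := IndQ.br_ne_zero q (n + 1)
  have b2 := IndQ.br_ne_zero q (n - 1)
  generalize (l : F) = l at *
  congr 1 <;>
  · simp only [qInt]
    try field_simp
    try simp only [IndQ.br, IndQ.kapP, IndQ.kapM, IndQ.kap, zpow_add₀ hq, zpow_sub₀ hq, zpow_neg,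
      zpow_ofNat, neg_sub, neg_add]
    try generalize q.val ^ n = A at *
    generalize q.val = Q at *
    try field_simp
    try ring

end IndQFormulas

end Quantum

/-! ### The `𝔸`-form of the quantized enveloping algebra -/

instance : CharZero FF := charZero_of_injective_algebraMap (algebraMap ℂ FF).injective

theorem powA_apply (c : ℝ) (p : Base) : (powA c).1 p = ((p.1.1 ^ (c * p.1.2) : ℝ) : ℂ) := rfl

theorem star_powA (c : ℝ) : star (powA c) = powA c :=
  Subtype.ext (funext fun _ => Complex.conj_ofReal _)

/-- The admissible parameter `ϙ^τ` of `𝔽`. -/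
def qF : QParam FF where
  val := algebraMap AA FF (powA 1)
  exists_sqrt := by
    refine ⟨algebraMap AA FF (powA (1 / 2)), ?_, ?_⟩
    · rw [star_algebraMap_fractionRing, star_powA]
    · rw [← map_pow]
      congr 1
      apply Subtype.ext
      funext p
      show ((powA (1 / 2)).1 p) ^ 2 = (powA 1).1 p
      rw [powA_apply, powA_apply, ← Complex.ofReal_pow, ← Real.rpow_natCast,
        ← Real.rpow_mul p.2.le]
      congr 2
      push_cast
      ring
  ne_zero := by
    intro h
    have h1 : powA 1 = 0 := by
      apply IsFractionRing.injective AA FF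
      rw [h, map_zero]
    have h2 := congrFun (congrArg Subtype.val h1) (⟨(1, 0), one_pos⟩ : Base)
    have h3 : ((1 : ℝ) ^ ((1 : ℝ) * 0) : ℝ) = (0 : ℂ) := h2
    simp at h3
  not_root := by
    intro n hn h
    have h1 : powA 1 ^ n = 1 := by
      apply IsFractionRing.injective AA FF
      rw [map_pow, h, map_one]
    have h2 := congrFun (congrArg Subtype.val h1) (⟨(2, 1), two_pos⟩ : Base)
    have h3 : (((2 : ℝ) ^ ((1 : ℝ) * 1) : ℝ) : ℂ) ^ n = 1 := h2
    have h4 : (2 : ℝ) ^ n = 1 := by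
      have : ((2 : ℂ)) ^ n = 1 := by simpa using h3
      exact_mod_cast this
    exact absurd h4 (one_lt_pow₀ (by norm_num) hn.ne').ne'

/-- The admissible parameter `q^t` of `ℂ`, for `q > 0`, `q ≠ 1` and `t ≠ 0`. -/
def qC (q t : ℝ) (hq : 0 < q) (hq1 : q ≠ 1) (ht : t ≠ 0) : QParam ℂ where
  val := ((q ^ t : ℝ) : ℂ)
  exists_sqrt := by
    refine ⟨((q ^ (t / 2) : ℝ) : ℂ), Complex.conj_ofReal _, ?_⟩
    rw [← Complex.ofReal_pow, ← Real.rpow_natCast, ← Real.rpow_mul hq.le]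
    congr 2
    push_cast
    ring
  ne_zero := Complex.ofReal_ne_zero.mpr (Real.rpow_pos_of_pos hq t).ne'
  not_root := by
    intro n hn h
    have h1 : (q ^ t) ^ n = 1 := by exact_mod_cast h
    have h2 : q ^ t = 1 := (pow_eq_one_iff_of_nonneg (Real.rpow_pos_of_pos hq t).le hn.ne').mp h1
    rw [Real.rpow_def_of_pos hq, Real.exp_eq_one_iff] at h2
    rcases mul_eq_zero.mp h2 with h | h
    · exact hq1 (Real.eq_one_of_pos_of_log_eq_zero hq h)
    · exact ht h

/-- The generator `θ_𝔸 = θ_{ϙ^τ}`. -/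
def θF : Uq qF := Uq.θ qF
/-- The generator `x_𝔸 = η⁻¹ (X_{ϙ^τ} - 1)`. -/
def xF : Uq qF := (algebraMap AA FF etaA)⁻¹ • (Uq.X qF - 1)
/-- The generator `z_𝔸 = η⁻¹ Z_{ϙ^τ}`. -/
def zF : Uq qF := (algebraMap AA FF etaA)⁻¹ • Uq.Z qF

/-- The `(𝔸, *)`-algebra `_𝔸U(𝔤)`: the `(𝔸, *)`-subalgebra of `_𝔽U_{ϙ^τ}(𝔤)` generated by `θ_𝔸`,
`x_𝔸` and `z_𝔸`. -/
def AUsub : StarSubalgebra AA (Uq qF) := StarAlgebra.adjoin AA {θF, xF, zF}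

/-- The `(𝔸, *)`-algebra `_𝔸U(𝔤)`. -/
abbrev AU : Type := AUsub

/-- `θ_𝔸` as an element of `_𝔸U(𝔤)`. -/
def θA : AU := ⟨θF, StarAlgebra.subset_adjoin AA _ (by simp)⟩
/-- `x_𝔸` as an element of `_𝔸U(𝔤)`. -/
def xA : AU := ⟨xF, StarAlgebra.subset_adjoin AA _ (by simp)⟩
/-- `z_𝔸` as an element of `_𝔸U(𝔤)`. -/
def zA : AU := ⟨zF, StarAlgebra.subset_adjoin AA _ (by simp)⟩

/-- The free `𝔸`-module `_𝔸𝒪^ε(K)` on the basis `(ζ_{ϙ^τ,n})`. -/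
abbrev AO (ε : ℤˣ) : Type := ZPar ε →₀ AA

/-- The inclusion of `_𝔸𝒪^ε(K)` into `_𝔽𝒪_{ϙ^τ}^ε(K)`, as the `𝔸`-span of the vectors
`ζ_{ϙ^τ,n}`. -/
def AO.incl (ε : ℤˣ) : AO ε →ₗ[AA] OqK FF ε := Finsupp.mapRange.linearMap (Algebra.linearMap AA FF)

/-- The image in `𝔽` of an invertible element of `𝔸`. -/
def toFF (l : AAˣ) : FFˣ := Units.map (algebraMap AA FF : AA →* FF) l

/-- `α` is the `_𝔸U(𝔤)`-module `_𝔸ind(ε, λ)`, namely `_𝔸𝒪^ε(K)` with the action restricted from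
`_𝔽ind_{ϙ^τ}(ε, λ)`. There is at most one such `α`, and there is one exactly when `_𝔸𝒪^ε(K)` is
stable under `_𝔸U(𝔤)`. -/
def IsIntegralInd (ε : ℤˣ) (l : AAˣ) (α : AU →ₐ[AA] Module.End AA (AO ε)) : Prop :=
  ∀ (b : AU) (m : AO ε), AO.incl ε (α b m) = indQ qF ε (toFF l) b.1 (AO.incl ε m)

/-- The map `ev^ε_{q,t}` from `_𝔸𝒪^ε(K)` to a complex vector space with distinguished vectors
`ζ_n`: it is linear with respect to the evaluation at `(q, t)` and maps basis vectors to
the corresponding distinguished vectors. -/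
def evModule {V : Type} [AddCommGroup V] [Module ℂ V] {ε : ℤˣ} (φ : AA →+* ℂ) (ζ : ZPar ε → V) :
    AO ε →+ V :=
  Finsupp.liftAddHom fun n => ((LinearMap.toSpanSingleton ℂ V (ζ n)).toAddMonoidHom).comp
    φ.toAddMonoidHom

theorem evModule_single {V : Type} [AddCommGroup V] [Module ℂ V] {ε : ℤˣ} (φ : AA →+* ℂ)
    (ζ : ZPar ε → V) (n : ZPar ε) (a : AA) :
    evModule φ ζ (Finsupp.single n a) = φ a • ζ n := by
  simp [evModule]

/-! ### Specializations -/

/-- `φB : B → C` is a specialization of the unital `(A, *)`-algebra `B` at the character `φ` of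
`A`: a universal `φ`-linear unital `*`-morphism to a complex unital `*`-algebra. -/
structure IsAlgSpecialization {A B C : Type} [CommRing A] [Ring B] [StarRing B] [Algebra A B]
    [Ring C] [StarRing C] [Algebra ℂ C] [StarModule ℂ C] (φ : A →+* ℂ) (φB : B →+* C) : Prop where
  map_algebraMap : ∀ a : A, φB (algebraMap A B a) = algebraMap ℂ C (φ a)
  map_star : ∀ b : B, φB (star b) = star (φB b)
  universal : ∀ (D : Type w) [Ring D] [StarRing D] [Algebra ℂ D] [StarModule ℂ D] (f : B →+* D),
    (∀ a : A, f (algebraMap A B a) = algebraMap ℂ D (φ a)) → (∀ b : B, f (star b) = star (f b)) →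
    ∃! g : C →⋆ₐ[ℂ] D, ∀ b : B, g (φB b) = f b

/-- Let `φB : B → C` be a ring morphism. The `φB`-linear map `e` from the `B`-module `(M, α)` to the
`C`-module `(V, ρ)` is a universal `φB`-linear map from `(M, α)` to a `C`-module. -/
structure IsModSpecialization {A B C M V : Type} [CommRing A] [Ring B] [Algebra A B] [Ring C]
    [Algebra ℂ C] [AddCommGroup M] [Module A M] [AddCommGroup V] [Module ℂ V]
    (φB : B →+* C) (α : B →ₐ[A] Module.End A M) (ρ : C →ₐ[ℂ] Module.End ℂ V) (e : M →+ V) :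
    Prop where
  map_smul : ∀ (b : B) (m : M), e (α b m) = ρ (φB b) (e m)
  universal : ∀ (N : Type w) [AddCommGroup N] [Module C N] (f : M →+ N),
    (∀ (b : B) (m : M), f (α b m) = φB b • f m) →
    ∃! g : V →+ N, (∀ (c : C) (v : V), g (ρ c v) = c • g v) ∧ ∀ m : M, g (e m) = f m

/-! ### Enveloping `*`-algebras of real Lie algebras -/

attribute [local instance 100] LieRing.ofAssociativeRing

section Enveloping

open MulOpposite

variable (L : Type) [LieRing L] [LieAlgebra ℝ L]

/-- The antimultiplicative extension of `x ↦ -x` to the universal enveloping algebra. -/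
def uStar : UniversalEnvelopingAlgebra ℝ L →ₐ[ℝ] (UniversalEnvelopingAlgebra ℝ L)ᵐᵒᵖ :=
  UniversalEnvelopingAlgebra.lift ℝ
    { toFun := fun x => op (-UniversalEnvelopingAlgebra.ι ℝ x)
      map_add' := fun x y => by rw [map_add, neg_add, op_add]
      map_smul' := fun r x => by rw [map_smul, ← smul_neg, op_smul]; rfl
      map_lie' := fun {x y} => by
        apply unop_injective
        simp only [LieHom.map_lie, LieRing.of_associative_ring_bracket, unop_sub, unop_mul, unop_op]
        noncomm_ring }

theorem uStar_ι (x : L) :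
    uStar L (UniversalEnvelopingAlgebra.ι ℝ x) = op (-UniversalEnvelopingAlgebra.ι ℝ x) :=
  UniversalEnvelopingAlgebra.lift_ι_apply ℝ _ x

theorem uStar_uStar (a : UniversalEnvelopingAlgebra ℝ L) : unop (uStar L (unop (uStar L a))) = a := by
  let f : UniversalEnvelopingAlgebra ℝ L →ₐ[ℝ] UniversalEnvelopingAlgebra ℝ L :=
    ((AlgEquiv.opOp ℝ (UniversalEnvelopingAlgebra ℝ L)).symm.toAlgHom.comp
      (AlgHom.op (uStar L))).comp (uStar L)
  have : f = AlgHom.id ℝ _ := by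
    apply UniversalEnvelopingAlgebra.hom_ext
    apply LieHom.ext
    intro x
    change unop (uStar L (unop (uStar L (UniversalEnvelopingAlgebra.ι ℝ x))))
      = UniversalEnvelopingAlgebra.ι ℝ x
    rw [uStar_ι, unop_op, map_neg, uStar_ι, unop_neg, unop_op, neg_neg]
  exact DFunLike.congr_fun this a

/-- The involution of the real enveloping algebra for which elements of `L` are skew-adjoint. -/
instance : StarRing (UniversalEnvelopingAlgebra ℝ L) where
  star a := unop (uStar L a)
  star_involutive := uStar_uStar L
  star_mul a b := by simp
  star_add a b := by simp

instance : StarModule ℝ (UniversalEnvelopingAlgebra ℝ L) :=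
  ⟨fun r a => by
    show unop (uStar L (r • a)) = star r • unop (uStar L a)
    simp⟩

/-- The enveloping `*`-algebra of a real Lie algebra: the complexification of its universal
enveloping algebra, with the involution for which elements of the Lie algebra are skew-adjoint. -/
abbrev CEnv : Type := ℂ ⊗[ℝ] UniversalEnvelopingAlgebra ℝ L

instance : StarModule ℂ (CEnv L) :=
  ⟨fun z a => by
    induction a using TensorProduct.induction_on with
    | zero => simp
    | tmul w u => simp [TensorProduct.smul_tmul']
    | add a b ha hb => rw [smul_add, star_add, ha, hb, star_add, smul_add]⟩

variable {L}

/-- An element of the Lie algebra, seen in the enveloping `*`-algebra. -/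
def toEnv (x : L) : CEnv L := 1 ⊗ₜ[ℝ] UniversalEnvelopingAlgebra.ι ℝ x

theorem star_toEnv (x : L) : star (toEnv x) = -toEnv x := by
  show star ((1 : ℂ) ⊗ₜ[ℝ] UniversalEnvelopingAlgebra.ι ℝ x) = _
  rw [TensorProduct.star_tmul]
  have : star (UniversalEnvelopingAlgebra.ι ℝ x) = -UniversalEnvelopingAlgebra.ι ℝ x := by
    show unop (uStar L _) = _
    rw [uStar_ι, unop_op]
  rw [this, star_one, TensorProduct.tmul_neg]
  rfl

end Enveloping

/-! ### `SL(2, ℝ)`, its maximal compact subgroup and its Cartan motion group -/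

open Matrix

/-- `G = SL(2, ℝ)`. -/
abbrev SL2 : Type := Matrix.SpecialLinearGroup (Fin 2) ℝ

/-- `K = SO(2)`, as a subgroup of `G`. -/
def SO2 : Subgroup SL2 where
  carrier := {g | (g : Matrix (Fin 2) (Fin 2) ℝ) * (g : Matrix (Fin 2) (Fin 2) ℝ)ᵀ = 1}
  mul_mem' {g h} hg hh := by
    change g.1 * g.1ᵀ = 1 at hg
    change h.1 * h.1ᵀ = 1 at hh
    change g.1 * h.1 * (g.1 * h.1)ᵀ = 1
    rw [transpose_mul, mul_assoc, ← mul_assoc h.1, hh, one_mul, hg]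
  one_mem' := by
    change (1 : Matrix (Fin 2) (Fin 2) ℝ) * 1ᵀ = 1
    simp
  inv_mem' {g} hg := by
    change g.1 * g.1ᵀ = 1 at hg
    change (g⁻¹).1 * (g⁻¹).1ᵀ = 1
    have h2 : (g⁻¹).1 * g.1 = 1 := congrArg Subtype.val (inv_mul_cancel g)
    rw [left_inv_eq_right_inv h2 hg, transpose_transpose]
    exact mul_eq_one_comm.mp hg

/-- The rotation `e^{isθ}`, where `θ = !![0, i; -i, 0]`. -/
def rot (s : ℝ) : SO2 :=
  ⟨⟨!![Real.cos s, -Real.sin s; Real.sin s, Real.cos s], by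
    rw [det_fin_two_of]; nlinarith [Real.sin_sq_add_cos_sq s]⟩, by
    show !![Real.cos s, -Real.sin s; Real.sin s, Real.cos s]
      * !![Real.cos s, -Real.sin s; Real.sin s, Real.cos s]ᵀ = 1
    ext i j
    fin_cases i <;> fin_cases j <;> simp [Matrix.mul_apply, Fin.sum_univ_two] <;>
      nlinarith [Real.sin_sq_add_cos_sq s]⟩

/-- The character `ζ_n` of `K`, such that `ζ_n(e^{isθ}) = e^{ins}`. -/
def zeta (n : ℤ) (k : SO2) : ℂ :=
  (((k.1.1 0 0 : ℝ) : ℂ) + ((k.1.1 1 0 : ℝ) : ℂ) * Complex.I) ^ n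

theorem zeta_rot (n : ℤ) (s : ℝ) : zeta n (rot s) = Complex.exp (Complex.I * n * s) := by
  have : zeta n (rot s) = (((Real.cos s : ℝ) : ℂ) + ((Real.sin s : ℝ) : ℂ) * Complex.I) ^ n := rfl
  rw [this, Complex.ofReal_cos, Complex.ofReal_sin, ← Complex.exp_mul_I, ← Complex.exp_int_mul]
  congr 1
  ring

/-- The space `𝒪^ε(K)` of functions on `K` spanned by the characters `ζ_n`, `n ∈ ℤ^ε`. -/
def OK (ε : ℤˣ) : Submodule ℂ (SO2 → ℂ) := Submodule.span ℂ (Set.range fun n : ZPar ε => zeta n.1)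

/-- `ζ_n` as an element of `𝒪^ε(K)`. -/
def zetaK {ε : ℤˣ} (n : ZPar ε) : OK ε := ⟨zeta n.1, Submodule.subset_span ⟨n, rfl⟩⟩

/-- `𝔤 = sl(2, ℝ)`. -/
abbrev sl2 : LieSubalgebra ℝ (Matrix (Fin 2) (Fin 2) ℝ) := LieAlgebra.SpecialLinear.sl (Fin 2) ℝ

theorem mem_sl2 {a b c d : ℝ} (h : a + d = 0) : !![a, b; c, d] ∈ sl2 := by
  change trace !![a, b; c, d] = 0
  simpa [trace_fin_two] using h

/-- The element `H` of `sl(2, ℝ)`. -/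
def eH : sl2 := ⟨!![1, 0; 0, -1], mem_sl2 (by norm_num)⟩
/-- The element `E` of `sl(2, ℝ)`. -/
def eE : sl2 := ⟨!![0, 1; 0, 0], mem_sl2 (by norm_num)⟩
/-- The element `F` of `sl(2, ℝ)`. -/
def eF : sl2 := ⟨!![0, 0; 1, 0], mem_sl2 (by norm_num)⟩

/-- `𝔨 = so(2)`, as a Lie subalgebra of `𝔤`: the skew-symmetric matrices. -/
def so2 : LieSubalgebra ℝ sl2 where
  carrier := {Y | (Y : Matrix (Fin 2) (Fin 2) ℝ)ᵀ = -(Y : Matrix (Fin 2) (Fin 2) ℝ)}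
  add_mem' {Y Z} hY hZ := by
    change Y.1ᵀ = -Y.1 at hY
    change Z.1ᵀ = -Z.1 at hZ
    change (Y.1 + Z.1)ᵀ = -(Y.1 + Z.1)
    rw [transpose_add, hY, hZ, neg_add]
  zero_mem' := by
    change (0 : Matrix (Fin 2) (Fin 2) ℝ)ᵀ = -0
    simp
  smul_mem' r Y hY := by
    change Y.1ᵀ = -Y.1 at hY
    change (r • Y.1)ᵀ = -(r • Y.1)
    rw [transpose_smul, hY, smul_neg]
  lie_mem' {Y Z} hY hZ := by
    change Y.1ᵀ = -Y.1 at hY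
    change Z.1ᵀ = -Z.1 at hZ
    change (Y.1 * Z.1 - Z.1 * Y.1)ᵀ = -(Y.1 * Z.1 - Z.1 * Y.1)
    rw [transpose_sub, transpose_mul, transpose_mul, hY, hZ]
    noncomm_ring

/-- The element `iθ = F - E` of `𝔨`. -/
def iθk : so2 := ⟨eF - eE, by
  change (eF.1 - eE.1)ᵀ = -(eF.1 - eE.1)
  ext i j
  fin_cases i <;> fin_cases j <;> simp [eF, eE]⟩

/-- `𝔤/𝔨`, with the adjoint action of `𝔨`. -/
def gModK : Type := sl2 ⧸ so2.toLieSubmodule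

instance : AddCommGroup gModK := inferInstanceAs (AddCommGroup (sl2 ⧸ so2.toLieSubmodule))
instance : Module ℝ gModK := inferInstanceAs (Module ℝ (sl2 ⧸ so2.toLieSubmodule))
instance : LieRingModule so2 gModK := inferInstanceAs (LieRingModule so2 (sl2 ⧸ so2.toLieSubmodule))
instance : LieModule ℝ so2 gModK := inferInstanceAs (LieModule ℝ so2 (sl2 ⧸ so2.toLieSubmodule))

/-- `𝔤/𝔨` is viewed as an abelian Lie algebra. -/
instance : LieRing gModK where
  bracket _ _ := 0
  add_lie _ _ _ := (add_zero 0).symm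
  lie_add _ _ _ := (add_zero 0).symm
  lie_self _ := rfl
  leibniz_lie _ _ _ := (add_zero 0).symm

instance : LieAlgebra ℝ gModK where
  lie_smul r _ _ := (smul_zero r).symm

theorem gModK_lie (v w : gModK) : ⁅v, w⁆ = 0 := rfl

/-- The class modulo `𝔨` of an element of `𝔤`. -/
def modK (Y : sl2) : gModK := LieSubmodule.Quotient.mk (N := so2.toLieSubmodule) Y

/-- The adjoint action of `𝔨` on `𝔤/𝔨` by derivations. -/
def adModK : so2 →ₗ⁅ℝ⁆ LieDerivation ℝ gModK gModK where
  toFun x :=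
    { toLinearMap := LieModule.toEnd ℝ so2 gModK x
      leibniz' := fun v w => by
        simp [gModK_lie] }
  map_add' x y := by ext v; simp
  map_smul' r x := by ext v; simp
  map_lie' {x y} := by ext v; simp

/-- The Lie algebra `𝔤₀ = 𝔨 ⋉ 𝔤/𝔨` of the Cartan motion group. -/
abbrev g0 : Type := LieAlgebra.SemiDirectSum gModK so2 adModK

/-- The element of `𝔤₀` defined by an element of `𝔨`. -/
def g0k (x : so2) : g0 := LieAlgebra.SemiDirectSum.inr adModK x

/-- The element of `𝔤₀` defined by an element of `𝔤/𝔨`. -/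
def g0p (v : gModK) : g0 := LieAlgebra.SemiDirectSum.inl adModK v

/-! ### Principal series of `SL(2, ℝ)` -/

/-- The space of the functions `f` on `G` such that `f(pg) = χ(p) f(g)` for every `p` in the
group `P` of upper triangular matrices, where `χ(p) = χ_{ε,μ}(p) |a|` and `χ_{ε,μ}(p) = |a|^μ`
or `ε |a|^μ` according to the sign of the upper left entry `a` of `p`, whose restriction to `K` is
`K`-finite. The factor `|a|` is the normalizing shift of parabolic induction. -/
def IndSpace (ε : ℤˣ) (μ : ℂ) : Submodule ℂ (SL2 → ℂ) where
  carrier := {f | (∀ p g : SL2, p.1 1 0 = 0 →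
      f (p * g) = (if p.1 0 0 < 0 then ((ε : ℤ) : ℂ) else 1) *
        ((|p.1 0 0| : ℝ) : ℂ) ^ (μ + 1) * f g) ∧
    (fun k : SO2 => f k.1) ∈ OK ε}
  add_mem' {f g} hf hg := by
    refine ⟨fun p x hp => ?_, (OK ε).add_mem hf.2 hg.2⟩
    rw [Pi.add_apply, Pi.add_apply, hf.1 p x hp, hg.1 p x hp]
    ring
  zero_mem' := ⟨fun _ _ _ => (mul_zero _).symm, (OK ε).zero_mem⟩
  smul_mem' c f hf := by
    refine ⟨fun p x hp => ?_, (OK ε).smul_mem c hf.2⟩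
    rw [Pi.smul_apply, Pi.smul_apply, hf.1 p x hp, smul_eq_mul, smul_eq_mul]
    ring

/-- `γ` is the one-parameter subgroup `s ↦ exp(sY)` of `G`. -/
def IsOneParam (γ : Multiplicative ℝ →* SL2) (Y : sl2) : Prop :=
  ∀ i j, HasDerivAt (fun s : ℝ => (γ (Multiplicative.ofAdd s)).1 i j) (Y.1 i j) 0

/-- `ρ` is the `U(𝔤)`-module `ind(ε, μ)` on `𝒪^ε(K)`, in the compact picture: restriction to `K`
identifies the space of functions induced from `χ_{ε,μ}` with `𝒪^ε(K)`, and `𝔤` acts by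
differentiating right translations. -/
def IsPrincipalSeries (ε : ℤˣ) (μ : ℂ) (ρ : CEnv sl2 →ₐ[ℂ] Module.End ℂ (OK ε)) : Prop :=
  ∃ Φ : OK ε ≃ₗ[ℂ] IndSpace ε μ, (∀ (ψ : OK ε) (k : SO2), (Φ ψ).1 k.1 = ψ.1 k) ∧
    ∀ (Y : sl2) (γ : Multiplicative ℝ →* SL2), IsOneParam γ Y → ∀ (ψ : OK ε) (g : SL2),
      HasDerivAt (fun s : ℝ => (Φ ψ).1 (g * γ (Multiplicative.ofAdd s)))
        ((Φ (ρ (toEnv Y) ψ)).1 g) 0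

/-! ### Representations of the motion group -/

/-- `ρ` is the `U(𝔤₀)`-module `ind(p_μ, M, ε)` on `𝒪^ε(K)`: `𝔨` acts by differentiating right
translations and `v ∈ 𝔤/𝔨` acts on `ψ` by `(v ψ)(k) = χ(Ad(k) v) ψ(k)`, where `χ : 𝔤/𝔨 → ℂ` is the
real-linear map such that `χ(H) = μ` and `χ(E) = 0`, that is `Y ↦ μ Y₀₀` in terms of matrices;
equivalently `χ(δX) = μ / 2` and `χ(δZ) = 0`. -/
def IsMotionInd (ε : ℤˣ) (μ : ℂ) (ρ : CEnv g0 →ₐ[ℂ] Module.End ℂ (OK ε)) : Prop :=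
  (∀ (ψ : OK ε) (k : SO2),
    HasDerivAt (fun s : ℝ => ψ.1 (k * rot s)) ((ρ (toEnv (g0k iθk)) ψ).1 k) 0) ∧
  ∀ (Y : sl2) (ψ : OK ε) (k : SO2), (ρ (toEnv (g0p (modK Y))) ψ).1 k
    = μ * (((k.1.1 * Y.1 * (k.1⁻¹).1) 0 0 : ℝ) : ℂ) * ψ.1 k

/-! ### The transformation groupoid of `K \ U` -/

/-- The defining relations of `U(𝔤₀^⋆)`: those of the universal commutative `*`-algebra
`𝒪(K\U)` on `X` and `Z` with `Z* = Z` and `X X* + Z² = 1`, and the commutation relations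
`θ f - f θ = θ # f` for `f = T, T⁺, T⁻`, where `T = X + X*` is fixed by `K` and `T^± = X - X* ∓ 2Z`
transforms under `K` by the character `ζ_{±2}`. -/
inductive G0starRel : FreeAlgebra ℂ (Gen ⊕ Gen) → FreeAlgebra ℂ (Gen ⊕ Gen) → Prop
  | Z_star : G0starRel (fZs ℂ) (fZ ℂ)
  | θ_star : G0starRel (fθs ℂ) (fθ ℂ)
  | XXs_comm : G0starRel (fX ℂ * fXs ℂ) (fXs ℂ * fX ℂ)
  | XZ_comm : G0starRel (fX ℂ * fZ ℂ) (fZ ℂ * fX ℂ)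
  | sphere : G0starRel (fX ℂ * fXs ℂ + fZ ℂ ^ 2) 1
  | θT : G0starRel (fθ ℂ * (fX ℂ + fXs ℂ) - (fX ℂ + fXs ℂ) * fθ ℂ) 0
  | θTplus : G0starRel
      (fθ ℂ * (fX ℂ - fXs ℂ - 2 * fZ ℂ) - (fX ℂ - fXs ℂ - 2 * fZ ℂ) * fθ ℂ)
      (2 * (fX ℂ - fXs ℂ - 2 * fZ ℂ))
  | θTminus : G0starRel
      (fθ ℂ * (fX ℂ - fXs ℂ + 2 * fZ ℂ) - (fX ℂ - fXs ℂ + 2 * fZ ℂ) * fθ ℂ)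
      (-2 * (fX ℂ - fXs ℂ + 2 * fZ ℂ))

/-- The enveloping `*`-algebra `U(𝔤₀^⋆)` of the transformation groupoid `K\U ⋊ K`. -/
abbrev UG0star : Type := StarPresented G0starRel

namespace UG0star

/-- The function `X` on `K\U`. -/
abbrev X : UG0star := StarPresented.gen _ Gen.X
/-- The function `Z` on `K\U`. -/
abbrev Z : UG0star := StarPresented.gen _ Gen.Z
/-- The generator `θ` of `U(𝔨)`. -/
abbrev θ : UG0star := StarPresented.gen _ Gen.θ

end UG0star

/-- The translate `p · k = k⁻¹ p k` of a point of the (complexified) sphere `K\U`. A point is given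
by the matrix `!![z, i x'; -i x, -z]` of the values `x, x', z` of the coordinate functions
`X, X*, Z`; it belongs to `K\U` itself when this matrix is Hermitian. -/
def translate (p : Matrix (Fin 2) (Fin 2) ℂ) (k : SO2) : Matrix (Fin 2) (Fin 2) ℂ :=
  (k.1⁻¹).1.map Complex.ofReal * p * k.1.1.map Complex.ofReal

/-- The point `p^⋆_μ`, at which `X`, `X*` and `Z` take the values `μ`, `μ⁻¹` and `0`. -/
def pStar (μ : ℂ) : Matrix (Fin 2) (Fin 2) ℂ := !![0, Complex.I * μ⁻¹; -Complex.I * μ, 0]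

/-- `ρ` is the `U(𝔤₀^⋆)`-module `ind(p^⋆_μ, M, ε)` on `𝒪^ε(K)`: `θ` acts by differentiating right
translations along `s ↦ e^{isθ}` and `f ∈ {X, X*, Z}` acts by `(f ψ)(k) = f(p^⋆_μ · k) ψ(k)`. -/
def IsGroupoidInd (ε : ℤˣ) (μ : ℂ) (ρ : UG0star →ₐ[ℂ] Module.End ℂ (OK ε)) : Prop :=
  (∀ (ψ : OK ε) (k : SO2),
    HasDerivAt (fun s : ℝ => ψ.1 (k * rot s)) (Complex.I * (ρ UG0star.θ ψ).1 k) 0) ∧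
  ∀ (ψ : OK ε) (k : SO2),
    (ρ UG0star.X ψ).1 k = Complex.I * translate (pStar μ) k 1 0 * ψ.1 k ∧
    (ρ (star UG0star.X) ψ).1 k = -Complex.I * translate (pStar μ) k 0 1 * ψ.1 k ∧
    (ρ UG0star.Z ψ).1 k = translate (pStar μ) k 0 0 * ψ.1 k

/-! ### The evaluation morphisms -/

/-- `ev : _𝔸U(𝔤) → C` is the specialization of `_𝔸U(𝔤)` at `(q, t)` whose values at `x_𝔸`, `z_𝔸`
and `θ_𝔸` are `x`, `z` and `θ`. -/
def IsEv {C : Type} [Ring C] [StarRing C] [Algebra ℂ C] [StarModule ℂ C] (q t : ℝ) (hq : 0 < q)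
    (x z θ : C) (ev : AU →+* C) : Prop :=
  IsAlgSpecialization.{w} (evalAt q t hq) ev ∧ ev xA = x ∧ ev zA = z ∧ ev θA = θ

/-- `ρ` is the unique `C`-module structure on `V` for which the map `ev^ε_{q,t} : _𝔸𝒪^ε(K) → V` is a
specialization, with respect to `ev : _𝔸U(𝔤) → C`, of the `_𝔸U(𝔤)`-module `α`. -/
def IsTheSpecialization {C V : Type} [Ring C] [Algebra ℂ C] [AddCommGroup V] [Module ℂ V] {ε : ℤˣ}
    (q t : ℝ) (hq : 0 < q) (ev : AU →+* C) (α : AU →ₐ[AA] Module.End AA (AO ε)) (ζ : ZPar ε → V)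
    (ρ : C →ₐ[ℂ] Module.End ℂ V) : Prop :=
  IsModSpecialization.{w} (M := AO ε) ev α ρ (evModule (evalAt q t hq) ζ) ∧
    ∀ ρ' : C →ₐ[ℂ] Module.End ℂ V,
      IsModSpecialization.{w} (M := AO ε) ev α ρ' (evModule (evalAt q t hq) ζ) → ρ' = ρ

end QMackey

end

open QMackey

set_option linter.unusedSimpArgs false
set_option linter.unusedSectionVars false

noncomputable section

namespace QMackey

open scoped TensorProduct

/-! The family of algebras is controlled by a presentation whose coefficients are functions on the
base. The generators `x`, `y = x*`, `z`, `θ` of the integral form satisfy the relations `SpecRel`,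
which are polynomial in `ϙ^τ`, `ϙ^(-τ)`, `τ` and `η`, with no division by `η`. The crucial point is
that these relations define the integral form (`exists_algHom_AU`). Indeed, in any algebra generated
by elements satisfying them, the ordered monomials in `x`, `w`, `z`, `θ` span (`span_mon`), where
`w` is defined by `w = x y + q² z²` and satisfies `x + y = -η w`. In the quantized enveloping
algebra over the fraction field the same monomials are linearly independent
(`linearIndependent_mon_uq`, by a polynomial model with a free Casimir parameter). Hence nothing is
lost in passing from generators and relations to the subalgebra.

Consequently the specialization at `(q, t)` is the complex algebra presented by the evaluated
relations, and it remains to recognize four algebras. If `η(q, t) ≠ 0`, the substitution `X = 1 + η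
x`, `Z = η z` turns the relations into those of `U_{q^t}(𝔤)`, or of `U(𝔤₀^⋆)` when `t = 0`. If `q =
1`, then `η = 0` and everything linearizes: `y = -x`, and the other relations become Lie brackets
(`specRelAt_one_iff`), those of `sl(2)` for `t ≠ 0` and of the motion algebra for `t = 0`.

For modules, the matrix coefficients of `x` and `z` are quotients by `η` of functions which vanish
on the line `q = 1`, precisely because `λ(1, t) = 1`. An analytic function vanishing there is a
multiple of `η`, and the quotient restricts to half of the derivative in `q` (`exists_eq_etaA_mul`).
This gives stability of the `𝔸`-span (`exists_isIntegralInd`) and also produces the parameter `∂λ(1,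
t)` in the limit. Since the evaluation maps are surjective and the `ζ_n` form bases, the universal
property and the uniqueness of the specialized module are formal (`isTheSpecialization`). The last
task is to identify the tridiagonal operators so obtained with the classical modules: multiplication
operators on `K` for the two groupoid-like cases, and the compact picture of the principal series
for `SL(2, ℝ)`. -/

/-! ### Division of analytic functions -/

section Division

open MeasureTheory Filter Topology NNReal ENNReal

/-- The average of an analytic function along a path of contractions is analytic. -/
theorem analyticAt_integral_comp_contraction {E G : Type*} [NormedAddCommGroup E] [NormedSpace ℝ E]
    [NormedAddCommGroup G] [NormedSpace ℝ G] [CompleteSpace G] {f : E → G} {x : E}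
    (hf : AnalyticAt ℝ f x) (A : ℝ → E →L[ℝ] E) (hA : Continuous A)
    (hA1 : ∀ s ∈ Set.uIcc (0 : ℝ) 1, ‖A s‖ ≤ 1) :
    AnalyticAt ℝ (fun y => ∫ s in (0 : ℝ)..1, f (x + A s (y - x))) x := by
  obtain ⟨p, r, hp⟩ := hf
  obtain ⟨r', hr'0, hr'⟩ := ENNReal.lt_iff_exists_nnreal_btwn.mp hp.r_pos
  have hr'p : (r' : ℝ≥0∞) < p.radius := lt_of_lt_of_le hr' hp.r_le
  have hcont : ∀ n, Continuous fun s => (p n).compContinuousLinearMap fun _ => A s := fun n => by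
    have h1 := (ContinuousMultilinearMap.compContinuousLinearMapContinuousMultilinear ℝ
      (fun _ : Fin n => E) (fun _ : Fin n => E) G).cont
    have h2 : Continuous fun s => (fun _ : Fin n => A s) := continuous_pi fun _ => hA
    exact (h1.comp h2).clm_apply continuous_const
  have hpow : ∀ (n : ℕ), ∀ s ∈ Set.uIcc (0 : ℝ) 1,
      ‖(p n).compContinuousLinearMap fun _ => A s‖ ≤ ‖p n‖ := fun n s hs => by
    refine (ContinuousMultilinearMap.norm_compContinuousLinearMap_le _ _).trans ?_
    refine mul_le_of_le_one_right (norm_nonneg _) ?_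
    exact Finset.prod_le_one (fun _ _ => norm_nonneg _) fun _ _ => hA1 s hs
  -- The Taylor series of the average is the average of the Taylor series precomposed with `A s`.
  -- Contractions do not increase the norms of the coefficients, so every radius `r'` below that of
  -- `p` remains available.
  let Q : FormalMultilinearSeries ℝ E G := fun n =>
    ∫ s in (0 : ℝ)..1, (p n).compContinuousLinearMap fun _ => A s
  have hQ : ∀ n, ‖Q n‖ ≤ ‖p n‖ := fun n => by
    have := intervalIntegral.norm_integral_le_of_norm_le_const (a := (0 : ℝ)) (b := 1)
      (f := fun s => (p n).compContinuousLinearMap fun _ => A s) (C := ‖p n‖)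
      fun s hs => hpow n s (Set.uIoc_subset_uIcc hs)
    simpa using this
  have hQapp : ∀ n (y : E), Q n (fun _ => y) = ∫ s in (0 : ℝ)..1, p n fun _ => A s y := fun n y => by
    have h1 := (ContinuousMultilinearMap.apply ℝ (fun _ : Fin n => E) G
      (fun _ => y)).intervalIntegral_comp_comm ((hcont n).intervalIntegrable (μ := volume) 0 1)
    exact h1.symm
  refine ⟨Q, r', ?_, by exact_mod_cast hr'0, ?_⟩
  · obtain ⟨C, -, hC⟩ := p.norm_mul_pow_le_of_lt_radius hr'p
    exact Q.le_radius_of_bound C fun n =>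
      (mul_le_mul_of_nonneg_right (hQ n) (by positivity)).trans (hC n)
  · intro y hy
    simp only [hQapp, add_sub_cancel_left]
    have hy' : ‖y‖ < r' := by simpa using hy
    have hAy : ∀ s ∈ Set.uIcc (0 : ℝ) 1, ‖A s y‖ ≤ ‖y‖ := fun s hs =>
      ((A s).le_opNorm y).trans (mul_le_of_le_one_left (norm_nonneg _) (hA1 s hs))
    have hsum : Summable fun n => ‖p n‖ * ‖y‖ ^ n := by
      refine Summable.of_nonneg_of_le (fun n => by positivity) (fun n => ?_)
        (p.summable_norm_mul_pow hr'p)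
      gcongr
    -- Sum and integral are exchanged with the dominating series `∑ ‖p n‖ ‖y‖ ^ n`, which is
    -- independent of `s`.
    refine intervalIntegral.hasSum_integral_of_dominated_convergence
      (fun n _ => ‖p n‖ * ‖y‖ ^ n) (fun n => ?_) (fun n => ?_) ?_ ?_ ?_
    · refine Continuous.aestronglyMeasurable ?_
      exact (p n).cont.comp (continuous_pi fun _ => hA.clm_apply continuous_const)
    · refine Eventually.of_forall fun s hs => ?_
      refine ((p n).le_opNorm _).trans ?_
      rw [Finset.prod_const, Finset.card_univ, Fintype.card_fin]
      gcongr
      exact hAy s (Set.uIoc_subset_uIcc hs)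
    · exact Eventually.of_forall fun s _ => hsum
    · exact intervalIntegrable_const
    · refine Eventually.of_forall fun s hs => hp.hasSum ?_
      have : ‖A s y‖ < r' := (hAy s (Set.uIoc_subset_uIcc hs)).trans_lt hy'
      refine Metric.eball_subset_eball hr'.le ?_
      simpa using this

/-- The linear map `(h, k) ↦ (s h, k)`. -/
def dilate (s : ℝ) : ℝ × ℝ →L[ℝ] ℝ × ℝ :=
  s • (ContinuousLinearMap.inl ℝ ℝ ℝ).comp (ContinuousLinearMap.fst ℝ ℝ ℝ) +
    (ContinuousLinearMap.inr ℝ ℝ ℝ).comp (ContinuousLinearMap.snd ℝ ℝ ℝ)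

theorem dilate_apply (s : ℝ) (y : ℝ × ℝ) : dilate s y = (s * y.1, y.2) := by
  simp [dilate]

theorem continuous_dilate : Continuous dilate := by
  unfold dilate; fun_prop

theorem norm_dilate_le {s : ℝ} (hs : s ∈ Set.uIcc (0 : ℝ) 1) : ‖dilate s‖ ≤ 1 := by
  rw [Set.uIcc_of_le zero_le_one] at hs
  refine ContinuousLinearMap.opNorm_le_bound _ zero_le_one fun y => ?_
  rw [dilate_apply, one_mul]
  refine max_le ?_ (le_max_right _ _)
  refine le_trans ?_ (le_max_left _ _)
  rw [norm_mul, Real.norm_of_nonneg hs.1]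
  exact mul_le_of_le_one_left (norm_nonneg _) hs.2

/-- An analytic function vanishing on the line `x = a` is divisible by `x - a`. -/
theorem exists_eq_sub_mul_of_analyticAt {f : ℝ × ℝ → ℂ} {a b : ℝ} (hf : AnalyticAt ℝ f (a, b))
    (h0 : ∀ t, f (a, t) = 0) :
    ∃ g : ℝ × ℝ → ℂ, AnalyticAt ℝ g (a, b) ∧ ∀ᶠ p in 𝓝 (a, b), f p = (p.1 - a : ℝ) * g p := by
  have hd : AnalyticAt ℝ (fun p => fderiv ℝ f p (1, 0)) (a, b) :=
    (ContinuousLinearMap.apply ℝ ℂ ((1 : ℝ), (0 : ℝ))).analyticAt _ |>.comp hf.fderiv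
  -- Hadamard's lemma: the quotient is the integral over `s ∈ [0, 1]` of the first partial
  -- derivative at `(a + s (x - a), t)`. The fundamental theorem of calculus along this segment
  -- yields `f (x, t) - f (a, t)`, and the last term vanishes by `h0`.
  refine ⟨_, analyticAt_integral_comp_contraction hd dilate continuous_dilate
    fun s hs => norm_dilate_le hs, ?_⟩
  obtain ⟨δ, hδ, hball⟩ := Metric.eventually_nhds_iff_ball.mp
    hf.eventually_analyticAt
  filter_upwards [Metric.ball_mem_nhds (a, b) hδ] with p hp
  have hmem : ∀ s ∈ Set.uIcc (0 : ℝ) 1, (a, b) + dilate s (p - (a, b)) ∈ Metric.ball (a, b) δ := by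
    intro s hs
    rw [mem_ball_iff_norm, add_sub_cancel_left]
    refine (((dilate s).le_opNorm _).trans
      (mul_le_of_le_one_left (norm_nonneg _) (norm_dilate_le hs))).trans_lt ?_
    rwa [mem_ball_iff_norm] at hp
  have hval : ∀ s, (a, b) + dilate s (p - (a, b)) = (a + s * (p.1 - a), p.2) := fun s => by
    rw [dilate_apply]; ext <;> simp
  have hderiv : ∀ s ∈ Set.uIcc (0 : ℝ) 1, HasDerivAt (fun s : ℝ => f (a + s * (p.1 - a), p.2))
      ((p.1 - a) • fderiv ℝ f ((a, b) + dilate s (p - (a, b))) (1, 0)) s := by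
    intro s hs
    have h1 := (hball _ (hmem s hs)).differentiableAt.hasFDerivAt
    have h2 : HasDerivAt (fun s : ℝ => (a + s * (p.1 - a), p.2)) ((p.1 - a), (0 : ℝ)) s := by
      have := ((hasDerivAt_id s).mul_const (p.1 - a)).const_add a
      simp only [one_mul, id] at this
      exact this.prodMk (hasDerivAt_const s p.2)
    rw [hval] at h1 ⊢
    have h3 := h1.comp_hasDerivAt s h2
    convert! h3 using 1
    rw [← map_smul]
    simp
  have hcont : ContinuousOn (fun s => (p.1 - a) •
      fderiv ℝ f ((a, b) + dilate s (p - (a, b))) (1, 0)) (Set.uIcc (0 : ℝ) 1) := by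
    intro s hs
    have h1 : ContinuousAt (fderiv ℝ f) ((a, b) + dilate s (p - (a, b))) :=
      (hball _ (hmem s hs)).fderiv.continuousAt
    have h2 : ContinuousAt (fun s => (a, b) + dilate s (p - (a, b))) s :=
      (continuous_const.add (continuous_dilate.clm_apply continuous_const)).continuousAt
    exact ((ContinuousAt.comp (f := fun s => (a, b) + dilate s (p - (a, b))) h1 h2).clm_apply
      continuousAt_const).const_smul (p.1 - a) |>.continuousWithinAt
  have := intervalIntegral.integral_eq_sub_of_hasDerivAt hderiv hcont.intervalIntegrable
  rw [intervalIntegral.integral_smul] at this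
  simp only [one_mul, zero_mul, add_zero, h0, sub_zero, add_sub_cancel] at this
  rw [Complex.real_smul] at this
  exact this.symm

end Division

/-! ### Calculus in the ring of analytic functions -/

section Calculus

open Filter Topology

theorem evalAt_apply (q t : ℝ) (hq : 0 < q) (f : AA) : evalAt q t hq f = f.1 ⟨(q, t), hq⟩ := rfl

theorem extend_eq_evalAt {q : ℝ} (t : ℝ) (hq : 0 < q) (f : AA) :
    extend f.1 (q, t) = evalAt q t hq f := extend_of_pos f.1 (p := (q, t)) hq

theorem AA_ext {f g : AA} (h : ∀ (q t : ℝ) (hq : 0 < q), evalAt q t hq f = evalAt q t hq g) :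
    f = g :=
  Subtype.ext (funext fun p => h p.1.1 p.1.2 p.2)

theorem evalAt_powA (q t : ℝ) (hq : 0 < q) (c : ℝ) :
    evalAt q t hq (powA c) = ((q ^ (c * t) : ℝ) : ℂ) := rfl

theorem evalAt_tauA (q t : ℝ) (hq : 0 < q) : evalAt q t hq tauA = t := rfl

theorem evalAt_etaA (q t : ℝ) (hq : 0 < q) : evalAt q t hq etaA = etaFun q t := rfl

theorem evalAt_algebraMap (q t : ℝ) (hq : 0 < q) (c : ℂ) :
    evalAt q t hq (algebraMap ℂ AA c) = c := rfl

theorem evalAt_star (q t : ℝ) (hq : 0 < q) (f : AA) :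
    evalAt q t hq (star f) = star (evalAt q t hq f) := rfl

theorem hasDerivAt_partialQ (f : AA) {q : ℝ} (t : ℝ) (hq : 0 < q) :
    HasDerivAt (fun s : ℝ => extend f.1 (s, t)) (partialQ f q t) q := by
  have h1 : DifferentiableAt ℝ (extend f.1) (q, t) := (f.2 (q, t) hq).differentiableAt
  have h2 : DifferentiableAt ℝ (fun s : ℝ => (s, t)) q := by fun_prop
  exact (DifferentiableAt.comp (g := extend f.1) q h1 h2).hasDerivAt

theorem partialQ_eq_of_hasDerivAt {f : AA} {q t : ℝ} (hq : 0 < q) {h : ℝ → ℂ} {d : ℂ}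
    (hd : HasDerivAt h d q) (hf : ∀ (s : ℝ) (hs : 0 < s), evalAt s t hs f = h s) :
    partialQ f q t = d := by
  refine HasDerivAt.deriv (hd.congr_of_eventuallyEq ?_)
  filter_upwards [lt_mem_nhds hq] with s hs
  rw [extend_eq_evalAt t hs, hf s hs]

theorem partialQ_add (f g : AA) {q : ℝ} (t : ℝ) (hq : 0 < q) :
    partialQ (f + g) q t = partialQ f q t + partialQ g q t :=
  partialQ_eq_of_hasDerivAt hq ((hasDerivAt_partialQ f t hq).add (hasDerivAt_partialQ g t hq))
    fun s hs => by simp only [Pi.add_apply]; rw [extend_eq_evalAt t hs, extend_eq_evalAt t hs, map_add]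

theorem partialQ_sub (f g : AA) {q : ℝ} (t : ℝ) (hq : 0 < q) :
    partialQ (f - g) q t = partialQ f q t - partialQ g q t :=
  partialQ_eq_of_hasDerivAt hq ((hasDerivAt_partialQ f t hq).sub (hasDerivAt_partialQ g t hq))
    fun s hs => by simp only [Pi.sub_apply]; rw [extend_eq_evalAt t hs, extend_eq_evalAt t hs, map_sub]

theorem partialQ_mul (f g : AA) {q : ℝ} (t : ℝ) (hq : 0 < q) :
    partialQ (f * g) q t = partialQ f q t * evalAt q t hq g + evalAt q t hq f * partialQ g q t := by
  rw [← extend_eq_evalAt, ← extend_eq_evalAt]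
  exact partialQ_eq_of_hasDerivAt hq
    ((hasDerivAt_partialQ f t hq).mul (hasDerivAt_partialQ g t hq))
    fun s hs => by simp only [Pi.mul_apply]; rw [extend_eq_evalAt t hs, extend_eq_evalAt t hs, map_mul]

theorem partialQ_algebraMap (c : ℂ) {q : ℝ} (t : ℝ) (hq : 0 < q) :
    partialQ (algebraMap ℂ AA c) q t = 0 :=
  partialQ_eq_of_hasDerivAt hq (hasDerivAt_const q c) fun s hs => evalAt_algebraMap s t hs c

theorem partialQ_one {q : ℝ} (t : ℝ) (hq : 0 < q) : partialQ 1 q t = 0 := by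
  rw [← map_one (algebraMap ℂ AA), partialQ_algebraMap _ _ hq]

theorem partialQ_powA_one (c t : ℝ) : partialQ (powA c) 1 t = (c * t : ℝ) := by
  have := (Real.hasDerivAt_rpow_const (x := 1) (p := c * t) (Or.inl one_ne_zero)).ofReal_comp
  simp only [Real.one_rpow, mul_one] at this
  exact partialQ_eq_of_hasDerivAt one_pos this fun s hs => evalAt_powA s t hs c

theorem evalAt_powA_one (c t : ℝ) : evalAt 1 t one_pos (powA c) = 1 := by
  simp [evalAt_powA]

/-- Since `q^t - q^(-t) = 2 sinh (t log q)`, both branches of `etaFun` are given by one analytic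
formula, with `dslope` supplying the value of `sinh u / u` at `u = 0`. The factor `log q` makes the
vanishing on `q = 1` visible. -/
theorem etaFun_eq {q : ℝ} (t : ℝ) (hq : 0 < q) :
    etaFun q t = 2 * Real.log q * dslope Real.sinh 0 (t * Real.log q) := by
  unfold etaFun
  split_ifs with h
  · simp [h]
  · rw [Real.rpow_def_of_pos hq, Real.rpow_def_of_pos hq]
    by_cases hl : Real.log q = 0
    · simp [hl]
    · rw [dslope_of_ne _ (mul_ne_zero h hl), slope_def_field, Real.sinh_eq]
      simp only [Real.sinh_zero, sub_zero]
      field_simp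

theorem etaFun_ne_zero {q : ℝ} (t : ℝ) (hq : 0 < q) (hq1 : q ≠ 1) : etaFun q t ≠ 0 := by
  have hl : Real.log q ≠ 0 := fun h => hq1 (Real.eq_one_of_pos_of_log_eq_zero hq h)
  unfold etaFun
  split_ifs with h
  · simpa using hl
  · refine div_ne_zero (fun h0 => ?_) h
    have := congrArg Real.log (sub_eq_zero.mp h0)
    rw [Real.log_rpow hq, Real.log_rpow hq] at this
    exact mul_ne_zero h hl (by linarith)

theorem etaFun_one (t : ℝ) : etaFun 1 t = 0 := by
  rw [etaFun_eq t one_pos, Real.log_one]; ring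

theorem etaA_ne_zero : etaA ≠ 0 := fun h => by
  have := evalAt_etaA 2 1 two_pos
  rw [h, map_zero] at this
  exact etaFun_ne_zero 1 two_pos (by norm_num) (by exact_mod_cast this.symm)

/-- The quotient of `η` by `q - 1`. -/
def etaSlope (p : ℝ × ℝ) : ℝ :=
  2 * dslope Real.log 1 p.1 * dslope Real.sinh 0 (p.2 * Real.log p.1)

theorem etaFun_eq_mul_etaSlope {q : ℝ} (t : ℝ) (hq : 0 < q) :
    etaFun q t = (q - 1) * etaSlope (q, t) := by
  have := sub_smul_dslope Real.log 1 q
  rw [Real.log_one, sub_zero, smul_eq_mul] at this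
  rw [etaFun_eq t hq, etaSlope]
  linear_combination -2 * dslope Real.sinh 0 (t * Real.log q) * this

theorem etaSlope_one (t : ℝ) : etaSlope (1, t) = 2 := by
  simp [etaSlope]

theorem analyticAt_etaSlope (t : ℝ) : AnalyticAt ℝ etaSlope (1, t) := by
  have hlog : AnalyticAt ℝ Real.log (1 : ℝ) := analyticAt_log one_pos
  obtain ⟨p, hp⟩ := hlog
  have h1 : AnalyticAt ℝ (dslope Real.log 1) 1 := ⟨_, hp.has_fpower_series_dslope_fslope⟩
  have h2 : AnalyticAt ℝ (fun p : ℝ × ℝ => Real.log p.1) (1, t) :=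
    AnalyticAt.comp (g := Real.log) (f := Prod.fst) (x := ((1 : ℝ), t))
      (analyticAt_log one_pos) analyticAt_fst
  have h3 : AnalyticAt ℝ (fun p : ℝ × ℝ => dslope Real.log 1 p.1) (1, t) :=
    AnalyticAt.comp (g := dslope Real.log 1) (f := Prod.fst) (x := ((1 : ℝ), t)) h1 analyticAt_fst
  exact (analyticAt_const.mul h3).mul ((analyticAt_dslope_sinh _).comp (analyticAt_snd.mul h2))

/-- The elements of `𝔸` vanishing for `q = 1` are the multiples of `η`. -/
theorem exists_eq_etaA_mul (f : AA) (hf : ∀ t, evalAt 1 t one_pos f = 0) :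
    ∃ g : AA, f = etaA * g ∧ ∀ t, evalAt 1 t one_pos g = partialQ f 1 t / 2 := by
  classical
  -- On the line `q = 1` the value is forced: `η = (q - 1) * etaSlope` with `etaSlope (1, t) = 2`,
  -- so the limit of `f / η` is half the derivative of `f`.
  let g : Base → ℂ := fun p =>
    if p.1.1 = 1 then partialQ f 1 p.1.2 / 2 else f.1 p / (etaFun p.1.1 p.1.2 : ℂ)
  have hg : IsAnalytic g := by
    intro p hp
    by_cases h1 : p.1 = 1
    · obtain ⟨a, t⟩ := p
      obtain rfl : a = 1 := h1
      obtain ⟨Φ, hΦ, hev⟩ := exists_eq_sub_mul_of_analyticAt (f.2 (1, t) hp)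
        fun s => by rw [extend_eq_evalAt s one_pos, hf]
      have hE : AnalyticAt ℝ (fun p => (etaSlope p : ℂ)) (1, t) :=
        (Complex.ofRealCLM.analyticAt _).comp (analyticAt_etaSlope t)
      have hE0 : (etaSlope (1, t) : ℂ) ≠ 0 := by rw [etaSlope_one]; norm_num
      -- Near the line, `f` and `η` share the factor `q - 1`, and the quotient is `Φ / etaSlope`
      -- with a non-vanishing denominator.
      refine (hΦ.div hE hE0).congr ?_
      filter_upwards [hev.eventually_nhds, hΦ.eventually_analyticAt, isOpen_domain.mem_nhds hp,
        hE.continuousAt.eventually_ne hE0] with x hx hxa hxd hxE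
      obtain ⟨q, s⟩ := x
      rw [extend_of_pos g hxd]
      simp only [g, Pi.div_apply]
      split_ifs with hq
      · subst hq
        rw [etaSlope_one]
        have hd : HasDerivAt (fun q : ℝ => Φ (q, s)) (deriv (fun q : ℝ => Φ (q, s)) 1) 1 :=
          (DifferentiableAt.comp (g := Φ) (1 : ℝ) hxa.differentiableAt
            (f := fun q : ℝ => (q, s)) (by fun_prop)).hasDerivAt
        have hd' := ((hasDerivAt_id (1 : ℝ)).sub_const 1).ofReal_comp.mul hd
        -- In the product rule for `(q - 1) Φ` at `q = 1`, the term with the derivative of `Φ` drops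
        -- out.
        have : partialQ f 1 s = Φ (1, s) := by
          have hc : Tendsto (fun q : ℝ => (q, s)) (𝓝 1) (𝓝 (1, s)) :=
            Continuous.tendsto (by fun_prop) 1
          refine (hd'.congr_of_eventuallyEq (f₁ := fun q : ℝ => extend f.1 (q, s)) ?_).deriv.trans ?_
          · filter_upwards [hc.eventually hx] with q hq
            rw [hq]; rfl
          · simp
        rw [this]
        norm_num
      · have h2 := hx.self_of_nhds
        rw [extend_of_pos _ hxd] at h2
        have h3 := etaFun_eq_mul_etaSlope s hxd
        simp only at h2 h3 ⊢
        rw [h2, h3]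
        have : (q : ℂ) - 1 ≠ 0 := sub_ne_zero.mpr (by exact_mod_cast hq)
        push_cast
        field_simp
    · have hη : AnalyticAt ℝ (extend etaA.1) p := etaA.2 p hp
      have hη0 : extend etaA.1 p ≠ 0 := by
        rw [extend_of_pos _ hp]
        exact Complex.ofReal_ne_zero.mpr (etaFun_ne_zero p.2 hp h1)
      refine ((f.2 p hp).div hη hη0).congr ?_
      filter_upwards [isOpen_domain.mem_nhds hp, continuousAt_fst.eventually_ne h1] with x hx hx1
      rw [Pi.div_apply, extend_of_pos _ hx, extend_of_pos _ hx, extend_of_pos _ hx]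
      simp only [g]
      rw [if_neg hx1]
      rfl
  refine ⟨⟨g, hg⟩, ?_, fun t => ?_⟩
  · refine AA_ext fun q t hq => ?_
    rw [map_mul, evalAt_etaA, evalAt_apply _ _ _ ⟨g, hg⟩]
    simp only [g]
    split_ifs with h
    · subst h
      rw [hf, etaFun_one]; simp
    · have : (etaFun q t : ℂ) ≠ 0 := Complex.ofReal_ne_zero.mpr (etaFun_ne_zero t hq h)
      rw [evalAt_apply]
      field_simp
  · rw [evalAt_apply]
    simp [g]

end Calculus

/-! ### The relations of the generators of the integral form -/

section SpecRel

variable {R : Type*} {D : Type*} [CommRing R] [Ring D] [Algebra R D]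

/-- The relations satisfied by `x_𝔸`, `x_𝔸*`, `z_𝔸` and `θ_𝔸`, with `q`, `qi` and `η` standing for
`ϙ^τ`, its inverse and `η`. -/
structure SpecRel (q qi τ η : R) (x y z θ : D) : Prop where
  xz : x * z = q ^ 2 • (z * x) + (q * τ) • z
  zy : z * y = q ^ 2 • (y * z) + (q * τ) • z
  sphere : x + y + η • (x * y + q ^ 2 • (z * z)) = 0
  sphere_comm : x * y + q ^ 2 • (z * z) = y * x + qi ^ 2 • (z * z)
  xθ : q • (x * θ) - qi • (θ * x) + τ • θ = (q + qi) • z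
  θy : q • (θ * y) - qi • (y * θ) + τ • θ = (q + qi) • z
  zθ : z * θ - θ * z = x - y

namespace SpecRel

variable {q qi τ η : R} {x y z θ : D}

theorem map {D' : Type*} [Ring D'] [Algebra R D'] (h : SpecRel q qi τ η x y z θ) (f : D →ₐ[R] D') :
    SpecRel q qi τ η (f x) (f y) (f z) (f θ) where
  xz := by simpa using congrArg f h.xz
  zy := by simpa using congrArg f h.zy
  sphere := by simpa using congrArg f h.sphere
  sphere_comm := by simpa using congrArg f h.sphere_comm
  xθ := by simpa using congrArg f h.xθ
  θy := by simpa using congrArg f h.θy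
  zθ := by simpa using congrArg f h.zθ

/-- The element `w`, such that `x + y = -η w`. -/
def w (q : R) (x y z : D) : D := x * y + q ^ 2 • (z * z)

variable (h : SpecRel q qi τ η x y z θ) (hq : q * qi = 1) (hη : τ * η = q - qi)
include h hq hη

theorem z_mul_x : z * x = qi ^ 2 • (x * z) - (qi * τ) • z := by
  rw [h.xz]
  match_scalars
  · linear_combination (-q * qi - 1) * hq
  · linear_combination (-qi * τ) * hq

/-- The generator `y` is traded for `w` rather than dividing by `η`. This is what keeps the
straightening below valid when `η` is not invertible. -/
theorem y_eq : y = -x - η • w q x y z := by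
  have := h.sphere
  rw [w]
  linear_combination (norm := module) this

/-- Inserting `y = -x - η w` into the definition of `w` and solving for `z²` requires only the
invertibility of `q`. Thus even powers of `z` are redundant once `x` and `w` are available. -/
theorem z_mul_z : z * z = qi ^ 2 • (w q x y z + x * x + η • (x * w q x y z)) := by
  have h1 : x * y = -(x * x) - η • (x * w q x y z) := by
    conv_lhs => rw [h.y_eq hq hη]
    rw [mul_sub, mul_neg, mul_smul_comm]
  have h2 : w q x y z = x * y + q ^ 2 • (z * z) := rfl
  rw [h1] at h2
  generalize w q x y z = w at *
  have h3 := congrArg (fun a => qi ^ 2 • a) h2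
  simp only [smul_add, smul_sub, smul_neg, smul_smul] at h3
  have h4 : qi ^ 2 * q ^ 2 = 1 := by linear_combination (q * qi + 1) * hq
  rw [h4, one_smul] at h3
  linear_combination (norm := module) -h3

theorem x_mul_z_mul_z : x * (z * z) = q ^ 4 • (z * z * x) + ((q ^ 3 + q) * τ) • (z * z) := by
  rw [← mul_assoc, h.xz, add_mul, smul_mul_assoc, smul_mul_assoc, mul_assoc z x z, h.xz, mul_add,
    mul_smul_comm, mul_smul_comm, ← mul_assoc]
  module

/-- Of the two expressions for `w` in `sphere_comm`, the one with `x y` is used for `w x` and the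
one with `y x` for `x w`. The common term `x y x` cancels and only `z²` terms are left. -/
theorem w_mul_x : w q x y z * x = x * w q x y z - ((q + qi) * τ) • (z * z) := by
  have e1 : w q x y z * x = x * (y * x) + q ^ 2 • (z * z * x) := by
    rw [w, add_mul, smul_mul_assoc, mul_assoc x y x]
  have e2 : x * w q x y z = x * (y * x) + qi ^ 2 • (x * (z * z)) := by
    rw [w, h.sphere_comm, mul_add, mul_smul_comm]
  rw [e1, e2, h.x_mul_z_mul_z hq hη]
  match_scalars
  · ring
  · linear_combination (-q ^ 2) * (q * qi + 1) * hq
  · linear_combination (-q * (q * qi + 1) * τ - qi * τ + (q * (q * qi +1 - 1) * τ - q ^ 2 * qi * τ)) * hq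

/-- Moving `z` through `x y` creates a term in `y z`, which is replaced by `-x z - η w z`. The
identity `q τ η = q² - 1` then changes the coefficient of `w z` from `1` to `q²` and removes `η`. -/
theorem z_mul_w : z * w q x y z
    = q ^ 2 • (w q x y z * z) + ((q + qi) * τ) • (x * z) - τ ^ 2 • z := by
  have h1 : z * (x * y) = x * y * z + (qi * τ) • (x * z) - (q * τ) • (y * z) - τ ^ 2 • z := by
    rw [← mul_assoc, h.z_mul_x hq hη, sub_mul, smul_mul_assoc, smul_mul_assoc, mul_assoc x z y,
      h.zy, mul_add, mul_smul_comm, mul_smul_comm, ← mul_assoc]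
    match_scalars
    · linear_combination (q * qi + 1) * hq
    · linear_combination (qi * τ) * hq
    · linear_combination (-q * τ) * hq
    · linear_combination (-τ ^ 2) * hq
  have h2 : y * z = -(x * z) - η • (w q x y z * z) := by
    conv_lhs => rw [h.y_eq hq hη]
    rw [sub_mul, neg_mul, smul_mul_assoc]
  have h3 : x * y = w q x y z - q ^ 2 • (z * z) := by rw [w]; abel
  rw [h2, h3] at h1
  rw [mul_sub, mul_smul_comm, sub_mul, smul_mul_assoc, mul_assoc z z z] at h1
  generalize w q x y z = w at *
  have h4 : q * τ * η = q ^ 2 - 1 := by linear_combination q * hη - hq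
  rw [smul_sub, smul_neg, smul_smul, h4] at h1
  linear_combination (norm := module) h1

theorem θ_mul_x : θ * x = q ^ 2 • (x * θ) + (q * τ) • θ - (q ^ 2 + 1) • z := by
  have := congrArg (fun a => q • a) h.xθ
  simp only [smul_add, smul_sub, smul_smul, hq] at this
  have h1 : q * (q + qi) = q ^ 2 + 1 := by linear_combination hq
  rw [h1] at this
  linear_combination (norm := module) -this

theorem θ_mul_y : θ * y = qi ^ 2 • (y * θ) - (qi * τ) • θ + (1 + qi ^ 2) • z := by
  have := congrArg (fun a => qi • a) h.θy
  simp only [smul_add, smul_sub, smul_smul] at this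
  have h1 : qi * (q + qi) = 1 + qi ^ 2 := by linear_combination hq
  have h2 : qi * q = 1 := by linear_combination hq
  rw [h1, h2] at this
  linear_combination (norm := module) this

end SpecRel

end SpecRel

/-! ### Ordered monomials -/

section Straightening

variable {R : Type*} {D : Type*} [CommRing R] [Ring D] [Algebra R D]

/-- The common principle of the straightening arguments: it suffices to stabilize a span containing
`1` under left multiplication by generators. -/
theorem adjoin_le_of_mul_mem {s : Set D} {N : Submodule R D} (h1 : 1 ∈ N)
    (hs : ∀ a ∈ s, ∀ n ∈ N, a * n ∈ N) {b : D} (hb : b ∈ Algebra.adjoin R s) : b ∈ N := by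
  have : ∀ n ∈ N, b * n ∈ N := by
    induction hb using Algebra.adjoin_induction with
    | mem a ha => exact hs a ha
    | algebraMap r => exact fun n hn => by rw [← Algebra.smul_def]; exact N.smul_mem r hn
    | add a b _ _ ha hb => exact fun n hn => by rw [add_mul]; exact N.add_mem (ha n hn) (hb n hn)
    | mul a b _ _ ha hb => exact fun n hn => by rw [mul_assoc]; exact ha _ (hb n hn)
  simpa using this 1 h1

namespace SpecRel

/-- The element `w ^ b z ^ e` with `d = 2 b + e` and `e < 2`. -/
def sphereMon (w z : D) (d : ℕ) : D := w ^ (d / 2) * z ^ (d % 2)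

/-- The ordered monomials. -/
def mon (q : R) (x y z θ : D) (p : ℕ × ℕ × ℕ) : D :=
  x ^ p.1 * sphereMon (w q x y z) z p.2.1 * θ ^ p.2.2

variable {q qi τ η : R} {x y z θ : D}
variable (h : SpecRel q qi τ η x y z θ) (hq : q * qi = 1) (hη : τ * η = q - qi)
include h hq hη

/-- Moving `w` to the right of `x` costs a multiple of `z²`, which `z_mul_z` expresses through `w`,
`x²` and `x w`. In each resulting term, `w` has one power of `x` less to cross, so an induction on
that power terminates. -/
theorem adjoin_x_w_le : (Algebra.adjoin R {x, w q x y z}).toSubmodule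
    ≤ Submodule.span R (Set.range fun p : ℕ × ℕ => x ^ p.1 * w q x y z ^ p.2) := by
  have hwx := h.w_mul_x hq hη
  rw [h.z_mul_z hq hη] at hwx
  generalize w q x y z = w at *
  set N := Submodule.span R (Set.range fun p : ℕ × ℕ => x ^ p.1 * w ^ p.2)
  have hN : ∀ a b, x ^ a * w ^ b ∈ N := fun a b => Submodule.subset_span ⟨(a, b), rfl⟩
  have hx : ∀ n ∈ N, x * n ∈ N := fun n hn => by
    induction hn using Submodule.span_induction with
    | mem n hn =>
      obtain ⟨⟨a, b⟩, rfl⟩ := hn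
      simp only
      rw [← mul_assoc, ← pow_succ']
      exact hN _ _
    | zero => simp
    | add a b _ _ ha hb => rw [mul_add]; exact N.add_mem ha hb
    | smul r a _ ha => rw [mul_smul_comm]; exact N.smul_mem r ha
  have hwm : ∀ a b, w * (x ^ a * w ^ b) ∈ N := fun a => by
    induction a with
    | zero => exact fun b => by simpa [pow_succ'] using hN 0 (b + 1)
    | succ a ih =>
      intro b
      have e : w * (x ^ (a + 1) * w ^ b) = x * (w * (x ^ a * w ^ b)) -
          ((q + qi) * τ * qi ^ 2) • (w * (x ^ a * w ^ b) + x * (x * (x ^ a * w ^ b))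
            + η • (x * (w * (x ^ a * w ^ b)))) := by
        rw [pow_succ', mul_assoc x, ← mul_assoc w x, hwx, sub_mul, smul_mul_assoc, smul_mul_assoc,
          add_mul (w + x * x), add_mul w, smul_mul_assoc, smul_smul, mul_assoc, mul_assoc, mul_assoc]
      rw [e]
      exact N.sub_mem (hx _ (ih b)) (N.smul_mem _ (N.add_mem (N.add_mem (ih b) (hx _ (hx _ (hN _ _))))
        (N.smul_mem _ (hx _ (ih b)))))
  intro b hb
  refine adjoin_le_of_mul_mem (by simpa using hN 0 0) ?_ hb
  rintro a (rfl | rfl) n hn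
  · exact hx n hn
  · induction hn using Submodule.span_induction with
    | mem n hn => obtain ⟨⟨a, b⟩, rfl⟩ := hn; exact hwm a b
    | zero => simp
    | add a b _ _ ha hb => rw [mul_add]; exact N.add_mem ha hb
    | smul r a _ ha => rw [mul_smul_comm]; exact N.smul_mem r ha

/-- For the subalgebra `S` generated by `x` and `w`, the inclusion `z S ⊆ S z` passes from
generators to products, as in a skew polynomial extension. -/
theorem exists_z_mul {s : D} (hs : s ∈ Algebra.adjoin R {x, w q x y z}) :
    ∃ s' ∈ Algebra.adjoin R {x, w q x y z}, z * s = s' * z := by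
  have hx : x ∈ Algebra.adjoin R {x, w q x y z} := Algebra.subset_adjoin (by simp)
  have hw : w q x y z ∈ Algebra.adjoin R {x, w q x y z} := Algebra.subset_adjoin (by simp)
  have hzx := h.z_mul_x hq hη
  have hzw := h.z_mul_w hq hη
  generalize w q x y z = w at *
  set S := Algebra.adjoin R {x, w}
  induction hs using Algebra.adjoin_induction with
  | mem a ha =>
    rcases ha with rfl | rfl
    · refine ⟨qi ^ 2 • a - algebraMap R D (qi * τ), S.sub_mem (S.smul_mem hx _)
        (S.algebraMap_mem _), ?_⟩
      rw [hzx, sub_mul, smul_mul_assoc, Algebra.smul_def (qi * τ)]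
    · refine ⟨q ^ 2 • a + ((q + qi) * τ) • x - algebraMap R D (τ ^ 2),
        S.sub_mem (S.add_mem (S.smul_mem hw _) (S.smul_mem hx _)) (S.algebraMap_mem _), ?_⟩
      rw [hzw, sub_mul, add_mul (q ^ 2 • a), smul_mul_assoc, smul_mul_assoc, Algebra.smul_def (τ ^ 2)]
  | algebraMap r => exact ⟨_, S.algebraMap_mem r, (Algebra.commutes _ _).symm⟩
  | add a b _ _ ha hb =>
    obtain ⟨a', ha', ha⟩ := ha
    obtain ⟨b', hb', hb⟩ := hb
    exact ⟨_, S.add_mem ha' hb', by rw [mul_add, ha, hb, add_mul]⟩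
  | mul a b _ _ ha hb =>
    obtain ⟨a', ha', ha⟩ := ha
    obtain ⟨b', hb', hb⟩ := hb
    exact ⟨_, S.mul_mem ha' hb', by rw [← mul_assoc, ha, mul_assoc, hb, mul_assoc]⟩

/-- With `S` generated by `x` and `w`, the module `S + S z` is stable under all three generators:
`y` lies in `S`, `z` moves past `S`, and `z²` falls back into `S`. So at most one factor `z` is ever
needed. -/
theorem exists_eq_add_mul_z {s : D} (hs : s ∈ Algebra.adjoin R {x, y, z}) :
    ∃ a ∈ Algebra.adjoin R {x, w q x y z}, ∃ b ∈ Algebra.adjoin R {x, w q x y z},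
      s = a + b * z := by
  set S := Algebra.adjoin R {x, w q x y z} with hS
  have hx : x ∈ S := Algebra.subset_adjoin (by simp)
  have hw : w q x y z ∈ S := Algebra.subset_adjoin (by simp)
  have hy : y ∈ S := by
    rw [h.y_eq hq hη]
    exact S.sub_mem (S.neg_mem hx) (S.smul_mem hw _)
  have hzz : z * z ∈ S := by
    rw [h.z_mul_z hq hη]
    exact S.smul_mem (S.add_mem (S.add_mem hw (S.mul_mem hx hx)) (S.smul_mem (S.mul_mem hx hw) _)) _
  let N : Submodule R D := S.toSubmodule ⊔ S.toSubmodule.map (LinearMap.mulRight R z)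
  have hN : ∀ n, n ∈ N ↔ ∃ a ∈ S, ∃ b ∈ S, n = a + b * z := fun n => by
    rw [Submodule.mem_sup]
    constructor
    · rintro ⟨a, ha, _, ⟨b, hb, rfl⟩, rfl⟩
      exact ⟨a, ha, b, hb, rfl⟩
    · rintro ⟨a, ha, b, hb, rfl⟩
      exact ⟨a, ha, _, ⟨b, hb, rfl⟩, rfl⟩
  rw [← hN]
  have hmul : ∀ c ∈ S, ∀ n ∈ N, c * n ∈ N := by
    intro c hc n hn
    obtain ⟨a, ha, b, hb, rfl⟩ := (hN n).mp hn
    exact (hN _).mpr ⟨c * a, S.mul_mem hc ha, c * b, S.mul_mem hc hb, by rw [mul_add, mul_assoc]⟩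
  refine adjoin_le_of_mul_mem ((hN 1).mpr ⟨1, S.one_mem, 0, S.zero_mem, by simp⟩) ?_ hs
  rintro c (rfl | rfl | rfl) n hn
  · exact hmul _ hx n hn
  · exact hmul _ hy n hn
  · obtain ⟨a, ha, b, hb, rfl⟩ := (hN n).mp hn
    obtain ⟨a', ha', hza⟩ := h.exists_z_mul hq hη ha
    obtain ⟨b', hb', hzb⟩ := h.exists_z_mul hq hη hb
    refine (hN _).mpr ⟨b' * (c * c), S.mul_mem hb' hzz, a', ha', ?_⟩
    rw [mul_add, hza, ← mul_assoc c b c, hzb, mul_assoc, add_comm]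

/-- The last three relations of `SpecRel` say that `θ` acts on the sphere subalgebra by a skew
derivation; this allows all powers of `θ` to be gathered on the right. -/
theorem exists_θ_mul {s : D} (hs : s ∈ Algebra.adjoin R {x, y, z}) :
    ∃ a ∈ Algebra.adjoin R {x, y, z}, ∃ b ∈ Algebra.adjoin R {x, y, z}, θ * s = a * θ + b := by
  set S := Algebra.adjoin R {x, y, z}
  have hx : x ∈ S := Algebra.subset_adjoin (by simp)
  have hy : y ∈ S := Algebra.subset_adjoin (by simp)
  have hz : z ∈ S := Algebra.subset_adjoin (by simp)
  induction hs using Algebra.adjoin_induction with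
  | mem a ha =>
    rcases ha with rfl | rfl | rfl
    · refine ⟨q ^ 2 • a + algebraMap R D (q * τ), S.add_mem (S.smul_mem hx _) (S.algebraMap_mem _),
        -((q ^ 2 + 1) • z), S.neg_mem (S.smul_mem hz _), ?_⟩
      rw [h.θ_mul_x hq hη, add_mul, smul_mul_assoc, Algebra.smul_def (q * τ), sub_eq_add_neg]
    · refine ⟨qi ^ 2 • a - algebraMap R D (qi * τ), S.sub_mem (S.smul_mem hy _)
        (S.algebraMap_mem _), (1 + qi ^ 2) • z, S.smul_mem hz _, ?_⟩
      rw [h.θ_mul_y hq hη, sub_mul, smul_mul_assoc, Algebra.smul_def (qi * τ)]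
    · refine ⟨a, hz, -(x - y), S.neg_mem (S.sub_mem hx hy), ?_⟩
      rw [← h.zθ]; abel
  | algebraMap r => exact ⟨_, S.algebraMap_mem r, 0, S.zero_mem, by
      rw [add_zero]; exact (Algebra.commutes _ _).symm⟩
  | add a b _ _ ha hb =>
    obtain ⟨a', ha', a'', ha'', ha⟩ := ha
    obtain ⟨b', hb', b'', hb'', hb⟩ := hb
    exact ⟨_, S.add_mem ha' hb', _, S.add_mem ha'' hb'', by rw [mul_add, ha, hb, add_mul]; abel⟩
  | mul a b _ hbS ha hb =>
    obtain ⟨a', ha', a'', ha'', ha⟩ := ha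
    obtain ⟨b', hb', b'', hb'', hb⟩ := hb
    refine ⟨_, S.mul_mem ha' hb', _, S.add_mem (S.mul_mem ha' hb'') (S.mul_mem ha'' hbS), ?_⟩
    rw [← mul_assoc, ha, add_mul, mul_assoc, hb, mul_add, mul_assoc, add_assoc]

/-- Half of a Poincaré–Birkhoff–Witt theorem: `θ` goes to the right, the sphere part is reduced to
`S + S z`, and `S` is spanned by the products `x^i w^j`. -/
theorem span_mon (htop : Algebra.adjoin R {x, y, z, θ} = ⊤) :
    Submodule.span R (Set.range (mon q x y z θ)) = ⊤ := by
  set S := Algebra.adjoin R {x, y, z}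
  set P := Submodule.span R (Set.range (mon q x y z θ))
  let N : Submodule R D := Submodule.span R {n | ∃ s ∈ S, ∃ c : ℕ, n = s * θ ^ c}
  have hmem : ∀ s ∈ S, ∀ c : ℕ, s * θ ^ c ∈ N := fun s hs c => Submodule.subset_span ⟨s, hs, c, rfl⟩
  have hN : ∀ b : D, b ∈ N := fun b => by
    refine adjoin_le_of_mul_mem (s := {x, y, z, θ}) ?_ ?_ (by rw [htop]; trivial)
    · simpa using hmem 1 S.one_mem 0
    · intro a ha n hn
      induction hn using Submodule.span_induction with
      | mem n hn =>
        obtain ⟨s, hs, c, rfl⟩ := hn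
        have : a ∈ S ∨ a = θ := by
          rcases ha with rfl | rfl | rfl | rfl
          · exact Or.inl (Algebra.subset_adjoin (by simp))
          · exact Or.inl (Algebra.subset_adjoin (by simp))
          · exact Or.inl (Algebra.subset_adjoin (by simp))
          · exact Or.inr rfl
        rcases this with haS | rfl
        · rw [← mul_assoc]
          exact hmem _ (S.mul_mem haS hs) c
        · obtain ⟨s', hs', s'', hs'', e⟩ := h.exists_θ_mul hq hη hs
          rw [← mul_assoc, e, add_mul, mul_assoc, ← pow_succ']
          exact N.add_mem (hmem _ hs' _) (hmem _ hs'' _)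
      | zero => simp
      | add a b _ _ ha hb => rw [mul_add]; exact N.add_mem ha hb
      | smul r a _ ha => rw [mul_smul_comm]; exact N.smul_mem r ha
  have key : ∀ (e : ℕ), e < 2 → ∀ (c : ℕ), ∀ a ∈ Algebra.adjoin R {x, w q x y z},
      a * z ^ e * θ ^ c ∈ P := fun e he c a ha => by
    have := h.adjoin_x_w_le hq hη ha
    clear ha
    induction this using Submodule.span_induction with
    | mem n hn =>
      obtain ⟨⟨i, j⟩, rfl⟩ := hn
      -- As `e < 2`, division of `2 j + e` by `2` recovers the exponents of `w` and `z` encoded in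
      -- `sphereMon`.
      refine Submodule.subset_span ⟨(i, 2 * j + e, c), ?_⟩
      have h1 : (2 * j + e) / 2 = j := by omega
      have h2 : (2 * j + e) % 2 = e := by omega
      simp only [mon, sphereMon, h1, h2, mul_assoc]
    | zero => simp
    | add a b _ _ ha hb => rw [add_mul, add_mul]; exact P.add_mem ha hb
    | smul r a _ ha => rw [smul_mul_assoc, smul_mul_assoc]; exact P.smul_mem r ha
  refine Submodule.eq_top_iff'.mpr fun b => ?_
  have hb := hN b
  induction hb using Submodule.span_induction with
  | mem n hn =>
    obtain ⟨s, hs, c, rfl⟩ := hn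
    obtain ⟨a, ha, b, hb, rfl⟩ := h.exists_eq_add_mul_z hq hη hs
    rw [add_mul]
    have h0 := key 0 (by norm_num) c a ha
    have h1 := key 1 (by norm_num) c b hb
    rw [pow_zero, mul_one] at h0
    rw [pow_one] at h1
    exact P.add_mem h0 h1
  | zero => simp
  | add a b _ _ ha hb => exact P.add_mem ha hb
  | smul r a _ ha => exact P.smul_mem r ha

end SpecRel

end Straightening

/-! ### Morphisms from algebras given by generators and relations -/

namespace StarPresented

open MulOpposite

section

variable {R S : Type} [CommRing R] [StarRing R]
  {rel : FreeAlgebra R (S ⊕ S) → FreeAlgebra R (S ⊕ S) → Prop}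

/-- The universal property, for algebras in an arbitrary universe. -/
theorem exists_algHom {B : Type*} [Ring B] [Algebra R B] (f : S ⊕ S → B)
    (hf : ∀ ⦃a b⦄, StarRel rel a b → FreeAlgebra.lift R f a = FreeAlgebra.lift R f b) :
    ∃ g : StarPresented rel →ₐ[R] B, (∀ s, g (gen rel s) = f (Sum.inl s)) ∧
      ∀ s, g (star (gen rel s)) = f (Sum.inr s) := by
  have h : ∀ a, RingQuot.liftAlgHom R ⟨FreeAlgebra.lift R f, hf⟩ (mk rel a)
      = FreeAlgebra.lift R f a := fun a => RingQuot.liftAlgHom_mkAlgHom_apply R _ _ a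
  refine ⟨RingQuot.liftAlgHom R ⟨FreeAlgebra.lift R f, hf⟩, fun s => ?_, fun s => ?_⟩
  · exact (h _).trans (FreeAlgebra.lift_ι_apply _ _)
  · rw [gen, star_mk, freeStar_ι, unop_op]
    exact (h _).trans (FreeAlgebra.lift_ι_apply _ _)

theorem eq_top_of_gen_mem {T : Subalgebra R (StarPresented rel)} (h : ∀ s, gen rel s ∈ T)
    (h' : ∀ s, star (gen rel s) ∈ T) : T = ⊤ := by
  refine Algebra.eq_top_iff.mpr fun x => ?_
  obtain ⟨a, rfl⟩ := mk_surjective x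
  induction a using FreeAlgebra.induction with
  | grade0 r => rw [AlgHom.commutes]; exact T.algebraMap_mem r
  | grade1 s =>
    rcases s with s | s
    · exact h s
    · have := h' s
      rwa [gen, star_mk, freeStar_ι, unop_op] at this
  | mul a b ha hb => rw [map_mul]; exact T.mul_mem ha hb
  | add a b ha hb => rw [map_add]; exact T.add_mem ha hb

end

end StarPresented

/-! ### Generators and relations of the quantized enveloping algebra. -/

section UqOps

variable {F : Type} [Field F] [CharZero F] [StarRing F]

/-- The relations of the generators of `U_q(𝔤)` and of their adjoints, with `Y` standing for the
adjoint of `X`. -/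
structure UqOps {D : Type*} [Ring D] [Algebra F D] (q : F) (X Y Z θ : D) : Prop where
  XZ : X * Z = q ^ 2 • (Z * X)
  ZY : Z * Y = q ^ 2 • (Y * Z)
  XY : X * Y + q ^ 2 • (Z * Z) = 1
  YX : Y * X + (q⁻¹) ^ 2 • (Z * Z) = 1
  Xθ : q • (X * θ) - q⁻¹ • (θ * X) = qInt q 2 • Z
  θY : q • (θ * Y) - q⁻¹ • (Y * θ) = qInt q 2 • Z
  Zθ : Z * θ - θ * Z = X - Y

namespace UqOps

variable {D : Type*} [Ring D] [Algebra F D] (q : QParam F)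

open MulOpposite in
theorem exists_algHom {X Y Z θ : D} (h : UqOps q.val X Y Z θ) :
    ∃ g : Uq q →ₐ[F] D, g (Uq.X q) = X ∧ g (star (Uq.X q)) = Y ∧ g (Uq.Z q) = Z ∧
      g (Uq.θ q) = θ := by
  let o : Gen ⊕ Gen → D
    | Sum.inl Gen.X => X
    | Sum.inr Gen.X => Y
    | Sum.inl Gen.Z => Z
    | Sum.inr Gen.Z => Z
    | Sum.inl Gen.θ => θ
    | Sum.inr Gen.θ => θ
  have g1 : o (Sum.inl Gen.X) = X := rfl
  have g2 : o (Sum.inr Gen.X) = Y := rfl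
  have g3 : o (Sum.inl Gen.Z) = Z := rfl
  have g4 : o (Sum.inr Gen.Z) = Z := rfl
  have g5 : o (Sum.inl Gen.θ) = θ := rfl
  have g6 : o (Sum.inr Gen.θ) = θ := rfl
  obtain ⟨g, hg, hg'⟩ := StarPresented.exists_algHom (rel := UqRel q.val) o fun a b hab => by
    obtain ⟨h1, h1s, h2, h3, h4, h4s, h5⟩ := h
    generalize o = o at *
    cases hab with
    | of h =>
      cases h <;> simp only [map_mul, map_add, map_sub, map_smul, map_one, FreeAlgebra.lift_ι_apply,
        g1, g2, g3, g4, g5, g6, pow_two Z, map_pow]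
      exacts [h1, h2, h3, h4, h5]
    | star h =>
      cases h <;> simp only [map_mul, map_add, map_sub, map_one, FreeAlgebra.lift_ι_apply,
        g1, g2, g3, g4, g5, g6, pow_two Z, map_pow, unop_freeStar_smul, MulOpposite.unop_mul,
        MulOpposite.unop_add, MulOpposite.unop_sub, MulOpposite.unop_one, MulOpposite.unop_pow,
        MulOpposite.unop_op, freeStar_ι, Sum.swap_inl, Sum.swap_inr, star_pow, star_inv₀,
        q.star_val, q.star_qInt, map_smul]
      exacts [h1s, h2, h3, h4s, by rw [← neg_sub, h5]; abel]
  exact ⟨g, hg _, hg' _, hg _, hg _⟩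

open StarPresented MulOpposite in
theorem star_Z : star (Uq.Z q) = Uq.Z q := by
  rw [Uq.Z, gen, star_mk, freeStar_ι, unop_op]
  exact mk_eq (StarRel.of UqRel.Z_star)

open StarPresented MulOpposite in
theorem star_θ : star (Uq.θ q) = Uq.θ q := by
  rw [Uq.θ, gen, star_mk, freeStar_ι, unop_op]
  exact mk_eq (StarRel.of UqRel.θ_star)

open StarPresented MulOpposite in
theorem star_X_eq_mk : star (Uq.X q) = StarPresented.mk (UqRel q.val) (FreeAlgebra.ι F (Sum.inr Gen.X)) := by
  exact (star_mk _).trans (by rw [freeStar_ι, unop_op]; rfl)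

open StarPresented in
theorem uq : UqOps q.val (Uq.X q) (star (Uq.X q)) (Uq.Z q) (Uq.θ q) := by
  have hq := q.star_val
  have h1 : Uq.X q * Uq.Z q = q.val ^ 2 • (Uq.Z q * Uq.X q) := by
    have := mk_eq (StarRel.of (UqRel.XZ (q := q.val)))
    rwa [map_mul, map_smul, map_mul] at this
  have h4 : q.val • (Uq.X q * Uq.θ q) - q.val⁻¹ • (Uq.θ q * Uq.X q) = qInt q.val 2 • Uq.Z q := by
    have := mk_eq (StarRel.of (UqRel.Xθ (q := q.val)))
    rwa [map_sub, map_smul, map_smul, map_smul, map_mul, map_mul] at this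
  refine ⟨h1, ?_, ?_, ?_, h4, ?_, ?_⟩
  · have := congrArg star h1
    rw [star_mul, star_smul, star_mul, star_Z, star_pow, hq] at this
    exact this
  · have := mk_eq (StarRel.of (UqRel.XXs (q := q.val)))
    rw [map_add, map_mul, map_smul, map_pow, map_one, pow_two (StarPresented.mk _ _)] at this
    rw [star_X_eq_mk]
    exact this
  · have := mk_eq (StarRel.of (UqRel.XsX (q := q.val)))
    rw [map_add, map_mul, map_smul, map_pow, map_one, pow_two (StarPresented.mk _ _)] at this
    rw [star_X_eq_mk]
    exact this
  · have := congrArg star h4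
    rwa [star_sub, star_smul, star_smul, star_smul, star_mul, star_mul, star_Z, star_θ, star_inv₀, hq,
      q.star_qInt] at this
  · have := mk_eq (StarRel.of (UqRel.Zθ (q := q.val)))
    rw [map_sub, map_sub, map_mul, map_mul] at this
    rw [star_X_eq_mk]
    exact this

variable {q}
variable {τ η : F} {X Y Z θ x y z : D}

theorem qInt_two {q : F} (hq : q - q⁻¹ ≠ 0) : qInt q 2 = q + q⁻¹ := by
  have h0 : q ≠ 0 := fun h => hq (by simp [h])
  rw [qInt, inv_mul_eq_iff_eq_mul₀ hq]
  simp only [zpow_neg, zpow_ofNat, inv_pow]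
  ring

/-- Each relation is the corresponding one of `U_q(𝔤)` divided by a power of `η`; the quotients `(q
- q⁻¹) / η` that appear are equal to `τ`. Only `sphere_comm`, the difference of the two sphere
relations, has to be divided twice. -/
theorem specRel (h : UqOps q.val X Y Z θ) (hη : τ * η = q.val - q.val⁻¹) (hη0 : η ≠ 0) :
    SpecRel q.val q.val⁻¹ τ η (η⁻¹ • (X - 1)) (η⁻¹ • (Y - 1)) (η⁻¹ • Z) θ := by
  have hs := IndQ.sub_inv_ne_zero q
  have h0 := q.ne_zero
  have h2 := qInt_two hs
  obtain ⟨hXZ, hZY, hXY, hYX, hXθ, hθY, hZθ⟩ := h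
  rw [h2] at hXθ hθY
  have hτ : τ = η⁻¹ * (q.val - q.val⁻¹) := by rw [← hη]; field_simp
  generalize q.val = Q at *
  subst hτ
  constructor <;>
  simp only [smul_mul_assoc, mul_smul_comm, sub_mul, mul_sub, one_mul, mul_one, smul_smul,
    smul_sub, smul_add]
  · rw [hXZ]
    match_scalars <;> field_simp <;> ring
  · rw [hZY]
    match_scalars <;> field_simp <;> ring
  · linear_combination (norm := skip) η⁻¹ • hXY
    match_scalars <;> field_simp <;> ring
  · linear_combination (norm := skip) (η⁻¹ * η⁻¹) • (hXY - hYX)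
    match_scalars <;> field_simp <;> ring
  · linear_combination (norm := skip) η⁻¹ • hXθ
    match_scalars <;> field_simp <;> ring
  · linear_combination (norm := skip) η⁻¹ • hθY
    match_scalars <;> field_simp <;> ring
  · linear_combination (norm := skip) η⁻¹ • hZθ
    match_scalars <;> field_simp <;> ring

/-- In this direction the relations are multiplied by powers of `η`, so no invertibility is
required. -/
theorem of_specRel (h : SpecRel q.val q.val⁻¹ τ η x y z θ) (hη : τ * η = q.val - q.val⁻¹) :
    UqOps q.val (1 + η • x) (1 + η • y) (η • z) θ := by
  have hs := IndQ.sub_inv_ne_zero q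
  have h0 := q.ne_zero
  have h2 := qInt_two hs
  obtain ⟨hxz, hzy, hs1, hs2, hxθ, hθy, hzθ⟩ := h
  generalize q.val = Q at *
  have hη' : Q * (τ * η) = Q ^ 2 - 1 := by rw [hη]; field_simp
  constructor <;> (try rw [h2]) <;>
  simp only [smul_mul_assoc, mul_smul_comm, add_mul, mul_add, one_mul, mul_one, smul_smul,
    smul_sub, smul_add]
  · rw [hxz]
    match_scalars
    · linear_combination η * hη'
    · ring
  · rw [hzy]
    match_scalars
    · linear_combination η * hη'
    · ring
  · linear_combination (norm := module) η • hs1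
  · linear_combination (norm := module) η • hs1 - (η * η) • hs2
  · linear_combination (norm := skip) η • hxθ
    match_scalars
    · linear_combination -hη
    all_goals ring
  · linear_combination (norm := skip) η • hθy
    match_scalars
    · linear_combination -hη
    all_goals ring
  · linear_combination (norm := module) η • hzθ

end UqOps

end UqOps

/-! ### Linear independence of the ordered monomials -/

section Independence

open Polynomial

/-- Triangularity with respect to the degree. The ring `E` is noncommutative: scalars from `v` stand
on the left, so the leading coefficients of `G` have to be cancelled on the right. -/
theorem linearIndependent_C_mul {F E ι : Type*} [Field F] [Ring E] [Algebra F E] {v : ι → E}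
    (hv : LinearIndependent F v) {G : ℕ → E[X]} (hG : ∀ n, (G n).natDegree ≤ n)
    (hG' : ∀ n, IsUnit ((G n).coeff n)) :
    LinearIndependent F fun p : ι × ℕ => C (v p.1) * G p.2 := by
  classical
  rw [linearIndependent_iff']
  intro s g hg
  by_contra! hne
  obtain ⟨p₀, hp₀, hgp₀⟩ := hne
  -- The largest degree index `N` occurring with a non-zero coefficient: the coefficient of `X^N` in
  -- the relation then involves only `G N`.
  obtain ⟨p₁, hp₁, hmax⟩ := Finset.exists_max_image (s.filter fun p => g p ≠ 0) (fun p => p.2)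
    ⟨p₀, by simp [hp₀, hgp₀]⟩
  simp only [Finset.mem_filter, and_imp] at hp₁ hmax
  set N := p₁.2
  obtain ⟨u, hu⟩ := hG' N
  have h1 : ∑ p ∈ s.filter (fun p => p.2 = N), g p • v p.1 = 0 := by
    have h2 := congrArg (fun P => P.coeff N * (↑u⁻¹ : E)) hg
    simp only [finsetSum_coeff, coeff_smul, coeff_C_mul, coeff_zero, zero_mul, Finset.sum_mul] at h2
    rw [Finset.sum_filter]
    refine Eq.trans ?_ h2
    refine Finset.sum_congr rfl fun p hp => ?_
    split_ifs with h
    · rw [h, ← hu, smul_mul_assoc, mul_assoc, Units.mul_inv, mul_one]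
    · by_cases hgp : g p = 0
      · rw [hgp, zero_smul, zero_mul]
      · have hlt : p.2 < N := lt_of_le_of_ne (hmax p hp hgp) h
        rw [coeff_eq_zero_of_natDegree_lt ((hG p.2).trans_lt hlt), mul_zero, smul_zero, zero_mul]
  have h3 : Set.InjOn Prod.fst (s.filter (fun p : ι × ℕ => p.2 = N) : Set (ι × ℕ)) := by
    rintro ⟨a, b⟩ ha ⟨c, d⟩ hc rfl
    simp only [Finset.coe_filter, Set.mem_ofPred_eq] at ha hc
    rw [ha.2, hc.2]
  rw [← Finset.sum_image (s := s.filter (fun p => p.2 = N)) (g := Prod.fst)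
    (f := fun i => g (i, N) • v i) h3 |>.trans
      (Finset.sum_congr rfl fun p hp => by rw [← (Finset.mem_filter.mp hp).2])] at h1
  exact hp₁.2 ((linearIndependent_iff'.mp hv _ _ h1) p₁.1
    (Finset.mem_image.mpr ⟨p₁, by simp [hp₁.1, N], rfl⟩))

theorem natDegree_le_coeff_pow {E : Type*} [Ring E] {P : E[X]} {m : ℕ} (hP : P.natDegree ≤ m)
    (hP' : IsUnit (P.coeff m)) (n : ℕ) :
    (P ^ n).natDegree ≤ n * m ∧ IsUnit ((P ^ n).coeff (n * m)) := by
  induction n with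
  | zero => simp
  | succ n ih =>
    rw [pow_succ, add_mul, one_mul]
    exact ⟨natDegree_mul_le_of_le ih.1 hP,
      by rw [coeff_mul_add_eq_of_natDegree_le ih.1 hP]; exact ih.2.mul hP'⟩

/-- The reason for the indexing of `sphereMon`: with `w` of degree two and `z` of degree one, there
is exactly one monomial in each degree. -/
theorem natDegree_le_coeff_sphereMon {E : Type*} [Ring E] {w z : E[X]} (hw : w.natDegree ≤ 2)
    (hw' : IsUnit (w.coeff 2)) (hz : z.natDegree ≤ 1) (hz' : IsUnit (z.coeff 1)) (d : ℕ) :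
    (SpecRel.sphereMon w z d).natDegree ≤ d ∧ IsUnit ((SpecRel.sphereMon w z d).coeff d) := by
  have h1 := natDegree_le_coeff_pow hw hw' (d / 2)
  have h2 := natDegree_le_coeff_pow hz hz' (d % 2)
  have h3 : d / 2 * 2 + d % 2 * 1 = d := by omega
  have h4 : (w ^ (d / 2) * z ^ (d % 2)).natDegree ≤ d / 2 * 2 + d % 2 * 1 :=
    natDegree_mul_le_of_le h1.1 h2.1
  have h5 : IsUnit ((w ^ (d / 2) * z ^ (d % 2)).coeff (d / 2 * 2 + d % 2 * 1)) := by
    rw [coeff_mul_add_eq_of_natDegree_le h1.1 h2.1]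
    exact h1.2.mul h2.2
  rw [h3] at h4 h5
  exact ⟨h4, h5⟩

/-! #### A model of the quantum sphere -/

section Model

variable {F : Type} [Field F]

/-- The shift by `m` on functions on `ℤ`. -/
def shiftOp (F : Type) [Field F] (m : ℤ) : Module.End F (ℤ → F) where
  toFun f k := f (k - m)
  map_add' _ _ := rfl
  map_smul' _ _ := rfl

/-- The multiplication by `k ↦ q ^ (m k)` on functions on `ℤ`. -/
def diagOp (q : F) (m : ℤ) : Module.End F (ℤ → F) where
  toFun f k := q ^ (m * k) * f k
  map_add' _ _ := funext fun _ => mul_add _ _ _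
  map_smul' _ _ := funext fun _ => mul_left_comm _ _ _

theorem shiftOp_mul (m n : ℤ) : shiftOp F m * shiftOp F n = shiftOp F (m + n) :=
  LinearMap.ext fun f => funext fun k => congrArg f (by ring)

theorem shiftOp_zero : shiftOp F 0 = 1 :=
  LinearMap.ext fun f => funext fun k => congrArg f (by ring)

theorem diagOp_mul {q : F} (hq : q ≠ 0) (m n : ℤ) : diagOp q m * diagOp q n = diagOp q (m + n) :=
  LinearMap.ext fun f => funext fun k => by
    show q ^ (m * k) * (q ^ (n * k) * f k) = q ^ ((m + n) * k) * f k
    rw [add_mul, zpow_add₀ hq, mul_assoc]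

theorem diagOp_zero (q : F) : diagOp q 0 = 1 :=
  LinearMap.ext fun f => funext fun k => by
    show q ^ (0 * k) * f k = f k
    rw [zero_mul, zpow_zero, one_mul]

theorem shiftOp_mul_diagOp {q : F} (hq : q ≠ 0) :
    shiftOp F 1 * diagOp q (-2) = q ^ 2 • (diagOp q (-2) * shiftOp F 1) :=
  LinearMap.ext fun f => funext fun k => by
    show q ^ (-2 * (k - 1)) * f (k - 1) = q ^ 2 * (q ^ (-2 * k) * f (k - 1))
    rw [← mul_assoc, ← zpow_natCast, ← zpow_add₀ hq]
    congr 2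
    push_cast
    ring

theorem shiftOp_pow (n : ℕ) : shiftOp F 1 ^ n = shiftOp F n := by
  induction n with
  | zero => rw [pow_zero, Nat.cast_zero, shiftOp_zero]
  | succ n ih => rw [pow_succ, ih, shiftOp_mul, Nat.cast_succ]

/-- A polynomial in the shift, applied to the delta function at `0`, takes its own coefficients as
values, so the shift is transcendental over `F`. Replacing the variable by `c (X - 1)` is a
triangular change of basis. -/
theorem linearIndependent_shiftOp_pow {c : F} (hc : c ≠ 0) :
    LinearIndependent F fun n : ℕ => (c • (shiftOp F 1 - 1)) ^ n := by
  have h1 : Function.Injective (aeval (R := F) (shiftOp F 1)) := by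
    rw [injective_iff_map_eq_zero]
    intro p hp
    ext n
    have h2 := congrFun (LinearMap.congr_fun hp (Pi.single 0 1)) n
    rw [aeval_eq_sum_range, LinearMap.sum_apply, Finset.sum_apply] at h2
    have h3 : ∀ i : ℕ, (p.coeff i • shiftOp F 1 ^ i) (Pi.single 0 1) (n : ℤ)
        = if i = n then p.coeff i else 0 := fun i => by
      rw [shiftOp_pow]
      show p.coeff i * (Pi.single (0 : ℤ) (1 : F) : ℤ → F) ((n : ℤ) - i) = _
      rw [Pi.single_apply]
      by_cases hi : i = n
      · simp [hi]
      · have : (n : ℤ) - i ≠ 0 := by omega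
        simp [hi, this]
    simp only [h3, Finset.sum_ite_eq', Finset.mem_range] at h2
    split_ifs at h2 with h
    · simpa using h2
    · rw [coeff_eq_zero_of_natDegree_lt (by omega), coeff_zero]
  have h2 : LinearIndependent F fun n : ℕ => (C c * (X - 1) : F[X]) ^ n := by
    have h3 : (C c * (X - 1) : F[X]).natDegree ≤ 1 := by compute_degree
    have h4 : IsUnit ((C c * (X - 1) : F[X]).coeff 1) := by
      simp [coeff_one, hc]
    have := linearIndependent_C_mul (F := F) (v := fun _ : Unit => (1 : F)) (by simp)
      (G := fun n => (C c * (X - 1) : F[X]) ^ n)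
      (fun n => by simpa using (natDegree_le_coeff_pow h3 h4 n).1)
      (fun n => by simpa using (natDegree_le_coeff_pow h3 h4 n).2)
    have h5 := this.comp (fun n : ℕ => ((), n)) fun a b h => (Prod.mk.inj h).2
    simpa [Function.comp_def] using h5
  have h3 := h2.map' (aeval (R := F) (shiftOp F 1)).toLinearMap (LinearMap.ker_eq_bot.mpr h1)
  have h4 : (aeval (R := F) (shiftOp F 1)).toLinearMap ∘ (fun n : ℕ => (C c * (X - 1) : F[X]) ^ n)
      = fun n : ℕ => (c • (shiftOp F 1 - 1)) ^ n := funext fun n => by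
    simp [Algebra.smul_def]
  rwa [h4] at h3

end Model

end Independence

/-! ### Polynomial models with a free Casimir parameter, and independence of the ordered monomials.
-/

section Casimir

variable {F : Type} [Field F] [CharZero F] [StarRing F]

/-- The relations of the quantum sphere. -/
structure SphereOps {D : Type*} [Ring D] [Algebra F D] (q : F) (X Y Z : D) : Prop where
  XZ : X * Z = q ^ 2 • (Z * X)
  ZY : Z * Y = q ^ 2 • (Y * Z)
  XY : X * Y + q ^ 2 • (Z * Z) = 1
  YX : Y * X + (q⁻¹) ^ 2 • (Z * Z) = 1

namespace SphereOps

variable {D : Type*} [Ring D] [Algebra F D]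

theorem map {D' : Type*} [Ring D'] [Algebra F D'] {q : F} {X Y Z : D} (h : SphereOps q X Y Z)
    (f : D →ₐ[F] D') : SphereOps q (f X) (f Y) (f Z) where
  XZ := by simpa using congrArg f h.XZ
  ZY := by simpa using congrArg f h.ZY
  XY := by simpa using congrArg f h.XY
  YX := by simpa using congrArg f h.YX

/-- When `X = S` is invertible, the relation `YX` forces the value of `Y`. The remaining sphere
relations then follow from the `q²`-commutation of `S` and `Z`. -/
theorem of_shift {q : F} {S Si Z : D} (h1 : S * Si = 1) (h2 : Si * S = 1)
    (h3 : S * Z = q ^ 2 • (Z * S)) : SphereOps q S ((1 - (q⁻¹) ^ 2 • (Z * Z)) * Si) Z := by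
  have h4 : Z * Si = q ^ 2 • (Si * Z) := by
    have : Si * (S * Z) * Si = Si * (q ^ 2 • (Z * S)) * Si := by rw [h3]
    rwa [← mul_assoc, h2, one_mul, mul_smul_comm, smul_mul_assoc, mul_assoc Si, mul_assoc Z, h1,
      mul_one] at this
  have h5 : S * (Z * Z) = q ^ 4 • (Z * Z * S) := by
    rw [← mul_assoc, h3, smul_mul_assoc, mul_assoc, h3, mul_smul_comm, smul_smul, mul_assoc]
    congr 1; ring
  refine ⟨h3, ?_, ?_, ?_⟩
  · rw [mul_assoc _ Si Z, ← mul_assoc Z, ← mul_smul_comm (q ^ 2) _ (Si * Z), ← h4, ← mul_assoc]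
    congr 1
    simp [mul_sub, sub_mul, mul_assoc]
  · rw [← mul_assoc, mul_sub, mul_smul_comm, h5, mul_one, sub_mul, smul_mul_assoc, smul_mul_assoc,
      mul_assoc _ S Si, h1, mul_one]
    match_scalars <;> field_simp
    ring
  · rw [mul_assoc, h2, mul_one, sub_add_cancel]

/-- The Casimir element can be prescribed. -/
theorem uqOps (q : QParam F) {X Y Z Zi v : D} (h : SphereOps q.val X Y Z) (hZ : Z * Zi = 1)
    (hZ' : Zi * Z = 1) (hX : Commute v X) (hY : Commute v Y) (hvZ : Commute v Z) :
    UqOps q.val X Y Z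
      ((v - (q.val - q.val⁻¹)⁻¹ • (q.val • X + q.val⁻¹ • Y)) * Zi) := by
  have hs := IndQ.sub_inv_ne_zero q
  have hs2 := IndQ.sq_sub_one_ne_zero q
  have h0 := q.ne_zero
  have h2 := UqOps.qInt_two hs
  obtain ⟨hXZ, hZY, hXY, hYX⟩ := h
  generalize q.val = Q at *
  -- This solves `v = θ Z + (Q - Q⁻¹)⁻¹ (Q X + Q⁻¹ Y)` for `θ`, the right-hand side being the
  -- Casimir element. Any `v` commuting with `X`, `Y` and `Z` is allowed.
  set θ := (v - (Q - Q⁻¹)⁻¹ • (Q • X + Q⁻¹ • Y)) * Zi with hθ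
  have hθZ : θ * Z = v - (Q - Q⁻¹)⁻¹ • (Q • X + Q⁻¹ • Y) := by rw [hθ, mul_assoc, hZ', mul_one]
  have hu : IsUnit Z := ⟨⟨Z, Zi, hZ, hZ'⟩, rfl⟩
  have hYZ : Y * Z = (Q⁻¹) ^ 2 • (Z * Y) := by
    rw [hZY, smul_smul]
    match_scalars
    field_simp
  have hZX : Z * X = (Q⁻¹) ^ 2 • (X * Z) := by
    rw [hXZ, smul_smul]
    match_scalars
    field_simp
  refine ⟨hXZ, hZY, hXY, hYX, ?_, ?_, ?_⟩
  -- After right multiplication by the unit `Z`, every occurrence of `θ` can be brought into the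
  -- form `θ Z`, which no longer involves `Zi`.
  · apply hu.mul_right_cancel
    rw [h2, sub_mul, smul_mul_assoc, smul_mul_assoc, smul_mul_assoc, mul_assoc, mul_assoc θ, hXZ,
      mul_smul_comm, ← mul_assoc θ, hθZ]
    simp only [mul_sub, sub_mul, mul_smul_comm, smul_mul_assoc, mul_add, add_mul, hX.eq]
    linear_combination (norm := skip) (Q - Q⁻¹)⁻¹ • (hYX - hXY)
    match_scalars <;> field_simp <;> ring
  · apply hu.mul_right_cancel
    rw [h2, sub_mul, smul_mul_assoc, smul_mul_assoc, smul_mul_assoc, mul_assoc, mul_assoc Y, hYZ,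
      mul_smul_comm, ← mul_assoc θ, hθZ]
    simp only [mul_sub, sub_mul, mul_smul_comm, smul_mul_assoc, mul_add, add_mul, hY.eq]
    linear_combination (norm := skip) (Q - Q⁻¹)⁻¹ • (hYX - hXY)
    match_scalars <;> field_simp <;> ring
  · apply hu.mul_right_cancel
    rw [sub_mul, sub_mul, mul_assoc, hθZ]
    simp only [mul_sub, sub_mul, mul_smul_comm, smul_mul_assoc, mul_add, add_mul, hvZ.eq, hYZ, hZX]
    match_scalars <;> field_simp <;> ring

end SphereOps

open Polynomial
open scoped LaurentPolynomial
open LaurentPolynomial (T T_add commute_T)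

/-- The inclusion of polynomials into Laurent polynomials, over a noncommutative algebra. -/
def toLaurentHom (F E : Type*) [Field F] [Ring E] [Algebra F E] : E[X] →ₐ[F] E[T;T⁻¹] :=
  { Polynomial.toLaurent with
    commutes' := fun r => Polynomial.toLaurent_C (algebraMap F E r) }

/-- The inclusion of the constants into polynomials, over a noncommutative algebra. -/
def constHom (F E : Type*) [Field F] [Ring E] [Algebra F E] : E →ₐ[F] E[X] :=
  { Polynomial.C with commutes' := fun _ => rfl }

/-- Independence is tested in an explicit representation with two new variables. In `E[X]` the
variable measures the degree in `Z`. Laurent polynomials then make `Z` invertible, and a second,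
central variable serves as Casimir element, so that `θ` has degree one in it. Independence is gained
in three stages: powers of `x` in `E`, then one sphere monomial in each `Z`-degree, then one power
of `θ` in each Casimir degree. -/
theorem linearIndependent_mon_of_shift (q : QParam F) {η : F} (hη0 : η ≠ 0) {E : Type*} [Ring E]
    [Algebra F E] {s si d di : E} (hs : s * si = 1) (hs' : si * s = 1) (hd : d * di = 1)
    (hd' : di * d = 1) (hsd : s * d = q.val ^ 2 • (d * s))
    (hli : LinearIndependent F fun n : ℕ => (η⁻¹ • (s - 1)) ^ n) :
    LinearIndependent F (SpecRel.mon q.val (η⁻¹ • (Uq.X q - 1)) (η⁻¹ • (star (Uq.X q) - 1))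
      (η⁻¹ • Uq.Z q) (Uq.θ q)) := by
  set Q := q.val with hQ
  have h0 : Q ≠ 0 := q.ne_zero
  let S : E[X] := C s
  let Si : E[X] := C si
  let Z : E[X] := C d * X
  let Y : E[X] := (1 - (Q⁻¹) ^ 2 • (Z * Z)) * Si
  have hS : SphereOps Q S Y Z := by
    refine SphereOps.of_shift ?_ ?_ ?_
    · rw [← C_mul, hs, C_1]
    · rw [← C_mul, hs', C_1]
    · rw [← mul_assoc, ← C_mul, hsd, mul_assoc _ X, X_mul, ← mul_assoc, ← C_mul,
        ← smul_mul_assoc (Q ^ 2) (C _) X, smul_C]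
  let ι := toLaurentHom F E
  let κ := constHom F E[T;T⁻¹]
  obtain ⟨Zi, hZi_def⟩ : ∃ Zi : E[T;T⁻¹], Zi = LaurentPolynomial.C di * T (-1) := ⟨_, rfl⟩
  have hιZ : ι Z = LaurentPolynomial.C d * T 1 := by
    show Polynomial.toLaurent (Polynomial.C _ * X) = _
    rw [map_mul, Polynomial.toLaurent_C, Polynomial.toLaurent_X]
  have hZi : ι Z * Zi = 1 := by
    rw [hιZ, hZi_def, mul_assoc, ← mul_assoc (T 1), (commute_T 1 _).eq, mul_assoc _ (T 1), ← T_add,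
      ← mul_assoc, ← map_mul, hd]
    simp
  have hZi' : Zi * ι Z = 1 := by
    rw [hιZ, hZi_def, mul_assoc, ← mul_assoc (T (-1)), (commute_T (-1) _).eq, mul_assoc _ (T (-1)), ← T_add,
      ← mul_assoc, ← map_mul, hd']
    simp
  -- Here `X` is the outer variable, which is central, hence an admissible Casimir element.
  have hops := ((hS.map ι).map κ).uqOps q (Zi := κ Zi) (v := X)
    (by rw [← map_mul, hZi, map_one]) (by rw [← map_mul, hZi', map_one])
    (Polynomial.commute_X _) (Polynomial.commute_X _) (Polynomial.commute_X _)
  set Θ := (X - (Q - Q⁻¹)⁻¹ • (Q • κ (ι S) + Q⁻¹ • κ (ι Y))) * κ Zi with hΘ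
  obtain ⟨Ψ, hΨX, hΨY, hΨZ, hΨθ⟩ := hops.exists_algHom
  let w : E[X] := SpecRel.w Q (η⁻¹ • (S - 1)) (η⁻¹ • (Y - 1)) (η⁻¹ • Z)
  have hw : w = (η⁻¹ * η⁻¹) • (2 - S - Y) := by
    show (η⁻¹ • (S - 1)) * (η⁻¹ • (Y - 1)) + Q ^ 2 • ((η⁻¹ • Z) * (η⁻¹ • Z)) = _
    simp only [smul_mul_assoc, mul_smul_comm, sub_mul, mul_sub, one_mul, mul_one, smul_smul,
      smul_sub]
    have h2 : (2 : E[X]) = (2 : F) • 1 := by rw [two_smul, one_add_one_eq_two]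
    rw [h2]
    linear_combination (norm := module) (η⁻¹ * η⁻¹) • hS.XY
  have hC2 : ∀ n : ℕ, (2 : E[X]).coeff (n + 1) = 0 := fun n => by
    rw [← one_add_one_eq_two, coeff_add, coeff_one]; simp
  have hZZ : Z * Z = C (d * d) * X ^ 2 := by
    show C _ * X * (C _ * X) = _
    rw [mul_assoc, ← mul_assoc X, X_mul, mul_assoc _ X X, ← mul_assoc, ← C_mul, pow_two]
  have hY : Y = Si - C ((Q⁻¹) ^ 2 • (d * d * si)) * X ^ 2 := by
    show (1 - (Q⁻¹) ^ 2 • (Z * Z)) * Si = _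
    rw [sub_mul, one_mul, hZZ, smul_mul_assoc, mul_assoc _ (X ^ 2), ((commute_X Si).pow_left 2).eq,
      ← mul_assoc, ← C_mul, ← smul_mul_assoc, smul_C]
  have hud : IsUnit d := ⟨⟨_, _, hd, hd'⟩, rfl⟩
  have hus : IsUnit si := ⟨⟨_, _, hs', hs⟩, rfl⟩
  have husmul : ∀ {c : F} {a : E}, c ≠ 0 → IsUnit a → IsUnit (c • a) := fun {c a} hc ha => by
    rw [Algebra.smul_def]
    exact ((IsUnit.mk0 c hc).map (algebraMap F E)).mul ha
  have hη2 : η⁻¹ ≠ 0 := inv_ne_zero hη0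
  have hQ2 : Q⁻¹ ≠ 0 := inv_ne_zero h0
  have hw2 : w.natDegree ≤ 2 := by
    rw [hw, hY]
    refine (natDegree_smul_le _ _).trans ?_
    refine (natDegree_sub_le_of_le (m := 2) (n := 2)
      ((natDegree_sub_le_of_le (m := 2) (n := 2) ?_ ?_).trans (max_self 2).le)
      ((natDegree_sub_le_of_le (m := 2) (n := 2) ?_ ?_).trans (max_self 2).le)).trans (max_self 2).le
    · exact (natDegree_ofNat 2).le.trans (Nat.zero_le _)
    · exact (natDegree_C _).le.trans (Nat.zero_le _)
    · exact (natDegree_C _).le.trans (Nat.zero_le _)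
    · exact natDegree_C_mul_X_pow_le _ _
  have hw2' : IsUnit (w.coeff 2) := by
    have : w.coeff 2 = (η⁻¹ * η⁻¹) •
        ((Q⁻¹) ^ 2 • (d * d * si)) := by
      rw [hw, hY, coeff_smul, coeff_sub, coeff_sub, coeff_sub, hC2 1, coeff_C_mul_X_pow]
      simp [S, Si, coeff_C]
    rw [this]
    exact husmul (mul_ne_zero hη2 hη2) (husmul (pow_ne_zero 2 hQ2) ((hud.mul hud).mul hus))
  have hz1 : (η⁻¹ • Z).natDegree ≤ 1 :=
    (natDegree_smul_le _ _).trans ((natDegree_C_mul_le _ _).trans natDegree_X_le)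
  have hz1' : IsUnit ((η⁻¹ • Z).coeff 1) := by
    have : (η⁻¹ • Z).coeff 1 = η⁻¹ • d := by
      rw [coeff_smul, coeff_C_mul_X]; simp
    rw [this]
    exact husmul hη2 hud
  have hli1 := linearIndependent_C_mul hli
    (fun n => (natDegree_le_coeff_sphereMon hw2 hw2' hz1 hz1' n).1)
    (fun n => (natDegree_le_coeff_sphereMon hw2 hw2' hz1 hz1' n).2)
  have hli2 := hli1.map' ι.toLinearMap
    (LinearMap.ker_eq_bot.mpr (Polynomial.toLaurent_injective (R := E)))
  -- The leading coefficient of `Θ` in the Casimir variable is `Z⁻¹`, a unit, so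
  -- `linearIndependent_C_mul` applies to its powers.
  have hΘ' : Θ = C Zi * X + C (-((Q - Q⁻¹)⁻¹ • (Q • ι S + Q⁻¹ • ι Y)) * Zi) := by
    have e : ∀ a, κ a = C a := fun _ => rfl
    rw [hΘ, ← e Zi, ← e (_ * Zi)]
    generalize ι S = u
    generalize ι Y = u'
    simp only [map_mul, map_neg, map_smul, map_add]
    rw [sub_mul, X_mul, sub_eq_add_neg, neg_mul]
  have hΘ1 : Θ.natDegree ≤ 1 := by
    rw [hΘ']; exact natDegree_linear_le
  have hΘ1' : IsUnit (Θ.coeff 1) := by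
    have : Θ.coeff 1 = Zi := by
      rw [hΘ', coeff_add, coeff_C_mul_X, coeff_C]; simp
    rw [this]
    exact ⟨⟨_, _, hZi', hZi⟩, rfl⟩
  have hli3 := linearIndependent_C_mul hli2 (G := fun n => Θ ^ n)
    (fun n => by simpa using (natDegree_le_coeff_pow hΘ1 hΘ1' n).1)
    (fun n => by simpa using (natDegree_le_coeff_pow hΘ1 hΘ1' n).2)
  have hli4 := hli3.comp (Equiv.prodAssoc ℕ ℕ ℕ).symm (Equiv.prodAssoc ℕ ℕ ℕ).symm.injective
  refine LinearIndependent.of_comp Ψ.toLinearMap ?_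
  suffices hfun : (Ψ.toLinearMap ∘ SpecRel.mon Q (η⁻¹ • (Uq.X q - 1)) (η⁻¹ • (star (Uq.X q) - 1))
      (η⁻¹ • Uq.Z q) (Uq.θ q)) = _ by
    rw [hfun]
    exact hli4
  funext ⟨a, n, c⟩
  simp only [Function.comp_apply, AlgHom.toLinearMap_apply, SpecRel.mon, map_mul Ψ, map_pow Ψ, hΨθ]
  congr 1
  have e1 : Ψ (η⁻¹ • (Uq.X q - 1)) = κ (ι (η⁻¹ • (S - 1))) := by
    simp only [map_smul, map_sub, map_one, hΨX]
  have e2 : Ψ (η⁻¹ • (star (Uq.X q) - 1)) = κ (ι (η⁻¹ • (Y - 1))) := by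
    simp only [map_smul, map_sub, map_one, hΨY]
  have e3 : Ψ (η⁻¹ • Uq.Z q) = κ (ι (η⁻¹ • Z)) := by
    simp only [map_smul, hΨZ]
  have e4 : Ψ (SpecRel.w q.val (η⁻¹ • (Uq.X q - 1)) (η⁻¹ • (star (Uq.X q) - 1)) (η⁻¹ • Uq.Z q))
      = κ (ι w) := by
    simp only [w, SpecRel.w, map_add, map_smul Ψ (q.val ^ 2), map_smul κ (q.val ^ 2),
      map_smul ι (q.val ^ 2), map_mul, e1, e2, e3, hQ]
  have e5 : C ((η⁻¹ • (s - 1)) ^ a) = (η⁻¹ • (S - 1)) ^ a := by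
    show C ((η⁻¹ • (s - 1)) ^ a) = (η⁻¹ • (C s - 1)) ^ a
    rw [← C_1, ← C_sub, smul_C, C_pow]
  simp only [SpecRel.sphereMon, map_mul Ψ, map_pow Ψ, e1, e3, e4]
  show _ = κ (ι (C ((η⁻¹ • (s - 1)) ^ a) * (w ^ (n / 2) * (η⁻¹ • Z) ^ (n % 2))))
  rw [e5]
  simp only [map_mul, map_pow, ← e4]
  rfl

/-- The required pair of invertible, `q²`-commuting operators is realized on functions on `ℤ` by a
shift and a diagonal operator. -/
theorem linearIndependent_mon_uq (q : QParam F) {η : F} (hη0 : η ≠ 0) :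
    LinearIndependent F (SpecRel.mon q.val (η⁻¹ • (Uq.X q - 1)) (η⁻¹ • (star (Uq.X q) - 1))
      (η⁻¹ • Uq.Z q) (Uq.θ q)) := by
  have h0 := q.ne_zero
  refine linearIndependent_mon_of_shift q hη0 (s := shiftOp F 1) (si := shiftOp F (-1))
    (d := diagOp q.val (-2)) (di := diagOp q.val 2) ?_ ?_ ?_ ?_ (shiftOp_mul_diagOp h0)
    (linearIndependent_shiftOp_pow (inv_ne_zero hη0))
  · rw [shiftOp_mul, add_neg_cancel, shiftOp_zero]
  · rw [shiftOp_mul, neg_add_cancel, shiftOp_zero]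
  · rw [diagOp_mul h0, neg_add_cancel, diagOp_zero]
  · rw [diagOp_mul h0, add_neg_cancel, diagOp_zero]

end Casimir

/-! ### The presentation of the integral form -/

section Presentation

/-- Names for the generators `x`, `y = x*`, `z` and `θ` of the integral form. -/
inductive IGen : Type
  | x
  | y
  | z
  | θ

variable {R : Type*} [CommRing R]

/-- The defining relations of the integral form. -/
inductive IRel (q qi τ η : R) : FreeAlgebra R IGen → FreeAlgebra R IGen → Prop
  | xz : IRel q qi τ η (FreeAlgebra.ι R IGen.x * FreeAlgebra.ι R IGen.z)
      (q ^ 2 • (FreeAlgebra.ι R IGen.z * FreeAlgebra.ι R IGen.x)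
        + (q * τ) • FreeAlgebra.ι R IGen.z)
  | zy : IRel q qi τ η (FreeAlgebra.ι R IGen.z * FreeAlgebra.ι R IGen.y)
      (q ^ 2 • (FreeAlgebra.ι R IGen.y * FreeAlgebra.ι R IGen.z)
        + (q * τ) • FreeAlgebra.ι R IGen.z)
  | sphere : IRel q qi τ η (FreeAlgebra.ι R IGen.x + FreeAlgebra.ι R IGen.y
      + η • (FreeAlgebra.ι R IGen.x * FreeAlgebra.ι R IGen.y
        + q ^ 2 • (FreeAlgebra.ι R IGen.z * FreeAlgebra.ι R IGen.z))) 0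
  | sphere_comm : IRel q qi τ η (FreeAlgebra.ι R IGen.x * FreeAlgebra.ι R IGen.y
        + q ^ 2 • (FreeAlgebra.ι R IGen.z * FreeAlgebra.ι R IGen.z))
      (FreeAlgebra.ι R IGen.y * FreeAlgebra.ι R IGen.x
        + qi ^ 2 • (FreeAlgebra.ι R IGen.z * FreeAlgebra.ι R IGen.z))
  | xθ : IRel q qi τ η (q • (FreeAlgebra.ι R IGen.x * FreeAlgebra.ι R IGen.θ)
      - qi • (FreeAlgebra.ι R IGen.θ * FreeAlgebra.ι R IGen.x) + τ • FreeAlgebra.ι R IGen.θ)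
      ((q + qi) • FreeAlgebra.ι R IGen.z)
  | θy : IRel q qi τ η (q • (FreeAlgebra.ι R IGen.θ * FreeAlgebra.ι R IGen.y)
      - qi • (FreeAlgebra.ι R IGen.y * FreeAlgebra.ι R IGen.θ) + τ • FreeAlgebra.ι R IGen.θ)
      ((q + qi) • FreeAlgebra.ι R IGen.z)
  | zθ : IRel q qi τ η (FreeAlgebra.ι R IGen.z * FreeAlgebra.ι R IGen.θ
      - FreeAlgebra.ι R IGen.θ * FreeAlgebra.ι R IGen.z)
      (FreeAlgebra.ι R IGen.x - FreeAlgebra.ι R IGen.y)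

/-- The universal algebra on generators satisfying `SpecRel`. -/
abbrev IAlg (q qi τ η : R) : Type _ := RingQuot (IRel q qi τ η)

namespace IAlg

/-- The generators. -/
def gen (q qi τ η : R) (s : IGen) : IAlg q qi τ η :=
  RingQuot.mkAlgHom R (IRel q qi τ η) (FreeAlgebra.ι R s)

variable (q qi τ η : R)

theorem specRel : SpecRel q qi τ η (gen q qi τ η IGen.x) (gen q qi τ η IGen.y)
    (gen q qi τ η IGen.z) (gen q qi τ η IGen.θ) where
  xz := by simpa [gen] using RingQuot.mkAlgHom_rel R (IRel.xz (q := q) (qi := qi) (τ := τ) (η := η))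
  zy := by simpa [gen] using RingQuot.mkAlgHom_rel R (IRel.zy (q := q) (qi := qi) (τ := τ) (η := η))
  sphere := by
    simpa [gen] using RingQuot.mkAlgHom_rel R (IRel.sphere (q := q) (qi := qi) (τ := τ) (η := η))
  sphere_comm := by
    simpa [gen] using RingQuot.mkAlgHom_rel R (IRel.sphere_comm (q := q) (qi := qi) (τ := τ) (η := η))
  xθ := by simpa [gen] using RingQuot.mkAlgHom_rel R (IRel.xθ (q := q) (qi := qi) (τ := τ) (η := η))
  θy := by simpa [gen] using RingQuot.mkAlgHom_rel R (IRel.θy (q := q) (qi := qi) (τ := τ) (η := η))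
  zθ := by simpa [gen] using RingQuot.mkAlgHom_rel R (IRel.zθ (q := q) (qi := qi) (τ := τ) (η := η))

theorem adjoin_eq_top : Algebra.adjoin R {gen q qi τ η IGen.x, gen q qi τ η IGen.y,
    gen q qi τ η IGen.z, gen q qi τ η IGen.θ} = ⊤ := by
  refine Algebra.eq_top_iff.mpr fun u => ?_
  obtain ⟨a, rfl⟩ := RingQuot.mkAlgHom_surjective R (IRel q qi τ η) u
  induction a using FreeAlgebra.induction with
  | grade0 r => rw [AlgHom.commutes]; exact Subalgebra.algebraMap_mem _ r
  | grade1 s => exact Algebra.subset_adjoin (by cases s <;> simp [gen])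
  | mul a b ha hb => rw [map_mul]; exact Subalgebra.mul_mem _ ha hb
  | add a b ha hb => rw [map_add]; exact Subalgebra.add_mem _ ha hb

variable {q qi τ η}

theorem exists_algHom {D : Type*} [Ring D] [Algebra R D] {x y z θ : D}
    (h : SpecRel q qi τ η x y z θ) : ∃ g : IAlg q qi τ η →ₐ[R] D,
      g (gen q qi τ η IGen.x) = x ∧ g (gen q qi τ η IGen.y) = y ∧ g (gen q qi τ η IGen.z) = z ∧
        g (gen q qi τ η IGen.θ) = θ := by
  let o : IGen → D
    | IGen.x => x
    | IGen.y => y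
    | IGen.z => z
    | IGen.θ => θ
  have hx : o IGen.x = x := rfl
  have hy : o IGen.y = y := rfl
  have hz : o IGen.z = z := rfl
  have hθ : o IGen.θ = θ := rfl
  have hrel : ∀ ⦃a b⦄, IRel q qi τ η a b → FreeAlgebra.lift R o a = FreeAlgebra.lift R o b := by
    obtain ⟨h1, h2, h3, h4, h5, h6, h7⟩ := h
    intro a b hab
    cases hab <;> simp only [map_add, map_sub, map_smul, map_mul, map_zero,
      FreeAlgebra.lift_ι_apply, hx, hy, hz, hθ] <;> assumption
  have key : ∀ s, RingQuot.liftAlgHom R ⟨FreeAlgebra.lift R o, hrel⟩ (gen q qi τ η s) = o s :=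
    fun s => (RingQuot.liftAlgHom_mkAlgHom_apply R _ _ _).trans (FreeAlgebra.lift_ι_apply _ _)
  exact ⟨_, key _, key _, key _, key _⟩

end IAlg

theorem SpecRel.restrictScalars {R' D : Type*} [CommRing R'] [Ring D] [Algebra R D] [Algebra R' D]
    [Algebra R R'] [IsScalarTower R R' D] {q qi τ η : R} {x y z θ : D}
    (h : SpecRel (algebraMap R R' q) (algebraMap R R' qi) (algebraMap R R' τ) (algebraMap R R' η)
      x y z θ) : SpecRel q qi τ η x y z θ where
  xz := by simpa only [← map_pow, ← map_mul, ← map_add, algebraMap_smul] using h.xz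
  zy := by simpa only [← map_pow, ← map_mul, ← map_add, algebraMap_smul] using h.zy
  sphere := by simpa only [← map_pow, ← map_mul, ← map_add, algebraMap_smul] using h.sphere
  sphere_comm := by
    simpa only [← map_pow, ← map_mul, ← map_add, algebraMap_smul] using h.sphere_comm
  xθ := by simpa only [← map_pow, ← map_mul, ← map_add, algebraMap_smul] using h.xθ
  θy := by simpa only [← map_pow, ← map_mul, ← map_add, algebraMap_smul] using h.θy
  zθ := h.zθ

theorem SpecRel.of_map {D D' : Type*} [Ring D] [Algebra R D] [Ring D'] [Algebra R D']
    {q qi τ η : R} {x y z θ : D} (f : D →ₐ[R] D') (hf : Function.Injective f)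
    (h : SpecRel q qi τ η (f x) (f y) (f z) (f θ)) : SpecRel q qi τ η x y z θ where
  xz := hf (by simpa using h.xz)
  zy := hf (by simpa using h.zy)
  sphere := hf (by simpa using h.sphere)
  sphere_comm := hf (by simpa using h.sphere_comm)
  xθ := hf (by simpa using h.xθ)
  θy := hf (by simpa using h.θy)
  zθ := hf (by simpa using h.zθ)

end Presentation

/-! ### The integral form -/

section IntegralForm

theorem powA_mul_powA : powA 1 * powA (-1) = 1 := AA_ext fun q t hq => by
  rw [map_mul, evalAt_powA, evalAt_powA, map_one, ← Complex.ofReal_mul, ← Real.rpow_add hq]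
  simp

theorem inv_algebraMap_powA : (algebraMap AA FF (powA 1))⁻¹ = algebraMap AA FF (powA (-1)) :=
  inv_eq_of_mul_eq_one_right (by rw [← map_mul, powA_mul_powA, map_one])

theorem tauA_mul_etaA' : tauA * etaA = powA 1 - powA (-1) := tauA_mul_etaA.symm

theorem algebraMap_etaA_ne_zero : algebraMap AA FF etaA ≠ 0 := fun h =>
  etaA_ne_zero (IsFractionRing.injective AA FF (h.trans (map_zero _).symm))

theorem star_etaA : star etaA = etaA :=
  Subtype.ext (funext fun _ => Complex.conj_ofReal _)

theorem coe_star_xA : (star xA : AU).1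
    = (algebraMap AA FF etaA)⁻¹ • (star (Uq.X qF) - 1) := by
  show star ((algebraMap AA FF etaA)⁻¹ • (Uq.X qF - 1)) = _
  rw [star_smul, star_inv₀, star_algebraMap_fractionRing, star_etaA, star_sub, star_one]

theorem star_zA : star zA = zA := Subtype.ext <| by
  show star ((algebraMap AA FF etaA)⁻¹ • Uq.Z qF) = (algebraMap AA FF etaA)⁻¹ • Uq.Z qF
  rw [star_smul, star_inv₀, star_algebraMap_fractionRing, star_etaA, UqOps.star_Z]

theorem star_θA : star θA = θA := Subtype.ext (UqOps.star_θ qF)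

/-- The relations can be checked over `𝔽`, where `η` is invertible. Their coefficients lie in `𝔸`,
so they hold in the subalgebra. -/
theorem specRel_AU : SpecRel (powA 1) (powA (-1)) tauA etaA xA (star xA) zA θA := by
  refine SpecRel.of_map AUsub.toSubalgebra.val Subtype.val_injective ?_
  refine SpecRel.restrictScalars (R' := FF) ?_
  have := (UqOps.uq qF).specRel (τ := algebraMap AA FF tauA) (η := algebraMap AA FF etaA) (by
    rw [← map_mul, tauA_mul_etaA', map_sub, ← inv_algebraMap_powA]; rfl) algebraMap_etaA_ne_zero
  rw [← coe_star_xA] at this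
  rw [← inv_algebraMap_powA]
  exact this

/-- The integral form is generated by `x_𝔸`, its adjoint, `z_𝔸` and `θ_𝔸`. -/
theorem AU_induction {p : AU → Prop} (halg : ∀ a, p (algebraMap AA AU a)) (hx : p xA)
    (hy : p (star xA)) (hz : p zA) (hθ : p θA) (hadd : ∀ a b, p a → p b → p (a + b))
    (hmul : ∀ a b, p a → p b → p (a * b)) (b : AU) : p b := by
  obtain ⟨b, hb⟩ := b
  change b ∈ Algebra.adjoin AA ({θF, xF, zF} ∪ star {θF, xF, zF} : Set (Uq qF)) at hb
  induction hb using Algebra.adjoin_induction with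
  | mem a ha =>
    rcases ha with (rfl | rfl | rfl) | ha
    · exact hθ
    · exact hx
    · exact hz
    · rcases Set.mem_star.mp ha with h | h | h
      · obtain rfl : a = star θF := by rw [← h, star_star]
        have := hθ
        rw [← star_θA] at this
        exact this
      · obtain rfl : a = star xF := by rw [← h, star_star]
        exact hy
      · obtain rfl : a = star zF := by rw [← h, star_star]
        have := hz
        rw [← star_zA] at this
        exact this
  | algebraMap r => exact halg r
  | add a b ha hb iha ihb => exact hadd ⟨a, ha⟩ ⟨b, hb⟩ iha ihb
  | mul a b ha hb iha ihb => exact hmul ⟨a, ha⟩ ⟨b, hb⟩ iha ihb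

/-- The relations `SpecRel` are a presentation of the integral form. -/
theorem exists_algHom_AU {D : Type*} [Ring D] [Algebra AA D] {x y z θ : D}
    (h : SpecRel (powA 1) (powA (-1)) tauA etaA x y z θ) :
    ∃ g : AU →ₐ[AA] D, g xA = x ∧ g (star xA) = y ∧ g zA = z ∧ g θA = θ := by
  obtain ⟨π, hπx, hπy, hπz, hπθ⟩ := IAlg.exists_algHom specRel_AU
  have hspec := IAlg.specRel (powA 1) (powA (-1)) tauA etaA
  set x' := IAlg.gen (powA 1) (powA (-1)) tauA etaA IGen.x
  set y' := IAlg.gen (powA 1) (powA (-1)) tauA etaA IGen.y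
  set z' := IAlg.gen (powA 1) (powA (-1)) tauA etaA IGen.z
  set θ' := IAlg.gen (powA 1) (powA (-1)) tauA etaA IGen.θ
  have hsurj : Function.Surjective π := fun b => by
    refine AU_induction (p := fun b => ∃ a, π a = b) (fun a => ⟨_, π.commutes a⟩) ⟨_, hπx⟩ ⟨_, hπy⟩
      ⟨_, hπz⟩ ⟨_, hπθ⟩ ?_ ?_ b
    · rintro _ _ ⟨a, rfl⟩ ⟨b, rfl⟩
      exact ⟨a + b, map_add _ _ _⟩
    · rintro _ _ ⟨a, rfl⟩ ⟨b, rfl⟩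
      exact ⟨a * b, map_mul _ _ _⟩
  -- An element of the presented algebra is an `𝔸`-combination of ordered monomials by `span_mon`.
  -- The images of these monomials in the algebra over `𝔽` are linearly independent, so an element
  -- mapped to zero has zero coefficients.
  have hinj : Function.Injective π := by
    let f : IAlg (powA 1) (powA (-1)) tauA etaA →ₐ[AA] Uq qF := AUsub.toSubalgebra.val.comp π
    suffices hf : Function.Injective f from
      fun a b hab => hf (congrArg AUsub.toSubalgebra.val hab)
    have htower : IsScalarTower AA FF (Uq qF) :=
      IsScalarTower.of_algebraMap_eq fun _ => rfl
    have hli := (linearIndependent_mon_uq qF algebraMap_etaA_ne_zero).restrict_scalars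
      (R := AA) (by
        intro a b hab
        apply IsFractionRing.injective AA FF
        simpa [Algebra.smul_def] using hab)
    have hmon : ∀ p, SpecRel.mon qF.val ((algebraMap AA FF etaA)⁻¹ • (Uq.X qF - 1))
        ((algebraMap AA FF etaA)⁻¹ • (star (Uq.X qF) - 1)) ((algebraMap AA FF etaA)⁻¹ • Uq.Z qF)
        (Uq.θ qF) p = f (SpecRel.mon (powA 1) x' y' z' θ' p) := fun p => by
      have e1 : f x' = (algebraMap AA FF etaA)⁻¹ • (Uq.X qF - 1) := congrArg Subtype.val hπx
      have e2 : f y' = (algebraMap AA FF etaA)⁻¹ • (star (Uq.X qF) - 1) :=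
        (congrArg Subtype.val hπy).trans coe_star_xA
      have e3 : f z' = (algebraMap AA FF etaA)⁻¹ • Uq.Z qF := congrArg Subtype.val hπz
      have e4 : f θ' = Uq.θ qF := congrArg Subtype.val hπθ
      have e5 : ∀ u : Uq qF, qF.val ^ 2 • u = (powA 1) ^ 2 • u := fun u => by
        rw [← algebraMap_smul FF ((powA 1) ^ 2) u, map_pow]; rfl
      simp only [SpecRel.mon, SpecRel.sphereMon, SpecRel.w, map_mul, map_pow, map_add, map_smul,
        e1, e2, e3, e4, e5]
    rw [injective_iff_map_eq_zero]
    intro a ha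
    have hspan := hspec.span_mon powA_mul_powA tauA_mul_etaA' (IAlg.adjoin_eq_top _ _ _ _)
    obtain ⟨c, rfl⟩ := (Finsupp.mem_span_range_iff_exists_finsupp (R := AA)).mp
      (hspan.ge (Submodule.mem_top (x := a)))
    rw [linearIndependent_iff] at hli
    have : c = 0 := by
      refine hli c ?_
      rw [Finsupp.linearCombination_apply, ← ha, map_finsuppSum]
      exact Finsupp.sum_congr fun p _ => by rw [hmon, map_smul]
    rw [this, Finsupp.sum_zero_index]
  obtain ⟨g, hgx, hgy, hgz, hgθ⟩ := IAlg.exists_algHom h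
  let e := AlgEquiv.ofBijective π ⟨hinj, hsurj⟩
  have he : ∀ {u v}, π u = v → e.symm v = u := fun {u v} huv => by
    rw [← huv]; exact e.symm_apply_apply u
  refine ⟨g.comp e.symm.toAlgHom, ?_, ?_, ?_, ?_⟩
  · exact (congrArg g (he hπx)).trans hgx
  · exact (congrArg g (he hπy)).trans hgy
  · exact (congrArg g (he hπz)).trans hgz
  · exact (congrArg g (he hπθ)).trans hgθ

end IntegralForm

/-! ### Specializations of the integral form and of its modules -/

section Specialization

theorem SpecRel.extendScalars {R R' D : Type*} [CommRing R] [CommRing R'] [Ring D] [Algebra R D]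
    [Algebra R' D] [Algebra R R'] [IsScalarTower R R' D] {q qi τ η : R} {x y z θ : D}
    (h : SpecRel q qi τ η x y z θ) :
    SpecRel (algebraMap R R' q) (algebraMap R R' qi) (algebraMap R R' τ) (algebraMap R R' η)
      x y z θ where
  xz := by simpa only [← map_pow, ← map_mul, ← map_add, algebraMap_smul] using h.xz
  zy := by simpa only [← map_pow, ← map_mul, ← map_add, algebraMap_smul] using h.zy
  sphere := by simpa only [← map_pow, ← map_mul, ← map_add, algebraMap_smul] using h.sphere
  sphere_comm := by
    simpa only [← map_pow, ← map_mul, ← map_add, algebraMap_smul] using h.sphere_comm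
  xθ := by simpa only [← map_pow, ← map_mul, ← map_add, algebraMap_smul] using h.xθ
  θy := by simpa only [← map_pow, ← map_mul, ← map_add, algebraMap_smul] using h.θy
  zθ := h.zθ

variable {q t : ℝ} {hq : 0 < q}

/-- The relations of the generators of the specialization at `(q, t)`. -/
abbrev SpecRelAt (q t : ℝ) (hq : 0 < q) {D : Type*} [Ring D] [Algebra ℂ D] (x y z θ : D) : Prop :=
  SpecRel (evalAt q t hq (powA 1)) (evalAt q t hq (powA (-1))) (evalAt q t hq tauA)
    (evalAt q t hq etaA) x y z θ

/-- Letting `𝔸` act on `D` through evaluation at `(q, t)`, the evaluated relations become an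
instance of the presentation over `𝔸`. -/
theorem exists_hom_of_specRelAt {D : Type*} [Ring D] [Algebra ℂ D] {x y z θ : D}
    (h : SpecRelAt q t hq x y z θ) :
    ∃ ev : AU →+* D, (∀ a, ev (algebraMap AA AU a) = algebraMap ℂ D (evalAt q t hq a)) ∧
      ev xA = x ∧ ev (star xA) = y ∧ ev zA = z ∧ ev θA = θ := by
  let : Algebra AA ℂ := (evalAt q t hq).toAlgebra
  let : Algebra AA D := Algebra.compHom D (evalAt q t hq)
  have : IsScalarTower AA ℂ D := IsScalarTower.of_algebraMap_eq fun _ => rfl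
  obtain ⟨g, hg⟩ := exists_algHom_AU (SpecRel.restrictScalars (R := AA) (R' := ℂ) h)
  exact ⟨g.toRingHom, g.commutes, hg⟩

/-- Together with `exists_hom_of_specRelAt`, this identifies evaluation-linear morphisms out of the
integral form with solutions of the evaluated relations. -/
theorem specRelAt_of_hom {D : Type*} [Ring D] [Algebra ℂ D] (f : AU →+* D)
    (hf : ∀ a, f (algebraMap AA AU a) = algebraMap ℂ D (evalAt q t hq a)) :
    SpecRelAt q t hq (f xA) (f (star xA)) (f zA) (f θA) := by
  let : Algebra AA ℂ := (evalAt q t hq).toAlgebra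
  let : Algebra AA D := Algebra.compHom D (evalAt q t hq)
  have : IsScalarTower AA ℂ D := IsScalarTower.of_algebraMap_eq fun _ => rfl
  let f' : AU →ₐ[AA] D := { f with commutes' := hf }
  exact SpecRel.extendScalars (R' := ℂ) (specRel_AU.map f')

theorem AU_hom_ext {D : Type*} [Ring D] {f g : AU →+* D}
    (ha : ∀ a, f (algebraMap AA AU a) = g (algebraMap AA AU a)) (hx : f xA = g xA)
    (hy : f (star xA) = g (star xA)) (hz : f zA = g zA) (hθ : f θA = g θA) : f = g :=
  RingHom.ext (AU_induction ha hx hy hz hθ (fun a b h h' => by rw [map_add, map_add, h, h'])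
    fun a b h h' => by rw [map_mul, map_mul, h, h'])

/-! ### Criteria for a morphism to be a specialization of algebras. -/

section Algebra

variable {C : Type} [Ring C] [Algebra ℂ C] {ev : AU →+* C}
  (hev : ∀ a, ev (algebraMap AA AU a) = algebraMap ℂ C (evalAt q t hq a))
include hev

/-- The range is a priori only a subring. It is a complex subalgebra because the constant functions
belong to `𝔸`. -/
theorem surjective_of_adjoin_eq_top
    (htop : Algebra.adjoin ℂ {ev xA, ev (star xA), ev zA, ev θA} = ⊤) :
    Function.Surjective ev := by
  let T : Subalgebra ℂ C := { ev.range with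
    algebraMap_mem' := fun c => ⟨algebraMap AA AU (algebraMap ℂ AA c), hev _⟩ }
  have hT : Algebra.adjoin ℂ {ev xA, ev (star xA), ev zA, ev θA} ≤ T := by
    refine Algebra.adjoin_le ?_
    rintro _ (rfl | rfl | rfl | rfl) <;> exact ⟨_, rfl⟩
  intro c
  exact hT (htop ▸ Algebra.mem_top : c ∈ Algebra.adjoin ℂ _)

theorem map_star_of_generators [StarRing C] [StarModule ℂ C]
    (hx : star (ev xA) = ev (star xA)) (hz : star (ev zA) = ev zA) (hθ : star (ev θA) = ev θA)
    (b : AU) : ev (star b) = star (ev b) := by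
  refine AU_induction (p := fun b => ev (star b) = star (ev b)) (fun a => ?_) hx.symm ?_ ?_ ?_
    ?_ ?_ b
  · rw [← algebraMap_star_comm, hev, hev, evalAt_star, algebraMap_star_comm]
  · rw [star_star, ← hx, star_star]
  · rw [star_zA, hz]
  · rw [star_θA, hθ]
  · intro a b ha hb
    rw [star_add, map_add, map_add, ha, hb, star_add]
  · intro a b ha hb
    rw [star_mul, map_mul, map_mul, ha, hb, star_mul]

/-- Universality among `*`-algebras reduces to universality among plain algebras for the evaluated
relations: by surjectivity of `ev`, the induced morphism is unique and automatically respects the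
involution. -/
theorem isAlgSpecialization [StarRing C] [StarModule ℂ C] (hsurj : Function.Surjective ev)
    (hstar : ∀ b, ev (star b) = star (ev b))
    (huniv : ∀ (D : Type w) [Ring D] [Algebra ℂ D] (x y z θ : D), SpecRelAt q t hq x y z θ →
      ∃ g : C →ₐ[ℂ] D, g (ev xA) = x ∧ g (ev (star xA)) = y ∧ g (ev zA) = z ∧ g (ev θA) = θ) :
    IsAlgSpecialization.{w} (evalAt q t hq) ev where
  map_algebraMap := hev
  map_star := hstar
  universal D _ _ _ _ f hf hf' := by
    obtain ⟨g, hgx, hgy, hgz, hgθ⟩ := huniv D _ _ _ _ (specRelAt_of_hom f hf)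
    have hg : ∀ b, g (ev b) = f b := fun b =>
      RingHom.congr_fun (f := g.toRingHom.comp ev) (AU_hom_ext (fun a => by
        rw [hf]
        show g (ev (algebraMap AA AU a)) = _
        rw [hev, AlgHom.commutes]) hgx hgy hgz hgθ) b
    refine ⟨{ g with map_star' := fun c => ?_ }, hg, fun g' hg' => ?_⟩
    · obtain ⟨b, rfl⟩ := hsurj c
      show g (star (ev b)) = star (g (ev b))
      rw [← hstar, hg, hg, hf']
    · refine StarAlgHom.ext fun c => ?_
      obtain ⟨b, rfl⟩ := hsurj c
      rw [hg']
      exact (hg b).symm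

end Algebra

/-! ### Specialization of modules with a basis. -/

section Module

variable {ε : ℤˣ} {V : Type} [AddCommGroup V] [Module ℂ V]

theorem evModule_smul (φ : AA →+* ℂ) (ζ : ZPar ε → V) (a : AA) (m : AO ε) :
    evModule φ ζ (a • m) = φ a • evModule φ ζ m := by
  induction m using Finsupp.induction_linear with
  | zero => simp
  | add m n hm hn => rw [smul_add, map_add, map_add, hm, hn, smul_add]
  | single n b => rw [Finsupp.smul_single, evModule_single, evModule_single, smul_eq_mul, map_mul,
      mul_smul]

theorem evModule_basis (ζ : Module.Basis (ZPar ε) ℂ V) (φ : AA →+* ℂ) (n : ZPar ε) :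
    evModule φ ζ (Finsupp.single n 1) = ζ n := by
  rw [evModule_single, map_one, one_smul]

theorem evModule_surjective (ζ : Module.Basis (ZPar ε) ℂ V) :
    Function.Surjective (evModule (evalAt q t hq) ζ) := fun v => by
  have hv : v ∈ Submodule.span ℂ (Set.range ζ) := ζ.mem_span v
  induction hv using Submodule.span_induction with
  | mem v hv =>
    obtain ⟨n, rfl⟩ := hv
    exact ⟨_, evModule_basis ζ _ n⟩
  | zero => exact ⟨0, map_zero _⟩
  | add v w _ _ hv hw =>
    obtain ⟨m, rfl⟩ := hv
    obtain ⟨m', rfl⟩ := hw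
    exact ⟨m + m', map_add _ _ _⟩
  | smul c v _ hv =>
    obtain ⟨m, rfl⟩ := hv
    exact ⟨algebraMap ℂ AA c • m, by rw [evModule_smul, evalAt_algebraMap]⟩

/-- The representation of the integral form on the specialization of a module. -/
theorem exists_hom_end (ζ : Module.Basis (ZPar ε) ℂ V) (α : AU →ₐ[AA] Module.End AA (AO ε)) :
    ∃ β : AU →+* Module.End ℂ V,
      (∀ a, β (algebraMap AA AU a) = algebraMap ℂ _ (evalAt q t hq a)) ∧
      ∀ b m, β b (evModule (evalAt q t hq) ζ m) = evModule (evalAt q t hq) ζ (α b m) := by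
  set e := evModule (evalAt q t hq) ζ
  have he : ∀ a m, e (a • m) = evalAt q t hq a • e m := evModule_smul _ _
  have hen : ∀ n, e (Finsupp.single n 1) = ζ n := evModule_basis ζ _
  -- Prescribing the operator on the basis suffices: `e` is evaluation-linear, so the intertwining
  -- property extends to all of `_𝔸𝒪^ε(K)`. Since `e` is surjective, all algebraic identities for
  -- `β` descend from `α`.
  let β : AU → Module.End ℂ V := fun b => ζ.constr ℂ fun n => e (α b (Finsupp.single n 1))
  have hβ : ∀ b m, β b (e m) = e (α b m) := fun b m => by
    induction m using Finsupp.induction_linear with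
    | zero => simp
    | add m n hm hn => rw [map_add, map_add, hm, hn, map_add, map_add]
    | single n a =>
      have h1 : (Finsupp.single n a : AO ε) = a • Finsupp.single n 1 := by
        rw [Finsupp.smul_single, smul_eq_mul, mul_one]
      rw [h1, he, map_smul, map_smul (α b), he, hen]
      congr 1
      exact ζ.constr_basis ℂ _ n
  have hext : ∀ f g : Module.End ℂ V, (∀ m, f (e m) = g (e m)) → f = g := fun f g h =>
    LinearMap.ext fun v => by
      obtain ⟨m, rfl⟩ := evModule_surjective (hq := hq) (t := t) ζ v
      exact h m
  refine ⟨{ toFun := β, map_one' := ?_, map_mul' := ?_, map_zero' := ?_, map_add' := ?_ },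
    fun a => ?_, hβ⟩
  · exact hext _ _ fun m => by rw [hβ, map_one]; rfl
  · exact fun b b' => hext _ _ fun m => by
      rw [hβ, map_mul, Module.End.mul_apply, Module.End.mul_apply, hβ, hβ]
  · exact hext _ _ fun m => by rw [hβ, map_zero, LinearMap.zero_apply, LinearMap.zero_apply, map_zero]
  · exact fun b b' => hext _ _ fun m => by
      rw [hβ, map_add, LinearMap.add_apply, LinearMap.add_apply, map_add, hβ, hβ]
  · refine hext _ _ fun m => ?_
    show β _ _ = _
    rw [hβ, AlgHom.commutes, Module.algebraMap_end_apply, Module.algebraMap_end_apply, he]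

/-- Because the `ζ_n` form a basis, `V` is the base change of the free module along the evaluation,
so every compatible map factors through it. Surjectivity of `ev` and of `evModule` then gives
`C`-linearity of the factorization, its uniqueness, and the uniqueness of the action. -/
theorem isTheSpecialization {C : Type} [Ring C] [Algebra ℂ C] {ev : AU →+* C}
    (hev : ∀ a, ev (algebraMap AA AU a) = algebraMap ℂ C (evalAt q t hq a))
    (hsurj : Function.Surjective ev) (ζ : Module.Basis (ZPar ε) ℂ V)
    (α : AU →ₐ[AA] Module.End AA (AO ε)) (ρ : C →ₐ[ℂ] Module.End ℂ V)
    (hρ : ∀ b m, evModule (evalAt q t hq) ζ (α b m)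
      = ρ (ev b) (evModule (evalAt q t hq) ζ m)) :
    IsTheSpecialization.{w} q t hq ev α ζ ρ := by
  have he := evModule_surjective (hq := hq) (t := t) ζ
  refine ⟨⟨hρ, fun N _ _ f hf => ?_⟩, fun ρ' hρ' => ?_⟩
  -- The target is only a `C`-module; its complex structure is the one coming from the scalars of
  -- `C`.
  · let _ : Module ℂ N := Module.compHom N (algebraMap ℂ C)
    have hsmul : ∀ (c : ℂ) (n : N), c • n = algebraMap ℂ C c • n := fun _ _ => rfl
    let g : V →ₗ[ℂ] N := ζ.constr ℂ fun n => f (Finsupp.single n 1)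
    have hf' : ∀ (a : AA) (m : AO ε), f (a • m) = evalAt q t hq a • f m := fun a m => by
      have := hf (algebraMap AA AU a) m
      rwa [AlgHom.commutes, Module.algebraMap_end_apply, hev, ← hsmul] at this
    have hg : ∀ m, g (evModule (evalAt q t hq) ζ m) = f m := fun m => by
      induction m using Finsupp.induction_linear with
      | zero => simp
      | add m n hm hn => rw [map_add, map_add, hm, hn, map_add]
      | single n a =>
        have h1 : (Finsupp.single n a : AO ε) = a • Finsupp.single n 1 := by
          rw [Finsupp.smul_single, smul_eq_mul, mul_one]
        rw [h1, evModule_smul, map_smul, hf', evModule_basis]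
        congr 1
        exact ζ.constr_basis ℂ _ n
    refine ⟨g.toAddMonoidHom, ⟨fun c v => ?_, hg⟩, fun g' hg' => ?_⟩
    · obtain ⟨b, rfl⟩ := hsurj c
      obtain ⟨m, rfl⟩ := he v
      show g _ = ev b • g _
      rw [← hρ, hg, hg, hf]
    · refine AddMonoidHom.ext fun v => ?_
      obtain ⟨m, rfl⟩ := he v
      exact (hg'.2 m).trans (hg m).symm
  · refine AlgHom.ext fun c => LinearMap.ext fun v => ?_
    obtain ⟨b, rfl⟩ := hsurj c
    obtain ⟨m, rfl⟩ := he v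
    rw [← hρ, ← hρ'.map_smul]

end Module

/-- A complex `*`-algebra which is universal for the relations of the integral form at `(q, t)` is a
specialization, and the modules of the integral form have specializations. -/
theorem exists_specialization {C : Type} [Ring C] [StarRing C] [Algebra ℂ C] [StarModule ℂ C]
    {x z θ : C} (hspec : SpecRelAt q t hq x (star x) z θ) (hz : star z = z) (hθ : star θ = θ)
    (htop : Algebra.adjoin ℂ {x, star x, z, θ} = ⊤)
    (huniv : ∀ (D : Type w) [Ring D] [Algebra ℂ D] (x' y' z' θ' : D),
      SpecRelAt q t hq x' y' z' θ' →
      ∃ g : C →ₐ[ℂ] D, g x = x' ∧ g (star x) = y' ∧ g z = z' ∧ g θ = θ')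
    (huniv₀ : ∀ (D : Type) [Ring D] [Algebra ℂ D] (x' y' z' θ' : D),
      SpecRelAt q t hq x' y' z' θ' →
      ∃ g : C →ₐ[ℂ] D, g x = x' ∧ g (star x) = y' ∧ g z = z' ∧ g θ = θ')
    {ε : ℤˣ} {V : Type} [AddCommGroup V] [Module ℂ V] (ζ : Module.Basis (ZPar ε) ℂ V)
    (α : AU →ₐ[AA] Module.End AA (AO ε)) :
    ∃ ev : AU →+* C, IsEv.{w} q t hq x z θ ev ∧
      ∃ ρ : C →ₐ[ℂ] Module.End ℂ V, IsTheSpecialization.{w} q t hq ev α ζ ρ ∧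
        (∀ m, ρ x (evModule (evalAt q t hq) ζ m) = evModule (evalAt q t hq) ζ (α xA m)) ∧
        (∀ m, ρ (star x) (evModule (evalAt q t hq) ζ m)
          = evModule (evalAt q t hq) ζ (α (star xA) m)) ∧
        (∀ m, ρ z (evModule (evalAt q t hq) ζ m) = evModule (evalAt q t hq) ζ (α zA m)) ∧
        (∀ m, ρ θ (evModule (evalAt q t hq) ζ m) = evModule (evalAt q t hq) ζ (α θA m)) := by
  obtain ⟨ev, hev, rfl, hy, rfl, rfl⟩ := exists_hom_of_specRelAt hspec
  rw [← hy] at htop huniv huniv₀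
  have hsurj := surjective_of_adjoin_eq_top hev htop
  have hstar := map_star_of_generators hev hy.symm hz hθ
  obtain ⟨β, hβ, hβ'⟩ := exists_hom_end (hq := hq) (t := t) ζ α
  -- The endomorphism algebra lives in the lowest universe, whereas the test algebras of the
  -- specialization live in universe `w`; hence two instances of the universal property are assumed.
  obtain ⟨ρ, hρx, hρy, hρz, hρθ⟩ := huniv₀ (Module.End ℂ V) _ _ _ _ (specRelAt_of_hom β hβ)
  have hρ : ∀ b, ρ (ev b) = β b := fun b =>
    RingHom.congr_fun (f := ρ.toRingHom.comp ev) (AU_hom_ext (fun a => by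
      rw [hβ]
      show ρ (ev (algebraMap AA AU a)) = _
      rw [hev, AlgHom.commutes]) hρx hρy hρz hρθ) b
  refine ⟨ev, ⟨isAlgSpecialization hev hsurj hstar huniv, rfl, rfl, rfl⟩, ρ,
    isTheSpecialization hev hsurj ζ α ρ (fun b m => by rw [hρ, hβ']), ?_, ?_, ?_, ?_⟩
  · exact fun m => by rw [hρ, hβ']
  · exact fun m => by rw [← hy, hρ, hβ']
  · exact fun m => by rw [hρ, hβ']
  · exact fun m => by rw [hρ, hβ']

end Specialization

/-! ### The quantized enveloping algebra as a specialization -/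

section QuantumRow

variable {q t : ℝ} {hq : 0 < q} (hq1 : q ≠ 1) (ht : t ≠ 0)

theorem evalAt_powA_one_eq (q t : ℝ) (hq : 0 < q) : evalAt q t hq (powA 1) = ((q ^ t : ℝ) : ℂ) := by
  rw [evalAt_powA, one_mul]

theorem evalAt_powA_neg_one_eq (q t : ℝ) (hq : 0 < q) :
    evalAt q t hq (powA (-1)) = ((q ^ t : ℝ) : ℂ)⁻¹ := by
  rw [evalAt_powA, neg_one_mul, Real.rpow_neg hq.le, Complex.ofReal_inv]

theorem specRelAt_uq : SpecRelAt q t hq ((etaFun q t : ℂ)⁻¹ • (Uq.X (qC q t hq hq1 ht) - 1))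
    (star ((etaFun q t : ℂ)⁻¹ • (Uq.X (qC q t hq hq1 ht) - 1)))
    ((etaFun q t : ℂ)⁻¹ • Uq.Z (qC q t hq hq1 ht)) (Uq.θ (qC q t hq hq1 ht)) := by
  have h0 : (etaFun q t : ℂ) ≠ 0 := Complex.ofReal_ne_zero.mpr (etaFun_ne_zero t hq hq1)
  have h1 : (t : ℂ) * etaFun q t = (qC q t hq hq1 ht).val - (qC q t hq hq1 ht).val⁻¹ := by
    have := congrArg (evalAt q t hq) tauA_mul_etaA'
    rwa [map_mul, map_sub, evalAt_powA_one_eq, evalAt_powA_neg_one_eq] at this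
  have h2 := (UqOps.uq (qC q t hq hq1 ht)).specRel h1 h0
  have h3 : star ((etaFun q t : ℂ)⁻¹ • (Uq.X (qC q t hq hq1 ht) - 1))
      = (etaFun q t : ℂ)⁻¹ • (star (Uq.X (qC q t hq hq1 ht)) - 1) := by
    rw [star_smul, star_sub, star_one, star_inv₀]
    congr 2
    exact Complex.conj_ofReal _
  rw [h3, SpecRelAt, evalAt_powA_one_eq, evalAt_powA_neg_one_eq]
  exact h2

/-- The elements `1 + η x`, `1 + η y`, `η z` satisfy the relations of `U_{q^t}(𝔤)`. Division by
`η(q, t) ≠ 0` then recovers the prescribed images. -/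
theorem exists_algHom_uq {D : Type*} [Ring D] [Algebra ℂ D] {x y z θ : D}
    (h : SpecRelAt q t hq x y z θ) : ∃ g : Uq (qC q t hq hq1 ht) →ₐ[ℂ] D,
      g ((etaFun q t : ℂ)⁻¹ • (Uq.X (qC q t hq hq1 ht) - 1)) = x ∧
      g (star ((etaFun q t : ℂ)⁻¹ • (Uq.X (qC q t hq hq1 ht) - 1))) = y ∧
      g ((etaFun q t : ℂ)⁻¹ • Uq.Z (qC q t hq hq1 ht)) = z ∧ g (Uq.θ (qC q t hq hq1 ht)) = θ := by
  have h0 : (etaFun q t : ℂ) ≠ 0 := Complex.ofReal_ne_zero.mpr (etaFun_ne_zero t hq hq1)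
  have h1 : (t : ℂ) * etaFun q t = (qC q t hq hq1 ht).val - (qC q t hq hq1 ht).val⁻¹ := by
    have := congrArg (evalAt q t hq) tauA_mul_etaA'
    rwa [map_mul, map_sub, evalAt_powA_one_eq, evalAt_powA_neg_one_eq] at this
  rw [SpecRelAt, evalAt_powA_one_eq, evalAt_powA_neg_one_eq] at h
  obtain ⟨g, hX, hY, hZ, hθ⟩ := (UqOps.of_specRel (q := qC q t hq hq1 ht) h h1).exists_algHom
  have h3 : star ((etaFun q t : ℂ)⁻¹ • (Uq.X (qC q t hq hq1 ht) - 1))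
      = (etaFun q t : ℂ)⁻¹ • (star (Uq.X (qC q t hq hq1 ht)) - 1) := by
    rw [star_smul, star_sub, star_one, star_inv₀]
    congr 2
    exact Complex.conj_ofReal _
  rw [evalAt_etaA] at *
  refine ⟨g, ?_, ?_, ?_, hθ⟩
  · rw [map_smul, map_sub, map_one, hX, add_sub_cancel_left, inv_smul_smul₀ h0]
  · rw [h3, map_smul, map_sub, map_one, hY, add_sub_cancel_left, inv_smul_smul₀ h0]
  · rw [map_smul, hZ, inv_smul_smul₀ h0]

theorem eq_top_of_inv_smul_mem {C : Type*} [Ring C] [Algebra ℂ C] {c : ℂ} (hc : c ≠ 0)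
    (T : Subalgebra ℂ C) {X : C} (h : c⁻¹ • (X - 1) ∈ T) : X ∈ T := by
  have : X = c • (c⁻¹ • (X - 1)) + 1 := by rw [smul_inv_smul₀ hc, sub_add_cancel]
  rw [this]
  exact T.add_mem (T.smul_mem h _) T.one_mem

/-- Shared by the two cases with `q ≠ 1`. The constant `c` is real, so that the adjoint of the
rescaled generator is the rescaled adjoint. -/
theorem adjoin_star_presented_eq_top
    {rel : FreeAlgebra ℂ (Gen ⊕ Gen) → FreeAlgebra ℂ (Gen ⊕ Gen) → Prop} {c : ℝ} (hc : (c : ℂ) ≠ 0)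
    (hZ : star (StarPresented.gen rel Gen.Z) = StarPresented.gen rel Gen.Z)
    (hθ : star (StarPresented.gen rel Gen.θ) = StarPresented.gen rel Gen.θ) :
    Algebra.adjoin ℂ {(c : ℂ)⁻¹ • (StarPresented.gen rel Gen.X - 1),
      star ((c : ℂ)⁻¹ • (StarPresented.gen rel Gen.X - 1)),
      (c : ℂ)⁻¹ • StarPresented.gen rel Gen.Z, StarPresented.gen rel Gen.θ} = ⊤ := by
  set T := Algebra.adjoin ℂ {(c : ℂ)⁻¹ • (StarPresented.gen rel Gen.X - 1),
      star ((c : ℂ)⁻¹ • (StarPresented.gen rel Gen.X - 1)),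
      (c : ℂ)⁻¹ • StarPresented.gen rel Gen.Z, StarPresented.gen rel Gen.θ}
  have hX : StarPresented.gen rel Gen.X ∈ T :=
    eq_top_of_inv_smul_mem hc T (Algebra.subset_adjoin (by simp))
  have hX' : star (StarPresented.gen rel Gen.X) ∈ T := by
    refine eq_top_of_inv_smul_mem hc T ?_
    have : star ((c : ℂ)⁻¹ • (StarPresented.gen rel Gen.X - 1))
        = (c : ℂ)⁻¹ • (star (StarPresented.gen rel Gen.X) - 1) := by
      rw [star_smul, star_sub, star_one, star_inv₀]
      congr 2
      exact Complex.conj_ofReal _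
    rw [← this]
    exact Algebra.subset_adjoin (by simp)
  have hZT : StarPresented.gen rel Gen.Z ∈ T := by
    rw [← smul_inv_smul₀ hc (StarPresented.gen rel Gen.Z)]
    exact T.smul_mem (Algebra.subset_adjoin (by simp)) _
  have hθT : StarPresented.gen rel Gen.θ ∈ T := Algebra.subset_adjoin (by simp)
  refine StarPresented.eq_top_of_gen_mem (fun s => ?_) fun s => ?_
  · cases s <;> assumption
  · cases s
    · exact hX'
    · rwa [hZ]
    · rwa [hθ]

end QuantumRow

/-! ### The enveloping algebra of the transformation groupoid as a specialization -/

section GroupoidRow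

/-- The relations of the generators of `U(𝔤₀^⋆)` and of their adjoints, with `Y` standing for the
adjoint of `X`. -/
structure GroupoidOps {D : Type*} [Ring D] (X Y Z θ : D) : Prop where
  XZ : X * Z = Z * X
  ZY : Z * Y = Y * Z
  XY_comm : X * Y = Y * X
  XY : X * Y + Z * Z = 1
  θX : θ * X - X * θ = -2 * Z
  θY : θ * Y - Y * θ = 2 * Z
  θZ : θ * Z - Z * θ = Y - X

namespace GroupoidOps

open StarPresented MulOpposite in
theorem exists_algHom {D : Type*} [Ring D] [Algebra ℂ D] {X Y Z θ : D}
    (h : GroupoidOps X Y Z θ) :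
    ∃ g : UG0star →ₐ[ℂ] D, g UG0star.X = X ∧ g (star UG0star.X) = Y ∧ g UG0star.Z = Z ∧
      g UG0star.θ = θ := by
  let o : Gen ⊕ Gen → D
    | Sum.inl Gen.X => X
    | Sum.inr Gen.X => Y
    | Sum.inl Gen.Z => Z
    | Sum.inr Gen.Z => Z
    | Sum.inl Gen.θ => θ
    | Sum.inr Gen.θ => θ
  have g1 : o (Sum.inl Gen.X) = X := rfl
  have g2 : o (Sum.inr Gen.X) = Y := rfl
  have g3 : o (Sum.inl Gen.Z) = Z := rfl
  have g4 : o (Sum.inr Gen.Z) = Z := rfl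
  have g5 : o (Sum.inl Gen.θ) = θ := rfl
  have g6 : o (Sum.inr Gen.θ) = θ := rfl
  have hnum : unop (freeStar ℂ Gen (2 : FreeAlgebra ℂ (Gen ⊕ Gen))) = 2 := by
    rw [map_ofNat]; rfl
  obtain ⟨g, hg, hg'⟩ := StarPresented.exists_algHom (rel := G0starRel) o fun a b hab => by
    obtain ⟨h1, h1s, h2, h3, h4, h4s, h5⟩ := h
    generalize o = o at *
    cases hab with
    | of h =>
      cases h <;> simp only [map_mul, map_add, map_sub, map_one, map_zero, map_neg, map_ofNat,
        FreeAlgebra.lift_ι_apply, g1, g2, g3, g4, g5, g6, pow_two Z, map_pow]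
      · exact h2
      · exact h1
      · exact h3
      · linear_combination (norm := noncomm_ring) h4 + h4s
      · linear_combination (norm := noncomm_ring) h4 - h4s - 2 * h5
      · linear_combination (norm := noncomm_ring) h4 - h4s + 2 * h5
    | star h =>
      cases h <;> simp only [map_mul, map_add, map_sub, map_one, map_zero, map_neg, hnum,
        FreeAlgebra.lift_ι_apply, g1, g2, g3, g4, g5, g6, pow_two Z, map_pow, MulOpposite.unop_mul,
        MulOpposite.unop_add, MulOpposite.unop_sub, MulOpposite.unop_one, MulOpposite.unop_pow,
        MulOpposite.unop_zero, MulOpposite.unop_neg, map_ofNat, MulOpposite.unop_ofNat,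
        MulOpposite.unop_op, freeStar_ι, Sum.swap_inl, Sum.swap_inr]
      · exact h2
      · exact h1s
      · exact h3
      · linear_combination (norm := noncomm_ring) -h4 - h4s
      · linear_combination (norm := noncomm_ring) h4 - h4s + 2 * h5
      · linear_combination (norm := noncomm_ring) h4 - h4s - 2 * h5
  exact ⟨g, hg _, hg' _, hg _, hg _⟩

open StarPresented MulOpposite in
theorem star_Z : star UG0star.Z = UG0star.Z := by
  rw [UG0star.Z, gen, star_mk, freeStar_ι, unop_op]
  exact mk_eq (StarRel.of G0starRel.Z_star)

open StarPresented MulOpposite in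
theorem star_θ : star UG0star.θ = UG0star.θ := by
  rw [UG0star.θ, gen, star_mk, freeStar_ι, unop_op]
  exact mk_eq (StarRel.of G0starRel.θ_star)

open StarPresented MulOpposite in
theorem star_X_eq_mk :
    star UG0star.X = StarPresented.mk G0starRel (FreeAlgebra.ι ℂ (Sum.inr Gen.X)) := by
  exact (star_mk _).trans (by rw [freeStar_ι, unop_op]; rfl)

theorem eq_of_two_mul {D : Type*} [Ring D] [Algebra ℂ D] {a b : D} (h : 2 * a = 2 * b) : a = b := by
  have h2 : ∀ c : D, (2 : ℂ)⁻¹ • (2 * c) = c := fun c => by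
    have : (2 : D) * c = (2 : ℂ) • c := by rw [two_mul, two_smul]
    rw [this, inv_smul_smul₀ two_ne_zero]
  rw [← h2 a, h, h2]

open StarPresented in
theorem uG0star : GroupoidOps UG0star.X (star UG0star.X) UG0star.Z UG0star.θ := by
  have h1 : UG0star.X * UG0star.Z = UG0star.Z * UG0star.X := by
    have := mk_eq (StarRel.of G0starRel.XZ_comm)
    rwa [map_mul, map_mul] at this
  have hT : UG0star.θ * (UG0star.X + star UG0star.X) - (UG0star.X + star UG0star.X) * UG0star.θ = 0 := by
    have := mk_eq (StarRel.of G0starRel.θT)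
    rw [map_sub, map_mul, map_mul, map_add, map_zero] at this
    rw [star_X_eq_mk]
    exact this
  have hP := mk_eq (StarRel.of G0starRel.θTplus)
  have hM := mk_eq (StarRel.of G0starRel.θTminus)
  simp only [map_sub, map_add, map_mul, map_neg, map_ofNat] at hP hM
  have hx := star_X_eq_mk
  change UG0star.θ * (UG0star.X - StarPresented.mk _ (fXs ℂ) - 2 * UG0star.Z)
    - (UG0star.X - StarPresented.mk _ (fXs ℂ) - 2 * UG0star.Z) * UG0star.θ
    = 2 * (UG0star.X - StarPresented.mk _ (fXs ℂ) - 2 * UG0star.Z) at hP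
  change UG0star.θ * (UG0star.X - StarPresented.mk _ (fXs ℂ) + 2 * UG0star.Z)
    - (UG0star.X - StarPresented.mk _ (fXs ℂ) + 2 * UG0star.Z) * UG0star.θ
    = -2 * (UG0star.X - StarPresented.mk _ (fXs ℂ) + 2 * UG0star.Z) at hM
  rw [← hx] at hP hM
  refine ⟨h1, ?_, ?_, ?_, ?_, ?_, ?_⟩
  · have := congrArg star h1
    rwa [star_mul, star_mul, star_Z] at this
  · have := mk_eq (StarRel.of G0starRel.XXs_comm)
    rw [map_mul, map_mul] at this
    rw [hx]
    exact this
  · have := mk_eq (StarRel.of G0starRel.sphere)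
    rw [map_add, map_mul, map_pow, map_one, pow_two (StarPresented.mk _ _)] at this
    rw [hx]
    exact this
  · generalize star UG0star.X = Y at *
    -- From `4 X = 2 T + T⁺ + T⁻`, `4 X* = 2 T - T⁺ - T⁻` and `4 Z = T⁻ - T⁺`, the commutators with
    -- `θ` are obtained up to a factor `4`, removed by two cancellations of `2`.
    apply eq_of_two_mul
    apply eq_of_two_mul
    linear_combination (norm := noncomm_ring) 2 * hT + hP + hM
  · generalize star UG0star.X = Y at *
    apply eq_of_two_mul
    apply eq_of_two_mul
    linear_combination (norm := noncomm_ring) 2 * hT - hP - hM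
  · generalize star UG0star.X = Y at *
    apply eq_of_two_mul
    apply eq_of_two_mul
    linear_combination (norm := noncomm_ring) hM - hP

/-- At `t = 0` one has `q^t = 1` and `τ = 0`: all deformation of the sphere disappears, while `η = 2
log q` survives as a mere scale for the coordinates. -/
theorem specRel {D : Type*} [Ring D] [Algebra ℂ D] {X Y Z θ : D} (h : GroupoidOps X Y Z θ) {η : ℂ}
    (hη : η ≠ 0) :
    SpecRel 1 1 0 η (η⁻¹ • (X - 1)) (η⁻¹ • (Y - 1)) (η⁻¹ • Z) θ := by
  obtain ⟨h1, h2, h3, h4, h5, h6, h7⟩ := h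
  have e : ∀ c : D, 2 * c = (2 : ℂ) • c := fun c => by rw [two_mul, two_smul]
  rw [neg_mul, e] at h5
  rw [e] at h6
  constructor <;>
  simp only [smul_mul_assoc, mul_smul_comm, sub_mul, mul_sub, one_mul, mul_one, smul_smul,
    smul_sub, smul_add, one_pow, mul_zero, zero_smul, one_smul, add_zero, zero_mul]
  · rw [h1]
  · rw [h2]
  · linear_combination (norm := skip) η⁻¹ • h4
    match_scalars <;> field_simp <;> ring
  · linear_combination (norm := module) (η⁻¹ * η⁻¹) • h3
  · linear_combination (norm := skip) -η⁻¹ • h5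
    match_scalars <;> field_simp <;> ring
  · linear_combination (norm := skip) η⁻¹ • h6
    match_scalars <;> field_simp <;> ring
  · linear_combination (norm := module) -η⁻¹ • h7

theorem of_specRel {D : Type*} [Ring D] [Algebra ℂ D] {x y z θ : D} {η : ℂ}
    (h : SpecRel 1 1 0 η x y z θ) : GroupoidOps (1 + η • x) (1 + η • y) (η • z) θ := by
  obtain ⟨h1, h2, h3, h4, h5, h6, h7⟩ := h
  have e : ∀ c : D, 2 * c = (2 : ℂ) • c := fun c => by rw [two_mul, two_smul]
  simp only [one_pow, mul_zero, zero_smul, one_smul, add_zero] at h1 h2 h3 h4 h5 h6 h7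
  constructor <;> (try rw [neg_mul]) <;> (try rw [e]) <;>
  simp only [smul_mul_assoc, mul_smul_comm, add_mul, mul_add, one_mul, mul_one, smul_smul,
    smul_sub, smul_add]
  · rw [h1]
  · rw [h2]
  · linear_combination (norm := module) (η * η) • h4
  · linear_combination (norm := module) η • h3
  · linear_combination (norm := module) -η • h5
  · linear_combination (norm := module) η • h6
  · linear_combination (norm := module) -η • h7

end GroupoidOps

variable {q : ℝ} {hq : 0 < q} (hq1 : q ≠ 1)

theorem etaFun_zero (q : ℝ) : etaFun q 0 = 2 * Real.log q := if_pos rfl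

theorem specRelAt_zero_iff {D : Type*} [Ring D] [Algebra ℂ D] {x y z θ : D} :
    SpecRelAt q 0 hq x y z θ ↔ SpecRel 1 1 0 ((2 * Real.log q : ℝ) : ℂ) x y z θ := by
  rw [SpecRelAt, evalAt_powA, evalAt_powA, evalAt_tauA, evalAt_etaA, etaFun_zero]
  simp

theorem star_inv_smul_X_sub_one (c : ℝ) : star ((c : ℂ)⁻¹ • (UG0star.X - 1))
    = (c : ℂ)⁻¹ • (star UG0star.X - 1) := by
  rw [star_smul, star_sub, star_one, star_inv₀]
  congr 2
  exact Complex.conj_ofReal _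

theorem specRelAt_uG0star (hc : ((2 * Real.log q : ℝ) : ℂ) ≠ 0) :
    SpecRelAt q 0 hq (((2 * Real.log q : ℝ) : ℂ)⁻¹ • (UG0star.X - 1))
    (star (((2 * Real.log q : ℝ) : ℂ)⁻¹ • (UG0star.X - 1)))
    (((2 * Real.log q : ℝ) : ℂ)⁻¹ • UG0star.Z) UG0star.θ := by
  rw [specRelAt_zero_iff, star_inv_smul_X_sub_one]
  exact GroupoidOps.uG0star.specRel hc

theorem exists_algHom_uG0star (hc : ((2 * Real.log q : ℝ) : ℂ) ≠ 0)
    {D : Type*} [Ring D] [Algebra ℂ D] {x y z θ : D}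
    (h : SpecRelAt q 0 hq x y z θ) : ∃ g : UG0star →ₐ[ℂ] D,
      g (((2 * Real.log q : ℝ) : ℂ)⁻¹ • (UG0star.X - 1)) = x ∧
      g (star (((2 * Real.log q : ℝ) : ℂ)⁻¹ • (UG0star.X - 1))) = y ∧
      g (((2 * Real.log q : ℝ) : ℂ)⁻¹ • UG0star.Z) = z ∧ g UG0star.θ = θ := by
  rw [specRelAt_zero_iff] at h
  obtain ⟨g, hX, hY, hZ, hθ⟩ := (GroupoidOps.of_specRel h).exists_algHom
  refine ⟨g, ?_, ?_, ?_, hθ⟩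
  · rw [map_smul, map_sub, map_one, hX, add_sub_cancel_left, inv_smul_smul₀ hc]
  · rw [star_inv_smul_X_sub_one, map_smul, map_sub, map_one, hY, add_sub_cancel_left,
      inv_smul_smul₀ hc]
  · rw [map_smul, hZ, inv_smul_smul₀ hc]

end GroupoidRow

section

attribute [local instance 100] LieRing.ofAssociativeRing

open Matrix

/-! ### Complexified enveloping algebras -/

section EnvelopingUniversal

variable {L : Type} [LieRing L] [LieAlgebra ℝ L]

theorem toEnv_add (x y : L) : toEnv (x + y) = toEnv x + toEnv y := by
  rw [toEnv, map_add, TensorProduct.tmul_add]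
  rfl

theorem toEnv_smul (r : ℝ) (x : L) : toEnv (r • x) = (r : ℂ) • toEnv x := by
  rw [toEnv, toEnv, map_smul, TensorProduct.tmul_smul, TensorProduct.smul_tmul',
    TensorProduct.smul_tmul', smul_eq_mul, Complex.real_smul]

theorem toEnv_neg (x : L) : toEnv (-x) = -toEnv x := by
  rw [toEnv, map_neg, TensorProduct.tmul_neg]
  rfl

theorem toEnv_sub (x y : L) : toEnv (x - y) = toEnv x - toEnv y := by
  rw [sub_eq_add_neg, toEnv_add, toEnv_neg, sub_eq_add_neg]

theorem toEnv_lie (x y : L) : toEnv ⁅x, y⁆ = toEnv x * toEnv y - toEnv y * toEnv x := by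
  rw [toEnv, LieHom.map_lie, LieRing.of_associative_ring_bracket, TensorProduct.tmul_sub, toEnv,
    toEnv, Algebra.TensorProduct.tmul_mul_tmul, Algebra.TensorProduct.tmul_mul_tmul, one_mul]

/-- The universal property of the complexified enveloping algebra. -/
theorem exists_algHom_CEnv {D : Type*} [Ring D] [Algebra ℂ D] (f : L →ₗ[ℝ] D)
    (hf : ∀ x y, f ⁅x, y⁆ = f x * f y - f y * f x) :
    ∃ g : CEnv L →ₐ[ℂ] D, ∀ x, g (toEnv x) = f x := by
  let f' : L →ₗ⁅ℝ⁆ D := { f with map_lie' := fun {x y} => hf x y }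
  refine ⟨AlgHom.liftEquiv ℝ ℂ (UniversalEnvelopingAlgebra ℝ L) D
    (UniversalEnvelopingAlgebra.lift ℝ f'), fun x => ?_⟩
  rw [toEnv, AlgHom.liftEquiv_tmul, one_smul]
  exact UniversalEnvelopingAlgebra.lift_ι_apply ℝ f' x

/-- The Lie algebra maps into the subalgebra `T'` of the real enveloping algebra, and the extension
of this map, followed by the inclusion, is the identity by uniqueness. So `T'` is everything, and
complex multiples of its elements span. -/
theorem eq_top_of_toEnv_mem (T : Subalgebra ℂ (CEnv L)) (h : ∀ x : L, toEnv x ∈ T) : T = ⊤ := by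
  let i : UniversalEnvelopingAlgebra ℝ L →ₐ[ℝ] CEnv L := Algebra.TensorProduct.includeRight
  have h1 : ∀ u : UniversalEnvelopingAlgebra ℝ L, (1 : ℂ) ⊗ₜ[ℝ] u ∈ T := by
    let T' : Subalgebra ℝ (UniversalEnvelopingAlgebra ℝ L) := (T.restrictScalars ℝ).comap i
    let f : L →ₗ⁅ℝ⁆ T' :=
      { toFun := fun x => ⟨UniversalEnvelopingAlgebra.ι ℝ x, h x⟩
        map_add' := fun x y => Subtype.ext (map_add _ x y)
        map_smul' := fun r x => Subtype.ext (map_smul _ r x)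
        map_lie' := fun {x y} => Subtype.ext (LieHom.map_lie _ x y) }
    have hf : T'.val.comp (UniversalEnvelopingAlgebra.lift ℝ f) = AlgHom.id ℝ _ := by
      apply UniversalEnvelopingAlgebra.hom_ext
      apply LieHom.ext
      intro x
      exact congrArg Subtype.val (UniversalEnvelopingAlgebra.lift_ι_apply ℝ f x)
    intro u
    have := (UniversalEnvelopingAlgebra.lift ℝ f u).2
    rwa [show ((UniversalEnvelopingAlgebra.lift ℝ f u : T') : UniversalEnvelopingAlgebra ℝ L) = u
      from DFunLike.congr_fun hf u] at this
  refine Algebra.eq_top_iff.mpr fun u => ?_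
  induction u using TensorProduct.induction_on with
  | zero => exact T.zero_mem
  | tmul c u =>
    have : c ⊗ₜ[ℝ] u = c • ((1 : ℂ) ⊗ₜ[ℝ] u) := by
      rw [TensorProduct.smul_tmul', smul_eq_mul, mul_one]
    rw [this]
    exact T.smul_mem (h1 u) c
  | add a b ha hb => exact T.add_mem ha hb

end EnvelopingUniversal

/-- On `q = 1` both `η = 0` and `q^t = 1`. The sphere equation becomes linear and eliminates `y`,
and the seven relations collapse to three brackets depending on `t`. The cases `t ≠ 0` and `t = 0`
are both read off from here. -/
theorem specRelAt_one_iff {t : ℝ} {D : Type*} [Ring D] [Algebra ℂ D] {x y z θ : D} :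
    SpecRelAt 1 t one_pos x y z θ ↔ x * z - z * x = (t : ℂ) • z ∧ y = -x ∧
      x * θ - θ * x = (2 : ℂ) • z - (t : ℂ) • θ ∧ z * θ - θ * z = (2 : ℂ) • x := by
  rw [SpecRelAt, evalAt_powA, evalAt_powA, evalAt_tauA, evalAt_etaA, etaFun_one, Real.one_rpow,
    Real.one_rpow, Complex.ofReal_one, Complex.ofReal_zero]
  constructor
  · rintro ⟨h1, h2, h3, h4, h5, h6, h7⟩
    obtain rfl : y = -x := by
      rw [zero_smul, add_zero] at h3
      exact eq_neg_of_add_eq_zero_right h3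
    refine ⟨?_, rfl, ?_, ?_⟩
    · linear_combination (norm := module) h1
    · linear_combination (norm := module) h5
    · linear_combination (norm := module) h7
  · rintro ⟨h1, rfl, h2, h3⟩
    constructor <;> (try simp only [mul_neg, neg_mul])
    · linear_combination (norm := module) h1
    · linear_combination (norm := module) h1
    · rw [zero_smul, add_zero, add_neg_cancel]
    · linear_combination (norm := module) h2
    · linear_combination (norm := module) h2
    · linear_combination (norm := module) h3

/-! ### The enveloping algebra of `sl(2, ℝ)` as a specialization -/

section ClassicalRow

theorem lie_eH_eE : ⁅eH, eE⁆ = (2 : ℝ) • eE := Subtype.ext <| by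
  show eH.1 * eE.1 - eE.1 * eH.1 = (2 : ℝ) • eE.1
  ext i j
  fin_cases i <;> fin_cases j <;> simp [eH, eE, Matrix.mul_apply, Fin.sum_univ_two]
  all_goals norm_num

theorem lie_eH_eF : ⁅eH, eF⁆ = (-2 : ℝ) • eF := Subtype.ext <| by
  show eH.1 * eF.1 - eF.1 * eH.1 = (-2 : ℝ) • eF.1
  ext i j
  fin_cases i <;> fin_cases j <;> simp [eH, eF, Matrix.mul_apply, Fin.sum_univ_two]
  all_goals norm_num

theorem lie_eE_eF : ⁅eE, eF⁆ = eH := Subtype.ext <| by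
  show eE.1 * eF.1 - eF.1 * eE.1 = eH.1
  ext i j
  fin_cases i <;> fin_cases j <;> simp [eH, eE, eF, Matrix.mul_apply, Fin.sum_univ_two]

theorem sl2_apply_one_one (Y : sl2) : Y.1 1 1 = -Y.1 0 0 := by
  have h : Y.1 0 0 + Y.1 1 1 = 0 := by
    rw [← trace_fin_two]
    exact Y.2
  linarith

theorem sl2_eq (Y : sl2) : Y = Y.1 0 0 • eH + Y.1 0 1 • eE + Y.1 1 0 • eF := Subtype.ext <| by
  have h := sl2_apply_one_one Y
  show Y.1 = Y.1 0 0 • eH.1 + Y.1 0 1 • eE.1 + Y.1 1 0 • eF.1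
  ext i j
  fin_cases i <;> fin_cases j <;> simp [eH, eE, eF, h]

variable {t : ℝ}

theorem star_real_smul_toEnv_eH : star ((t / 2 : ℂ) • toEnv eH) = -((t / 2 : ℂ) • toEnv eH) := by
  rw [star_smul, star_toEnv, smul_neg]
  congr 2
  have : (t / 2 : ℂ) = ((t / 2 : ℝ) : ℂ) := by push_cast; rfl
  rw [this]
  exact Complex.conj_ofReal _

theorem star_I_mul_smul_toEnv {L : Type} [LieRing L] [LieAlgebra ℝ L] (r : ℝ) (Y : L) :
    star ((Complex.I * r) • toEnv Y) = (Complex.I * r) • toEnv Y := by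
  rw [star_smul, star_toEnv, smul_neg, ← neg_smul]
  congr 1
  simp

theorem specRelAt_sl2 : SpecRelAt 1 t one_pos ((t / 2 : ℂ) • toEnv eH)
    (star ((t / 2 : ℂ) • toEnv eH)) ((Complex.I * t) • toEnv eE)
    (Complex.I • toEnv (eE - eF)) := by
  have hI := Complex.I_mul_I
  have h1 := toEnv_lie eH eE
  have h2 := toEnv_lie eH eF
  have h3 := toEnv_lie eE eF
  rw [lie_eH_eE, toEnv_smul] at h1
  rw [lie_eH_eF, toEnv_smul] at h2
  rw [lie_eE_eF] at h3
  rw [specRelAt_one_iff, star_real_smul_toEnv_eH, toEnv_sub]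
  generalize toEnv eH = h, toEnv eE = e, toEnv eF = f at *
  push_cast at h1 h2
  simp only [smul_mul_assoc, mul_smul_comm, smul_smul, smul_sub, mul_sub, sub_mul]
  refine ⟨?_, trivial, ?_, ?_⟩
  · linear_combination (norm := module) -(t / 2 * (Complex.I * t)) • h1
  · linear_combination (norm := module)
      -(t / 2 * Complex.I) • h1 + (t / 2 * Complex.I) • h2
  · rw [show Complex.I * t * Complex.I = -t by linear_combination t * hI,
      show Complex.I * (Complex.I * t) = -t by linear_combination t * hI]
    linear_combination (norm := module) (-t : ℂ) • h3

/-- For `t ≠ 0` the rescalings `x = tH/2`, `z = itE`, `θ = i(E - F)` can be inverted, and the three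
brackets become those of an `sl(2)`-triple. -/
theorem exists_algHom_sl2 (ht : t ≠ 0) {D : Type*} [Ring D] [Algebra ℂ D] {x y z θ : D}
    (h : SpecRelAt 1 t one_pos x y z θ) : ∃ g : CEnv sl2 →ₐ[ℂ] D,
      g ((t / 2 : ℂ) • toEnv eH) = x ∧ g (star ((t / 2 : ℂ) • toEnv eH)) = y ∧
      g ((Complex.I * t) • toEnv eE) = z ∧ g (Complex.I • toEnv (eE - eF)) = θ := by
  have hI := Complex.I_mul_I
  have htC : (t : ℂ) ≠ 0 := Complex.ofReal_ne_zero.mpr ht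
  rw [specRelAt_one_iff] at h
  obtain ⟨h1, rfl, h2, h3⟩ := h
  obtain ⟨H, rfl⟩ : ∃ H, x = (t / 2 : ℂ) • H :=
    ⟨(2 / t : ℂ) • x, by rw [smul_smul]; field_simp; rw [one_smul]⟩
  obtain ⟨e, rfl⟩ : ∃ e, z = (Complex.I * t) • e :=
    ⟨(Complex.I * t)⁻¹ • z, by rw [smul_inv_smul₀ (mul_ne_zero Complex.I_ne_zero htC)]⟩
  obtain ⟨f, rfl⟩ : ∃ f, θ = Complex.I • (e - f) :=
    ⟨e + Complex.I • θ, by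
      rw [sub_add_cancel_left, smul_neg, smul_smul, hI, neg_one_smul, neg_neg]⟩
  simp only [smul_mul_assoc, mul_smul_comm, smul_smul, smul_sub, mul_sub, sub_mul] at h1 h2 h3
  have k1 : H * e - e * H = (2 : ℂ) • e := by
    have : (t / 2 * (Complex.I * t) : ℂ) ≠ 0 := by simp [ht]
    apply smul_right_injective D this
    linear_combination (norm := module) h1
  -- The bracket of `x` with `θ = i(e - f)` involves both `e` and `f`; the part in `e` is removed by
  -- means of `k1`.
  have k2 : H * f - f * H = (-2 : ℂ) • f := by
    have : (t / 2 * Complex.I : ℂ) ≠ 0 := by simp [ht]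
    apply smul_right_injective D this
    linear_combination (norm := module) -h2 + (t / 2 * Complex.I : ℂ) • k1
  have k3 : e * f - f * e = H := by
    apply smul_right_injective D htC
    show (t : ℂ) • _ = (t : ℂ) • _
    rw [show Complex.I * (Complex.I * (t : ℂ)) = -t by linear_combination t * hI] at h3
    linear_combination (norm := skip) h3
    rw [show Complex.I * t * Complex.I = -t by linear_combination t * hI]
    module
  obtain ⟨g, hg⟩ := exists_algHom_CEnv (L := sl2) (D := D)
    { toFun := fun Y => Y.1 0 0 • H + Y.1 0 1 • e + Y.1 1 0 • f
      map_add' := fun Y Z => by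
        show (Y.1 0 0 + Z.1 0 0) • H + (Y.1 0 1 + Z.1 0 1) • e + (Y.1 1 0 + Z.1 1 0) • f = _
        module
      map_smul' := fun r Y => by
        show (r * Y.1 0 0) • H + (r * Y.1 0 1) • e + (r * Y.1 1 0) • f = r • (_ + _ + _)
        module } (fun Y Z => by
    have k1' : H * e - e * H = (2 : ℝ) • e := by rw [k1, ← Complex.coe_smul]; norm_num
    have k2' : H * f - f * H = (-2 : ℝ) • f := by rw [k2, ← Complex.coe_smul]; norm_num
    show (Y.1 * Z.1 - Z.1 * Y.1) 0 0 • H + (Y.1 * Z.1 - Z.1 * Y.1) 0 1 • e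
      + (Y.1 * Z.1 - Z.1 * Y.1) 1 0 • f
      = (Y.1 0 0 • H + Y.1 0 1 • e + Y.1 1 0 • f) * (Z.1 0 0 • H + Z.1 0 1 • e + Z.1 1 0 • f)
      - (Z.1 0 0 • H + Z.1 0 1 • e + Z.1 1 0 • f) * (Y.1 0 0 • H + Y.1 0 1 • e + Y.1 1 0 • f)
    simp only [Matrix.sub_apply, Matrix.mul_apply, Fin.sum_univ_two, sl2_apply_one_one, add_mul,
      mul_add, smul_mul_assoc, mul_smul_comm, smul_smul]
    generalize Y.1 0 0 = a, Y.1 0 1 = b, Y.1 1 0 = c, Z.1 0 0 = a', Z.1 0 1 = b', Z.1 1 0 = c'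
    linear_combination (norm := module) -(a * b' - b * a') • k1' - (a * c' - c * a') • k2'
      - (b * c' - c * b') • k3)
  have hH : g (toEnv eH) = H := (hg _).trans (by simp [eH])
  have hE : g (toEnv eE) = e := (hg _).trans (by simp [eE])
  have hF : g (toEnv eF) = f := (hg _).trans (by simp [eF])
  refine ⟨g, ?_, ?_, ?_, ?_⟩
  · rw [map_smul, hH]
  · rw [star_real_smul_toEnv_eH, map_neg, map_smul, hH]
  · rw [map_smul, hE]
  · rw [map_smul, toEnv_sub, map_sub, hE, hF]

theorem adjoin_sl2_eq_top (ht : t ≠ 0) : Algebra.adjoin ℂ {(t / 2 : ℂ) • toEnv eH,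
    star ((t / 2 : ℂ) • toEnv eH), (Complex.I * t) • toEnv eE, Complex.I • toEnv (eE - eF)} = ⊤ := by
  set T := Algebra.adjoin ℂ {(t / 2 : ℂ) • toEnv eH, star ((t / 2 : ℂ) • toEnv eH),
    (Complex.I * t) • toEnv eE, Complex.I • toEnv (eE - eF)}
  have htC : (t : ℂ) ≠ 0 := Complex.ofReal_ne_zero.mpr ht
  have key : ∀ {c : ℂ} (_ : c ≠ 0) {Y : CEnv sl2}, c • Y ∈ T → Y ∈ T := fun {c} hc {Y} hY => by
    rw [← inv_smul_smul₀ hc Y]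
    exact T.smul_mem hY _
  have hH : toEnv eH ∈ T := key (div_ne_zero htC two_ne_zero) (Algebra.subset_adjoin (by simp))
  have hE : toEnv eE ∈ T :=
    key (mul_ne_zero Complex.I_ne_zero htC) (Algebra.subset_adjoin (by simp))
  have hF : toEnv eF ∈ T := by
    have : toEnv (eE - eF) ∈ T := key Complex.I_ne_zero (Algebra.subset_adjoin (by simp))
    rw [toEnv_sub] at this
    simpa using T.sub_mem hE this
  refine eq_top_of_toEnv_mem T fun Y => ?_
  rw [sl2_eq Y, toEnv_add, toEnv_add, toEnv_smul, toEnv_smul, toEnv_smul]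
  exact T.add_mem (T.add_mem (T.smul_mem hH _) (T.smul_mem hE _)) (T.smul_mem hF _)

end ClassicalRow

end

section

attribute [local instance 100] LieRing.ofAssociativeRing

open Matrix

/-! ### The enveloping algebra of the motion group as a specialization -/

section MotionRow

theorem so2_eq (k : so2) : k = k.1.1 1 0 • iθk := by
  have h := congrFun₂ k.2
  have h0 := h 0 0
  have h1 := h 1 0
  have h2 := sl2_apply_one_one k.1
  simp only [transpose_apply, Matrix.neg_apply] at h0 h1
  have h0' : k.1.1 0 0 = 0 := by linarith
  apply Subtype.ext
  apply Subtype.ext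
  show k.1.1 = k.1.1 1 0 • (eF.1 - eE.1)
  ext i j
  fin_cases i <;> fin_cases j <;> simp [eF, eE, h0', h1, h2]

theorem modK_add (Y Z : sl2) : modK (Y + Z) = modK Y + modK Z := rfl

theorem modK_smul (r : ℝ) (Y : sl2) : modK (r • Y) = r • modK Y := rfl

theorem modK_surjective : Function.Surjective modK := Submodule.mkQ_surjective _

theorem modK_eF : modK eF = modK eE :=
  (Submodule.Quotient.eq so2.toLieSubmodule.toSubmodule).mpr iθk.2

theorem modK_eq (Y : sl2) : modK Y = Y.1 0 0 • modK eH + (Y.1 0 1 + Y.1 1 0) • modK eE := by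
  conv_lhs => rw [sl2_eq Y]
  rw [modK_add, modK_add, modK_smul, modK_smul, modK_smul, modK_eF, add_assoc, add_smul]

theorem adModK_modK (k : so2) (Y : sl2) : adModK k (modK Y) = modK ⁅k.1, Y⁆ := rfl

/-- The linear map on `𝔤/𝔨` with prescribed values at the classes of `H` and `E`. -/
theorem exists_linearMap_gModK {D : Type*} [AddCommGroup D] [Module ℝ D] (h e : D) :
    ∃ P : gModK →ₗ[ℝ] D, ∀ Y : sl2, P (modK Y) = Y.1 0 0 • h + (Y.1 0 1 + Y.1 1 0) • e := by
  let f : sl2 →ₗ[ℝ] D :=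
    { toFun := fun Y => Y.1 0 0 • h + (Y.1 0 1 + Y.1 1 0) • e
      map_add' := fun Y Z => by
        show (Y.1 0 0 + Z.1 0 0) • h + (Y.1 0 1 + Z.1 0 1 + (Y.1 1 0 + Z.1 1 0)) • e = _
        module
      map_smul' := fun r Y => by
        show (r * Y.1 0 0) • h + (r * Y.1 0 1 + r * Y.1 1 0) • e = r • (_ + _)
        module }
  refine ⟨Submodule.liftQ so2.toLieSubmodule.toSubmodule f fun k hk => ?_, fun Y => rfl⟩
  have h1 := so2_eq ⟨k, hk⟩
  have h2 : k = k.1 1 0 • iθk.1 := congrArg Subtype.val h1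
  rw [LinearMap.mem_ker, h2, map_smul]
  show k.1 1 0 • ((eF.1 - eE.1) 0 0 • h + ((eF.1 - eE.1) 0 1 + (eF.1 - eE.1) 1 0) • e) = 0
  simp [eF, eE]

theorem g0_eq (u : g0) : u = g0p u.left + g0k u.right := by
  obtain ⟨v, k⟩ := u
  simp [g0p, g0k]

theorem lie_g0p (v w : gModK) : ⁅g0p v, g0p w⁆ = 0 := by
  simp [g0p, gModK_lie]

theorem lie_g0k_g0p (k : so2) (v : gModK) : ⁅g0k k, g0p v⁆ = g0p (adModK k v) := by
  simp [g0p, g0k]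

theorem g0p_smul (r : ℝ) (v : gModK) : g0p (r • v) = r • g0p v := map_smul _ _ _

theorem g0p_add (v w : gModK) : g0p (v + w) = g0p v + g0p w :=
  map_add (LieAlgebra.SemiDirectSum.inl adModK) _ _

/-- The bracket of `F - E` with `H` is `2E + 2F`, and `F` is congruent to `E` modulo `𝔨`; hence the
factor `4`. -/
theorem adModK_eH : adModK iθk (modK eH) = (4 : ℝ) • modK eE := by
  rw [adModK_modK, modK_eq]
  have : ⁅iθk.1, eH⁆.1 = (eF.1 - eE.1) * eH.1 - eH.1 * (eF.1 - eE.1) := rfl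
  rw [this]
  simp [eH, eE, eF, Matrix.mul_apply, Fin.sum_univ_two]
  norm_num

theorem adModK_eE : adModK iθk (modK eE) = (-1 : ℝ) • modK eH := by
  rw [adModK_modK, modK_eq]
  have : ⁅iθk.1, eE⁆.1 = (eF.1 - eE.1) * eE.1 - eE.1 * (eF.1 - eE.1) := rfl
  rw [this]
  simp [eH, eE, eF, Matrix.mul_apply, Fin.sum_univ_two]

theorem toEnv_zero : toEnv (0 : g0) = 0 := by
  rw [toEnv, map_zero, TensorProduct.tmul_zero]

theorem star_half_smul_toEnv (Y : g0) :
    star ((1 / 2 : ℂ) • toEnv Y) = -((1 / 2 : ℂ) • toEnv Y) := by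
  rw [star_smul, star_toEnv, smul_neg]
  congr 2
  simp

theorem star_I_smul_toEnv (Y : g0) : star (Complex.I • toEnv Y) = Complex.I • toEnv Y := by
  rw [star_smul, star_toEnv, smul_neg, ← neg_smul]
  congr 1
  simp

theorem star_neg_I_smul_toEnv (Y : g0) : star (-Complex.I • toEnv Y) = -Complex.I • toEnv Y := by
  rw [neg_smul, star_neg, star_I_smul_toEnv]

theorem specRelAt_of_motion {D : Type*} [Ring D] [Algebra ℂ D] {h e k : D}
    (h1 : k * h - h * k = (4 : ℂ) • e) (h2 : k * e - e * k = (-1 : ℂ) • h) (h3 : h * e = e * h) :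
    SpecRelAt 1 0 one_pos ((1 / 2 : ℂ) • h) (-((1 / 2 : ℂ) • h)) (Complex.I • e)
      (-Complex.I • k) := by
  have hI := Complex.I_mul_I
  rw [specRelAt_one_iff, Complex.ofReal_zero]
  simp only [smul_mul_assoc, mul_smul_comm, smul_smul, smul_sub, mul_sub, sub_mul, mul_neg,
    neg_mul, hI, zero_smul, sub_zero]
  refine ⟨?_, trivial, ?_, ?_⟩
  · linear_combination (norm := module) (1 / 2 * Complex.I) • h3
  · linear_combination (norm := module) (1 / 2 * Complex.I) • h1
  · linear_combination (norm := module) -h2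

theorem specRelAt_g0 : SpecRelAt 1 0 one_pos ((1 / 2 : ℂ) • toEnv (g0p (modK eH)))
    (star ((1 / 2 : ℂ) • toEnv (g0p (modK eH)))) (Complex.I • toEnv (g0p (modK eE)))
    (-Complex.I • toEnv (g0k iθk)) := by
  rw [star_half_smul_toEnv]
  apply specRelAt_of_motion
  · rw [← toEnv_lie, lie_g0k_g0p, adModK_eH, g0p_smul, toEnv_smul]
    norm_num
  · rw [← toEnv_lie, lie_g0k_g0p, adModK_eE, g0p_smul, toEnv_smul]
    norm_num
  · rw [← sub_eq_zero, ← toEnv_lie, lie_g0p, toEnv_zero]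

/-- The left-hand side is the image of a bracket in `𝔤₀` of elements with coordinates `(a, b, c)`
and `(a', b', c')` on the classes of `H`, `E` and on `iθ`; only `𝔨` acting on `𝔤/𝔨` contributes. The
identity expresses compatibility with commutators. -/
theorem motion_bracket {D : Type*} [Ring D] [Algebra ℝ D] {H e k : D}
    (h1 : k * H - H * k = (4 : ℝ) • e) (h2 : k * e - e * k = (-1 : ℝ) • H)
    (h3 : H * e - e * H = 0) (a b a' b' c c' : ℝ) :
    c • ((4 * a') • e - b' • H) - c' • ((4 * a) • e - b • H)
      = (a • H + b • e + c • k) * (a' • H + b' • e + c' • k)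
        - (a' • H + b' • e + c' • k) * (a • H + b • e + c • k) := by
  simp only [add_mul, mul_add, smul_mul_assoc, mul_smul_comm, smul_smul]
  linear_combination (norm := module) -(a * b' - b * a') • h3 - (c * a' - c' * a) • h1
      - (c * b' - c' * b) • h2

theorem g0k_smul (r : ℝ) (k : so2) : g0k (r • k) = r • g0k k :=
  map_smul (LieAlgebra.SemiDirectSum.inr adModK) _ _

theorem exists_eq_g0p_add_g0k (u : g0) :
    ∃ (Y : sl2) (c : ℝ), u = g0p (modK Y) + c • g0k iθk := by
  obtain ⟨Y, hY⟩ := modK_surjective u.left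
  exact ⟨Y, u.right.1.1 1 0, by rw [hY, ← g0k_smul, ← so2_eq, ← g0_eq]⟩

theorem lie_g0_eq (v w : gModK) (c c' : ℝ) :
    ⁅g0p v + c • g0k iθk, g0p w + c' • g0k iθk⁆
      = c • g0p (adModK iθk w) - c' • g0p (adModK iθk v) := by
  rw [add_lie, lie_add, lie_add, lie_g0p, smul_lie, smul_lie, lie_smul, lie_smul, lie_g0k_g0p,
    lie_self, ← lie_skew (g0p v), lie_g0k_g0p]
  module

/-- The linear map on `𝔤₀` with prescribed values at a basis. -/
theorem exists_linearMap_g0 {D : Type*} [AddCommGroup D] [Module ℝ D] (h e k : D) :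
    ∃ f : g0 →ₗ[ℝ] D, f (g0k iθk) = k ∧
      ∀ Y : sl2, f (g0p (modK Y)) = Y.1 0 0 • h + (Y.1 0 1 + Y.1 1 0) • e := by
  obtain ⟨P, hP⟩ := exists_linearMap_gModK h e
  refine ⟨{ toFun := fun u => P u.left + u.right.1.1 1 0 • k
            map_add' := fun u v => ?_
            map_smul' := fun r u => ?_ }, ?_, fun Y => ?_⟩
  · show P (u.left + v.left) + (u.right.1.1 1 0 + v.right.1.1 1 0) • k = _
    rw [map_add]
    module
  · show P (r • u.left) + (r * u.right.1.1 1 0) • k = r • (_ + _)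
    rw [map_smul]
    module
  · show P 0 + (eF.1 - eE.1) 1 0 • k = k
    simp [eE, eF]
  · show P (modK Y) + (0 : ℝ) • k = _
    rw [hP, zero_smul, add_zero]

theorem exists_algHom_g0 {D : Type*} [Ring D] [Algebra ℂ D] {x y z θ : D}
    (h : SpecRelAt 1 0 one_pos x y z θ) : ∃ g : CEnv g0 →ₐ[ℂ] D,
      g ((1 / 2 : ℂ) • toEnv (g0p (modK eH))) = x ∧
      g (star ((1 / 2 : ℂ) • toEnv (g0p (modK eH)))) = y ∧
      g (Complex.I • toEnv (g0p (modK eE))) = z ∧ g (-Complex.I • toEnv (g0k iθk)) = θ := by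
  have hI := Complex.I_mul_I
  rw [specRelAt_one_iff, Complex.ofReal_zero, zero_smul, zero_smul, sub_zero] at h
  obtain ⟨h1, rfl, h2, h3⟩ := h
  obtain ⟨H, rfl⟩ : ∃ H, x = (1 / 2 : ℂ) • H :=
    ⟨(2 : ℂ) • x, by rw [smul_smul]; norm_num⟩
  obtain ⟨e, rfl⟩ : ∃ e, z = Complex.I • e :=
    ⟨Complex.I⁻¹ • z, by rw [smul_inv_smul₀ Complex.I_ne_zero]⟩
  obtain ⟨k, rfl⟩ : ∃ k, θ = -Complex.I • k :=
    ⟨Complex.I • θ, by rw [smul_smul, neg_mul, hI, neg_neg, one_smul]⟩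
  simp only [smul_mul_assoc, mul_smul_comm, smul_smul, smul_sub, mul_sub, sub_mul, mul_neg,
    neg_mul, hI] at h1 h2 h3
  have hc : (1 / 2 * Complex.I : ℂ) ≠ 0 := by simp
  have k1 : H * e - e * H = 0 := by
    apply smul_right_injective D hc
    linear_combination (norm := module) h1
  have k2 : k * H - H * k = (4 : ℝ) • e := by
    rw [← Complex.coe_smul]
    apply smul_right_injective D hc
    push_cast
    linear_combination (norm := module) h2
  have k3 : k * e - e * k = (-1 : ℝ) • H := by
    rw [← Complex.coe_smul]
    push_cast
    linear_combination (norm := module) -h3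
  obtain ⟨f, hk, hf⟩ := exists_linearMap_g0 H e k
  have hH : f (g0p (modK eH)) = H := (hf _).trans (by simp [eH])
  have hE : f (g0p (modK eE)) = e := (hf _).trans (by simp [eE])
  have had : ∀ Y : sl2, f (g0p (adModK iθk (modK Y)))
      = (4 * Y.1 0 0) • e - (Y.1 0 1 + Y.1 1 0) • H := fun Y => by
    have h1 : f (g0p (adModK iθk (modK Y))) = Y.1 0 0 • f (g0p (adModK iθk (modK eH)))
        + (Y.1 0 1 + Y.1 1 0) • f (g0p (adModK iθk (modK eE))) := by
      conv_lhs => rw [modK_eq Y]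
      rw [map_add, map_smul, map_smul, g0p_add, g0p_smul, g0p_smul, map_add, map_smul, map_smul]
    rw [h1, adModK_eH, adModK_eE, g0p_smul, g0p_smul, map_smul, map_smul, hH, hE]
    module
  obtain ⟨g, hg⟩ := exists_algHom_CEnv f (fun u v => by
    obtain ⟨Y₁, c₁, rfl⟩ := exists_eq_g0p_add_g0k u
    obtain ⟨Y₂, c₂, rfl⟩ := exists_eq_g0p_add_g0k v
    rw [lie_g0_eq, map_sub, map_smul, map_smul, had, had, map_add, map_add, map_smul, map_smul,
      hk, hf, hf]
    exact motion_bracket k2 k3 k1 _ _ _ _ _ _)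
  have gH := (hg _).trans hH
  have gE := (hg _).trans hE
  have gk := (hg _).trans hk
  refine ⟨g, ?_, ?_, ?_, ?_⟩
  · rw [map_smul, gH]
  · rw [star_half_smul_toEnv, map_neg, map_smul, gH]
  · rw [map_smul, gE]
  · rw [map_smul, gk]

theorem adjoin_g0_eq_top : Algebra.adjoin ℂ {(1 / 2 : ℂ) • toEnv (g0p (modK eH)),
    star ((1 / 2 : ℂ) • toEnv (g0p (modK eH))), Complex.I • toEnv (g0p (modK eE)),
    -Complex.I • toEnv (g0k iθk)} = ⊤ := by
  set T := Algebra.adjoin ℂ {(1 / 2 : ℂ) • toEnv (g0p (modK eH)),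
    star ((1 / 2 : ℂ) • toEnv (g0p (modK eH))), Complex.I • toEnv (g0p (modK eE)),
    -Complex.I • toEnv (g0k iθk)}
  have key : ∀ {c : ℂ} (_ : c ≠ 0) {Y : CEnv g0}, c • Y ∈ T → Y ∈ T := fun {c} hc {Y} hY => by
    rw [← inv_smul_smul₀ hc Y]
    exact T.smul_mem hY _
  have hH : toEnv (g0p (modK eH)) ∈ T :=
    key (one_div_ne_zero two_ne_zero) (Algebra.subset_adjoin (by simp))
  have hE : toEnv (g0p (modK eE)) ∈ T :=
    key Complex.I_ne_zero (Algebra.subset_adjoin (by simp))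
  have hk : toEnv (g0k iθk) ∈ T :=
    key (neg_ne_zero.mpr Complex.I_ne_zero) (Algebra.subset_adjoin (by simp))
  refine eq_top_of_toEnv_mem T fun u => ?_
  obtain ⟨Y, c, rfl⟩ := exists_eq_g0p_add_g0k u
  rw [modK_eq, g0p_add, g0p_smul, g0p_smul, toEnv_add, toEnv_add, toEnv_smul, toEnv_smul,
    toEnv_smul]
  exact T.add_mem (T.add_mem (T.smul_mem hH _) (T.smul_mem hE _)) (T.smul_mem hk _)

end MotionRow

end

/-! ### The integral form of the induced modules -/

section IntegralInd

/-- The element `κ^(nτ)`. -/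
abbrev powZ (n : ℤ) : AA := powA n

theorem powA_add (c d : ℝ) : powA (c + d) = powA c * powA d := AA_ext fun q t hq => by
  rw [map_mul, evalAt_powA, evalAt_powA, evalAt_powA, ← Complex.ofReal_mul, ← Real.rpow_add hq,
    add_mul]

theorem powA_zero : powA 0 = 1 := AA_ext fun q t hq => by
  rw [map_one, evalAt_powA, zero_mul, Real.rpow_zero, Complex.ofReal_one]

theorem powZ_add (m n : ℤ) : powZ (m + n) = powZ m * powZ n := by
  rw [powZ, Int.cast_add, powA_add]

theorem powZ_one : powZ 1 = powA 1 := by rw [powZ, Int.cast_one]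

theorem powZ_zero : powZ 0 = 1 := by rw [powZ, Int.cast_zero, powA_zero]

theorem powZ_mul_powZ_neg (n : ℤ) : powZ n * powZ (-n) = 1 := by
  rw [← powZ_add, add_neg_cancel, powZ_zero]

/-- The element `{n} = κ^(nτ) + κ^(-nτ)`. -/
def brA (n : ℤ) : AA := powZ n + powZ (-n)

theorem evalAt_brA_ne_zero (q t : ℝ) (hq : 0 < q) (n : ℤ) : evalAt q t hq (brA n) ≠ 0 := by
  rw [brA, map_add, evalAt_powA, evalAt_powA, ← Complex.ofReal_add]
  exact Complex.ofReal_ne_zero.mpr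
    (add_pos (Real.rpow_pos_of_pos hq _) (Real.rpow_pos_of_pos hq _)).ne'

/-- The inverse of `{n}`. -/
def invBr (n : ℤ) : AA := ⟨fun p => ((brA n).1 p)⁻¹,
  isAnalytic_of_eqOn (g := fun p => (extend (brA n).1 p)⁻¹)
    (fun p hp => ((brA n).2 p hp).inv (by
      rw [extend_of_pos _ hp]
      exact evalAt_brA_ne_zero p.1 p.2 hp n))
    fun p => by rw [extend_val]⟩

theorem evalAt_invBr (q t : ℝ) (hq : 0 < q) (n : ℤ) :
    evalAt q t hq (invBr n) = (evalAt q t hq (brA n))⁻¹ := rfl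

theorem brA_mul_invBr (n : ℤ) : brA n * invBr n = 1 := AA_ext fun q t hq => by
  rw [map_mul, evalAt_invBr, mul_inv_cancel₀ (evalAt_brA_ne_zero q t hq n), map_one]

open Classical in
/-- The quotient of `f` by `η`, if there is one. -/
def divEta (f : AA) : AA := if h : ∃ g, f = etaA * g then h.choose else 0

theorem etaA_mul_divEta {f : AA} (hf : ∀ t, evalAt 1 t one_pos f = 0) : etaA * divEta f = f := by
  obtain ⟨g, hg, -⟩ := exists_eq_etaA_mul f hf
  have h : ∃ g, f = etaA * g := ⟨g, hg⟩
  rw [divEta, dif_pos h]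
  exact h.choose_spec.symm

theorem evalAt_divEta_one {f : AA} (hf : ∀ t, evalAt 1 t one_pos f = 0) (t : ℝ) :
    evalAt 1 t one_pos (divEta f) = partialQ f 1 t / 2 := by
  obtain ⟨g, hg, hg'⟩ := exists_eq_etaA_mul f hf
  have : divEta f = g := mul_left_cancel₀ etaA_ne_zero ((etaA_mul_divEta hf).trans hg)
  rw [this, hg']

/-- The integral version of `IndQ.kapP`. -/
def kapPA (l : AAˣ) (n : ℤ) : AA :=
  (l : AA) * powZ (1 + n) - ((l⁻¹ : AAˣ) : AA) * powZ (-1 - n)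

/-- The integral version of `IndQ.kap`. -/
def kapA (l : AAˣ) : AA := (l : AA) + ((l⁻¹ : AAˣ) : AA)

/-- The recursions `[n+1] = q⁻¹ [n] + qⁿ` and `[n-1] = q [n] - qⁿ` show that `q`-integers are
Laurent polynomials in `q`. They therefore make sense where `q^t = 1`, and there the same recursions
give the value `n`. -/
theorem exists_qInt_eq (n : ℤ) : ∃ s : AA, (powZ 1 - powZ (-1)) * s = powZ n - powZ (-n) ∧
    ∀ (q t : ℝ) (hq : 0 < q), evalAt q t hq (powA 1) = 1 → evalAt q t hq s = n := by
  have hm : ∀ m : ℤ, ∀ (q t : ℝ) (hq : 0 < q), evalAt q t hq (powA 1) = 1 →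
      evalAt q t hq (powZ m) = 1 := fun m q t hq h => by
    rw [evalAt_powA, one_mul] at h
    rw [evalAt_powA, mul_comm, Real.rpow_mul hq.le, Complex.ofReal_eq_one.mp h, Real.one_rpow,
      Complex.ofReal_one]
  have h0 := powZ_mul_powZ_neg 1
  induction n using Int.induction_on with
  | zero => exact ⟨0, by simp, fun q t hq h => by simp⟩
  | succ n ih =>
    obtain ⟨s, h1, h2⟩ := ih
    refine ⟨powZ (-1) * s + powZ n, ?_, fun q t hq h => ?_⟩
    · rw [neg_add, powZ_add, powZ_add]
      linear_combination powZ (-1) * h1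
    · rw [map_add, map_mul, h2 q t hq h, hm _ q t hq h, hm _ q t hq h]
      push_cast
      ring
  | pred n ih =>
    obtain ⟨s, h1, h2⟩ := ih
    refine ⟨powZ 1 * s - powZ (-n), ?_, fun q t hq h => ?_⟩
    · rw [neg_sub, sub_eq_add_neg (-(n : ℤ)), sub_eq_add_neg (1 : ℤ), powZ_add, powZ_add]
      linear_combination powZ 1 * h1
    · rw [map_sub, map_mul, h2 q t hq h, hm _ q t hq h, hm _ q t hq h]
      push_cast
      ring

/-- The `q`-integer `[n]_q` for `q = κ^τ`. -/
def qIntA (n : ℤ) : AA := (exists_qInt_eq n).choose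

theorem sub_mul_qIntA (n : ℤ) : (powZ 1 - powZ (-1)) * qIntA n = powZ n - powZ (-n) :=
  (exists_qInt_eq n).choose_spec.1

theorem evalAt_qIntA (q t : ℝ) (hq : 0 < q) (h : evalAt q t hq (powA 1) = 1) (n : ℤ) :
    evalAt q t hq (qIntA n) = n :=
  (exists_qInt_eq n).choose_spec.2 q t hq h

/-- The operator on `_𝔸𝒪^ε(K)` mapping `ζ_n` to `a n ζ_{n+2} + b n ζ_n + c n ζ_{n-2}`. -/
def triA (ε : ℤˣ) (a b c : ℤ → AA) : Module.End AA (AO ε) :=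
  Finsupp.linearCombination AA fun n : ZPar ε =>
    Finsupp.single (n.shift 1) (a n.1) + Finsupp.single n (b n.1)
      + Finsupp.single (n.shift (-1)) (c n.1)

theorem triA_single (ε : ℤˣ) (a b c : ℤ → AA) (n : ZPar ε) :
    triA ε a b c (Finsupp.single n 1) = Finsupp.single (n.shift 1) (a n.1)
      + Finsupp.single n (b n.1) + Finsupp.single (n.shift (-1)) (c n.1) := by
  rw [triA, Finsupp.linearCombination_single, one_smul]

theorem evModule_triA_single {V : Type} [AddCommGroup V] [Module ℂ V] (φ : AA →+* ℂ) {ε : ℤˣ}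
    (ζ : ZPar ε → V) (a b c : ℤ → AA) (n : ZPar ε) :
    evModule φ ζ (triA ε a b c (Finsupp.single n 1))
      = φ (a n.1) • ζ (n.shift 1) + φ (b n.1) • ζ n + φ (c n.1) • ζ (n.shift (-1)) := by
  rw [triA_single, map_add, map_add, evModule_single, evModule_single, evModule_single]

theorem incl_single {ε : ℤˣ} (n : ZPar ε) (a : AA) :
    AO.incl ε (Finsupp.single n a) = algebraMap AA FF a • zetaq FF n := by
  rw [AO.incl, Finsupp.mapRange.linearMap_apply, Finsupp.mapRange_single, Finsupp.smul_single,
    smul_eq_mul, mul_one]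
  rfl

theorem incl_injective (ε : ℤˣ) : Function.Injective (AO.incl ε) :=
  Finsupp.mapRange_injective _ (map_zero _) (IsFractionRing.injective AA FF)

theorem incl_triA {ε : ℤˣ} {a b c : ℤ → AA} {a' b' c' : ℤ → FF}
    (ha : ∀ n, algebraMap AA FF (a n) = a' n) (hb : ∀ n, algebraMap AA FF (b n) = b' n)
    (hc : ∀ n, algebraMap AA FF (c n) = c' n) (m : AO ε) :
    AO.incl ε (triA ε a b c m) = IndQ.tri ε a' b' c' (AO.incl ε m) := by
  induction m using Finsupp.induction_linear with
  | zero => rw [map_zero, map_zero, map_zero]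
  | add m n hm hn =>
    rw [map_add (triA ε a b c), map_add (AO.incl ε), hm, hn, map_add (AO.incl ε), map_add]
  | single n r =>
    have h1 : (Finsupp.single n r : AO ε) = r • Finsupp.single n 1 := by
      rw [Finsupp.smul_single, smul_eq_mul, mul_one]
    have h2 : AO.incl ε (triA ε a b c (Finsupp.single n 1)) = IndQ.tri ε a' b' c' (zetaq FF n) := by
      rw [triA_single, map_add, map_add, incl_single, incl_single, incl_single, ha, hb, hc,
        IndQ.tri_zetaq]
    rw [h1, map_smul (triA ε a b c), map_smul (AO.incl ε), h2, ← h1, incl_single,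
      map_smul (IndQ.tri ε a' b' c'), algebraMap_smul]

theorem smul_tri {F : Type} [Field F] [CharZero F] [StarRing F] (ε : ℤˣ) (r : F) (a b c : ℤ → F) :
    r • IndQ.tri ε a b c
      = IndQ.tri ε (fun n => r * a n) (fun n => r * b n) (fun n => r * c n) :=
  IndQ.end_ext fun n => by
    rw [LinearMap.smul_apply, IndQ.tri_zetaq, IndQ.tri_zetaq, smul_add, smul_add, smul_smul,
      smul_smul, smul_smul]

theorem tri_sub_one {F : Type} [Field F] [CharZero F] [StarRing F] (ε : ℤˣ) (a b c : ℤ → F) :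
    IndQ.tri ε a b c - 1 = IndQ.tri ε a (fun n => b n - 1) c :=
  IndQ.end_ext fun n => by
    rw [LinearMap.sub_apply, Module.End.one_apply, IndQ.tri_zetaq, IndQ.tri_zetaq, sub_smul,
      one_smul]
    abel

variable (ε : ℤˣ) (l : AAˣ)

/-- The coefficients of the action of `x_𝔸`. -/
def xUp (n : ℤ) : AA := powZ (n + 1) * divEta (kapPA l n) * (invBr n * invBr (n + 1))
/-- The coefficients of the action of `x_𝔸`. -/
def xMid (n : ℤ) : AA :=
  divEta (brA 1 * kapA l - brA (n + 1) * brA (n - 1)) * (invBr (n + 1) * invBr (n - 1))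
/-- The coefficients of the action of `x_𝔸`. -/
def xDown (n : ℤ) : AA := powZ (1 - n) * divEta (kapPA l (-n)) * (invBr n * invBr (n - 1))
/-- The coefficients of the action of the adjoint of `x_𝔸`. -/
def yUp (n : ℤ) : AA := -(powZ (-n - 1) * divEta (kapPA l n)) * (invBr n * invBr (n + 1))
/-- The coefficients of the action of the adjoint of `x_𝔸`. -/
def yDown (n : ℤ) : AA := -(powZ (n - 1) * divEta (kapPA l (-n))) * (invBr n * invBr (n - 1))
/-- The coefficients of the action of `z_𝔸`. -/
def zUp (n : ℤ) : AA := -divEta (kapPA l n) * (invBr n * invBr (n + 1))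
/-- The coefficients of the action of `z_𝔸`. -/
def zMid (n : ℤ) : AA :=
  divEta (powZ n - powZ (-n)) * kapA l * (invBr (n + 1) * invBr (n - 1))
/-- The coefficients of the action of `z_𝔸`. -/
def zDown (n : ℤ) : AA := divEta (kapPA l (-n)) * (invBr n * invBr (n - 1))

variable {l} (hl : ∀ t : ℝ, evalAt 1 t one_pos (l : AA) = 1)

theorem evalAt_powZ_sub_one (n : ℤ) (t : ℝ) : evalAt 1 t one_pos (powZ n - powZ (-n)) = 0 := by
  rw [map_sub, evalAt_powA_one, evalAt_powA_one, sub_self]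

include hl

theorem evalAt_inv_one (t : ℝ) : evalAt 1 t one_pos ((l⁻¹ : AAˣ) : AA) = 1 := by
  have := congrArg (evalAt 1 t one_pos) (Units.mul_inv l)
  rwa [map_mul, hl, one_mul, map_one] at this

/-- Together with `evalAt_mid_one`, this is how `λ(1, t) = 1` yields stability of the `𝔸`-span: the
numerators of the coefficients of `x` and `z` vanish on `q = 1` and are thus divisible by `η`. -/
theorem evalAt_kapPA_one (n : ℤ) (t : ℝ) : evalAt 1 t one_pos (kapPA l n) = 0 := by
  rw [kapPA, map_sub, map_mul, map_mul, hl, evalAt_inv_one hl, evalAt_powA_one, evalAt_powA_one,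
    sub_self]

/-- This is the numerator of the diagonal coefficient of `X - 1`; at `q = 1` each of the four
factors equals `2`. -/
theorem evalAt_mid_one (n : ℤ) (t : ℝ) :
    evalAt 1 t one_pos (brA 1 * kapA l - brA (n + 1) * brA (n - 1)) = 0 := by
  simp only [brA, kapA, map_sub, map_mul, map_add, hl, evalAt_inv_one hl, evalAt_powA_one]
  ring

omit hl

/-! ### The coefficients under morphisms from `𝔸` to a field in which the image of `η` is non-zero.
-/

section Hom

variable {F : Type} [Field F] [CharZero F] [StarRing F] {φ : AA →+* F} {q : QParam F}
  (hq : φ (powA 1) = q.val) (hη : φ etaA ≠ 0)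
include hq

theorem map_powZ (n : ℤ) : φ (powZ n) = q.val ^ n := by
  have hq0 := q.ne_zero
  have h1 : φ (powZ (-1)) = q.val⁻¹ := by
    refine (inv_eq_of_mul_eq_one_right ?_).symm
    rw [← hq, ← powZ_one, ← map_mul, powZ_mul_powZ_neg, map_one]
  induction n using Int.induction_on with
  | zero => rw [powZ_zero, map_one, zpow_zero]
  | succ n ih => rw [powZ_add, map_mul, ih, zpow_add₀ hq0, powZ_one, hq, zpow_one]
  | pred n ih =>
    rw [sub_eq_add_neg, powZ_add, map_mul, ih, zpow_add₀ hq0, h1, zpow_neg_one]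

theorem map_brA (n : ℤ) : φ (brA n) = IndQ.br q.val n := by
  rw [brA, map_add, map_powZ hq, map_powZ hq, IndQ.br]

theorem map_invBr (n : ℤ) : φ (invBr n) = (IndQ.br q.val n)⁻¹ := by
  rw [← map_brA hq]
  exact (inv_eq_of_mul_eq_one_right (by rw [← map_mul, brA_mul_invBr, map_one])).symm

theorem map_qIntA (n : ℤ) : φ (qIntA n) = qInt q.val n := by
  have h := congrArg φ (sub_mul_qIntA n)
  rw [map_mul, map_sub, map_sub, map_powZ hq, map_powZ hq, map_powZ hq, map_powZ hq, zpow_one,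
    zpow_neg_one] at h
  rw [qInt, ← h, inv_mul_cancel_left₀ (IndQ.sub_inv_ne_zero q)]

omit hq in
theorem map_units_inv : ((Units.map (φ : AA →* F) l : Fˣ) : F)⁻¹ = φ (l⁻¹ : AAˣ) :=
  inv_eq_of_mul_eq_one_right (by
    rw [Units.coe_map]
    show φ l * φ _ = 1
    rw [← map_mul, Units.mul_inv, map_one])

theorem map_kapPA (n : ℤ) :
    φ (kapPA l n) = IndQ.kapP q.val (Units.map (φ : AA →* F) l : F) n := by
  rw [kapPA, map_sub, map_mul, map_mul, map_powZ hq, map_powZ hq, ← map_units_inv]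
  rfl

theorem map_kapPA_neg (n : ℤ) :
    φ (kapPA l (-n)) = IndQ.kapM q.val (Units.map (φ : AA →* F) l : F) n := by
  rw [map_kapPA hq, IndQ.kapP, IndQ.kapM, ← sub_eq_add_neg, sub_neg_eq_add]

omit hq in
theorem map_kapA : φ (kapA l) = IndQ.kap (Units.map (φ : AA →* F) l : F) := by
  rw [kapA, map_add, ← map_units_inv]
  rfl

include hη

omit hq in
theorem map_divEta {f : AA} (hf : ∀ t, evalAt 1 t one_pos f = 0) :
    φ (divEta f) = (φ etaA)⁻¹ * φ f := by
  have h := congrArg φ (etaA_mul_divEta hf)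
  rw [map_mul] at h
  rw [← h, inv_mul_cancel_left₀ hη]

include hl

/-- Stated for a general `φ` so as to serve twice: with the inclusion into `𝔽` it proves stability
of the `𝔸`-span, and with evaluation at a point with `q ≠ 1`, `t ≠ 0` it identifies the specialized
module. -/
theorem smul_opX_sub_one :
    (φ etaA)⁻¹ • (IndQ.opX q.val ε (Units.map (φ : AA →* F) l : F) - 1)
      = IndQ.tri ε (fun n => φ (xUp l n)) (fun n => φ (xMid l n)) (fun n => φ (xDown l n)) := by
  rw [IndQ.opX, tri_sub_one, smul_tri]
  congr 1 <;> funext n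
  · rw [xUp, map_mul, map_mul, map_mul, map_powZ hq, map_divEta hη (evalAt_kapPA_one hl n),
      map_kapPA hq, map_invBr hq, map_invBr hq, div_eq_mul_inv, mul_inv]
    ring
  · rw [xMid, map_mul, map_mul, map_divEta hη (evalAt_mid_one hl n), map_sub, map_mul, map_mul,
      map_brA hq, map_brA hq, map_brA hq, map_kapA, map_invBr hq, map_invBr hq]
    have h1 := IndQ.br_ne_zero q (n + 1)
    have h2 := IndQ.br_ne_zero q (n - 1)
    field_simp
  · rw [xDown, map_mul, map_mul, map_mul, map_powZ hq, map_divEta hη (evalAt_kapPA_one hl _),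
      map_kapPA_neg hq, map_invBr hq, map_invBr hq, div_eq_mul_inv, mul_inv]
    ring

theorem smul_opXs_sub_one :
    (φ etaA)⁻¹ • (IndQ.opXs q.val ε (Units.map (φ : AA →* F) l : F) - 1)
      = IndQ.tri ε (fun n => φ (yUp l n)) (fun n => φ (xMid l n)) (fun n => φ (yDown l n)) := by
  rw [IndQ.opXs, tri_sub_one, smul_tri]
  congr 1 <;> funext n
  · rw [yUp, map_mul, map_neg, map_mul, map_mul, map_powZ hq,
      map_divEta hη (evalAt_kapPA_one hl n), map_kapPA hq, map_invBr hq, map_invBr hq,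
      div_eq_mul_inv, mul_inv]
    ring
  · rw [xMid, map_mul, map_mul, map_divEta hη (evalAt_mid_one hl n), map_sub, map_mul, map_mul,
      map_brA hq, map_brA hq, map_brA hq, map_kapA, map_invBr hq, map_invBr hq]
    have h1 := IndQ.br_ne_zero q (n + 1)
    have h2 := IndQ.br_ne_zero q (n - 1)
    field_simp
  · rw [yDown, map_mul, map_neg, map_mul, map_mul, map_powZ hq,
      map_divEta hη (evalAt_kapPA_one hl _), map_kapPA_neg hq, map_invBr hq, map_invBr hq,
      div_eq_mul_inv, mul_inv]
    ring

theorem smul_opZ :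
    (φ etaA)⁻¹ • IndQ.opZ q.val ε (Units.map (φ : AA →* F) l : F)
      = IndQ.tri ε (fun n => φ (zUp l n)) (fun n => φ (zMid l n)) (fun n => φ (zDown l n)) := by
  rw [IndQ.opZ, smul_tri]
  congr 1 <;> funext n
  · rw [zUp, map_mul, map_neg, map_mul, map_divEta hη (evalAt_kapPA_one hl n),
      map_kapPA hq, map_invBr hq, map_invBr hq, div_eq_mul_inv, mul_inv]
    ring
  · rw [zMid, map_mul, map_mul, map_mul, map_divEta hη (evalAt_powZ_sub_one n), map_sub,
      map_powZ hq, map_powZ hq, map_kapA, map_invBr hq, map_invBr hq, div_eq_mul_inv, mul_inv]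
    ring
  · rw [zDown, map_mul, map_mul, map_divEta hη (evalAt_kapPA_one hl _),
      map_kapPA_neg hq, map_invBr hq, map_invBr hq, div_eq_mul_inv, mul_inv]
    ring

end Hom

/-- The action of `x_𝔸`. -/
abbrev opxA (l : AAˣ) : Module.End AA (AO ε) := triA ε (xUp l) (xMid l) (xDown l)
/-- The action of the adjoint of `x_𝔸`. -/
abbrev opyA (l : AAˣ) : Module.End AA (AO ε) := triA ε (yUp l) (xMid l) (yDown l)
/-- The action of `z_𝔸`. -/
abbrev opzA (l : AAˣ) : Module.End AA (AO ε) := triA ε (zUp l) (zMid l) (zDown l)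
/-- The action of `θ_𝔸`. -/
abbrev opθA : Module.End AA (AO ε) := triA ε 0 qIntA 0

theorem indQ_θ_eq {F : Type} [Field F] [CharZero F] [StarRing F] (q : QParam F) (u : Fˣ) :
    indQ q ε u (Uq.θ q) = IndQ.opθ q.val ε := IndQ.end_ext fun n => by
  rw [indQ_θ, IndQ.opθ, IndQ.tri_zetaq]
  show _ = (0 : F) • _ + _ + (0 : F) • _
  rw [zero_smul, zero_smul, zero_add, add_zero]

theorem incl_opθA (m : AO ε) :
    AO.incl ε (opθA ε m) = indQ qF ε (toFF l) θF (AO.incl ε m) := by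
  rw [θF, indQ_θ_eq]
  exact incl_triA (fun n => map_zero _) (map_qIntA (φ := algebraMap AA FF) (q := qF) rfl)
    (fun n => map_zero _) m

include hl

theorem incl_opxA (m : AO ε) :
    AO.incl ε (opxA ε l m) = indQ qF ε (toFF l) xF (AO.incl ε m) := by
  rw [xF, map_smul, map_sub, map_one, indQ_X]
  erw [smul_opX_sub_one ε hl (φ := algebraMap AA FF) (q := qF) rfl algebraMap_etaA_ne_zero]
  exact incl_triA (fun n => rfl) (fun n => rfl) (fun n => rfl) m

theorem incl_opyA (m : AO ε) :
    AO.incl ε (opyA ε l m) = indQ qF ε (toFF l) (star xA : AU).1 (AO.incl ε m) := by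
  rw [coe_star_xA, map_smul, map_sub, map_one, indQ_star_X]
  erw [smul_opXs_sub_one ε hl (φ := algebraMap AA FF) (q := qF) rfl algebraMap_etaA_ne_zero]
  exact incl_triA (fun n => rfl) (fun n => rfl) (fun n => rfl) m

theorem incl_opzA (m : AO ε) :
    AO.incl ε (opzA ε l m) = indQ qF ε (toFF l) zF (AO.incl ε m) := by
  rw [zF, map_smul, indQ_Z]
  erw [smul_opZ ε hl (φ := algebraMap AA FF) (q := qF) rfl algebraMap_etaA_ne_zero]
  exact incl_triA (fun n => rfl) (fun n => rfl) (fun n => rfl) m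

/-- The `𝔸`-span of the vectors `ζ_n` is stable under the integral form, which acts on it by the
given operators. -/
theorem exists_isIntegralInd : ∃ α : AU →ₐ[AA] Module.End AA (AO ε), IsIntegralInd ε l α ∧
    α xA = opxA ε l ∧ α (star xA) = opyA ε l ∧ α zA = opzA ε l ∧ α θA = opθA ε := by
  have key : ∀ b : AU, ∃ f : Module.End AA (AO ε),
      ∀ m, AO.incl ε (f m) = indQ qF ε (toFF l) b.1 (AO.incl ε m) := by
    refine AU_induction (fun a => ⟨algebraMap AA _ a, fun m => ?_⟩) ⟨_, incl_opxA ε hl⟩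
      ⟨_, incl_opyA ε hl⟩ ⟨_, incl_opzA ε hl⟩ ⟨_, incl_opθA ε⟩ ?_ ?_
    · show _ = indQ qF ε (toFF l) (algebraMap FF (Uq qF) (algebraMap AA FF a)) _
      rw [AlgHom.commutes, Module.algebraMap_end_apply, Module.algebraMap_end_apply, map_smul,
        algebraMap_smul]
    · rintro b b' ⟨f, hf⟩ ⟨f', hf'⟩
      refine ⟨f + f', fun m => ?_⟩
      show _ = indQ qF ε (toFF l) (b.1 + b'.1) _
      rw [LinearMap.add_apply, map_add, hf, hf', map_add, LinearMap.add_apply]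
    · rintro b b' ⟨f, hf⟩ ⟨f', hf'⟩
      refine ⟨f * f', fun m => ?_⟩
      show _ = indQ qF ε (toFF l) (b.1 * b'.1) _
      rw [Module.End.mul_apply, hf, hf', map_mul, Module.End.mul_apply]
  -- The operators are chosen one by one. Injectivity of the inclusion into the module over `𝔽`
  -- makes each of them unique, and therefore the choice is multiplicative and linear.
  choose α hα using key
  have hext : ∀ {b : AU} {f : Module.End AA (AO ε)},
      (∀ m, AO.incl ε (f m) = indQ qF ε (toFF l) b.1 (AO.incl ε m)) → α b = f := fun {b f} h =>
    LinearMap.ext fun m => incl_injective ε ((hα b m).trans (h m).symm)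
  refine ⟨{ toFun := α, map_one' := ?_, map_mul' := ?_, map_zero' := ?_, map_add' := ?_,
            commutes' := ?_ }, hα, hext (incl_opxA ε hl), hext (incl_opyA ε hl),
    hext (incl_opzA ε hl), hext (incl_opθA ε)⟩
  · refine hext fun m => ?_
    show _ = indQ qF ε (toFF l) 1 _
    rw [map_one]
    rfl
  · refine fun b b' => hext fun m => ?_
    show _ = indQ qF ε (toFF l) (b.1 * b'.1) _
    rw [Module.End.mul_apply, hα, hα, map_mul, Module.End.mul_apply]
  · refine hext fun m => ?_
    show _ = indQ qF ε (toFF l) 0 _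
    rw [map_zero]
    exact map_zero _
  · refine fun b b' => hext fun m => ?_
    show _ = indQ qF ε (toFF l) (b.1 + b'.1) _
    rw [LinearMap.add_apply, map_add, hα, hα, map_add, LinearMap.add_apply]
  · refine fun a => hext fun m => ?_
    show _ = indQ qF ε (toFF l) (algebraMap FF (Uq qF) (algebraMap AA FF a)) _
    rw [AlgHom.commutes, Module.algebraMap_end_apply, Module.algebraMap_end_apply, map_smul,
      algebraMap_smul]

end IntegralInd

section

open Matrix

/-! ### The module of trigonometric polynomials -/

section Trigonometric

theorem hasDerivAt_exp_I_mul (n : ℤ) (s : ℝ) :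
    HasDerivAt (fun s : ℝ => Complex.exp (Complex.I * n * s))
      (Complex.exp (Complex.I * n * s) * (Complex.I * n)) s := by
  have h1 : HasDerivAt (fun s : ℝ => Complex.I * n * s) (Complex.I * n * 1) s :=
    (Complex.ofRealCLM.hasDerivAt (x := s)).const_mul (Complex.I * n)
  rw [mul_one] at h1
  exact h1.cexp

/-- Pulled back to `ℝ` along `s ↦ e^{isθ}`, the `ζ_n` are monoid morphisms with distinct derivatives
at `0`, so Dedekind's independence of characters applies. -/
theorem linearIndependent_zeta : LinearIndependent ℂ zeta := by
  let χ : ℤ → (Multiplicative ℝ →* ℂ) := fun n =>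
    { toFun := fun s => Complex.exp (Complex.I * n * (s.toAdd : ℝ))
      map_one' := by simp
      map_mul' := fun s t => by
        rw [← Complex.exp_add, toAdd_mul]
        congr 1
        push_cast
        ring }
  have hχ : Function.Injective χ := fun n m h => by
    have h1 : ∀ s : ℝ, Complex.exp (Complex.I * n * s) = Complex.exp (Complex.I * m * s) :=
      fun s => DFunLike.congr_fun h (Multiplicative.ofAdd s)
    have h2 := hasDerivAt_exp_I_mul n 0
    rw [funext h1] at h2
    have h3 := h2.unique (hasDerivAt_exp_I_mul m 0)
    simpa using h3
  have h1 : LinearIndependent ℂ (fun n => (χ n : Multiplicative ℝ → ℂ)) :=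
    (linearIndependent_monoidHom (Multiplicative ℝ) ℂ).comp χ hχ
  let R : (SO2 → ℂ) →ₗ[ℂ] (Multiplicative ℝ → ℂ) :=
    LinearMap.funLeft ℂ ℂ fun s : Multiplicative ℝ => rot (s.toAdd)
  refine LinearIndependent.of_comp R ?_
  convert h1 using 2 with n
  exact funext fun s => zeta_rot n _

theorem linearIndependent_zetaK (ε : ℤˣ) : LinearIndependent ℂ (zetaK (ε := ε)) := by
  refine LinearIndependent.of_comp (OK ε).subtype ?_
  exact linearIndependent_zeta.comp (fun n : ZPar ε => n.1) Subtype.val_injective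

/-- The basis `(ζ_n)` of `𝒪^ε(K)`. -/
def zetaBasis (ε : ℤˣ) : Module.Basis (ZPar ε) ℂ (OK ε) :=
  Module.Basis.mk (linearIndependent_zetaK ε) (by
    rw [← Submodule.map_le_map_iff_of_injective (OK ε).subtype_injective, Submodule.map_span,
      Submodule.map_top, Submodule.range_subtype, ← Set.range_comp]
    exact le_rfl)

theorem coe_zetaBasis (ε : ℤˣ) : ⇑(zetaBasis ε) = zetaK := Module.Basis.coe_mk _ _

/-- The inverse of `k` is both its transpose and, as the determinant is `1`, its adjugate. This
forces the shape of a rotation, whose angle is the argument of the unit complex number given by the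
first column. -/
theorem exists_rot_eq (k : SO2) : ∃ s, k = rot s := by
  have hk : k.1.1 * k.1.1ᵀ = 1 := k.2
  have h00 := congrFun₂ hk 0 0
  have h01 := congrFun₂ hk 0 1
  have h11 := congrFun₂ hk 1 1
  have hdet := k.1.2
  rw [Matrix.det_fin_two] at hdet
  simp only [Matrix.mul_apply, Fin.sum_univ_two, Matrix.transpose_apply, Matrix.one_apply_eq,
    Matrix.one_apply_ne (zero_ne_one (α := Fin 2))] at h00 h01 h11
  set a := k.1.1 0 0 with ha
  set b := k.1.1 0 1 with hb
  set c := k.1.1 1 0 with hc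
  set d := k.1.1 1 1 with hd
  have e1 : d = a := by linear_combination -d * h00 + b * h01 + a * hdet
  have e2 : b = -c := by linear_combination -c * h00 + a * h01 - b * hdet
  have e3 : a ^ 2 + c ^ 2 = 1 := by rw [e2] at h00; linear_combination h00
  have hn : ‖(⟨a, c⟩ : ℂ)‖ = 1 := by
    rw [Complex.norm_def, Complex.normSq_mk, ← pow_two, ← pow_two, e3, Real.sqrt_one]
  refine ⟨Complex.arg ⟨a, c⟩, Subtype.ext (Subtype.ext ?_)⟩
  have hz : (⟨a, c⟩ : ℂ) ≠ 0 := fun h => by rw [h, norm_zero] at hn; exact zero_ne_one hn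
  have hcos : Real.cos (Complex.arg ⟨a, c⟩) = a := by rw [Complex.cos_arg hz, hn, div_one]
  have hsin : Real.sin (Complex.arg ⟨a, c⟩) = c := by rw [Complex.sin_arg, hn, div_one]
  show k.1.1 = !![Real.cos _, -Real.sin _; Real.sin _, Real.cos _]
  rw [hcos, hsin]
  ext i j
  fin_cases i <;> fin_cases j
  · exact ha.symm
  · exact hb.symm.trans e2
  · exact hc.symm
  · exact hd.symm.trans e1

theorem rot_mul_rot (s t : ℝ) : rot s * rot t = rot (s + t) := by
  apply Subtype.ext
  apply Subtype.ext
  show !![Real.cos s, -Real.sin s; Real.sin s, Real.cos s]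
    * !![Real.cos t, -Real.sin t; Real.sin t, Real.cos t]
    = !![Real.cos (s + t), -Real.sin (s + t); Real.sin (s + t), Real.cos (s + t)]
  rw [Real.cos_add, Real.sin_add]
  ext i j
  fin_cases i <;> fin_cases j <;> simp [Matrix.mul_apply, Fin.sum_univ_two] <;> ring

theorem rot_inv (s : ℝ) : (rot s)⁻¹ = rot (-s) :=
  inv_eq_of_mul_eq_one_right (by
    rw [rot_mul_rot, add_neg_cancel]
    apply Subtype.ext
    apply Subtype.ext
    show !![Real.cos 0, -Real.sin 0; Real.sin 0, Real.cos 0] = (1 : Matrix (Fin 2) (Fin 2) ℝ)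
    ext i j
    fin_cases i <;> fin_cases j <;> simp)

/-- Differentiation along right translations by `K`. -/
theorem hasDerivAt_mul_rot {ε : ℤˣ} (D : Module.End ℂ (OK ε))
    (hD : ∀ n : ZPar ε, D (zetaK n) = (Complex.I * n.1) • zetaK n) (ψ : OK ε) (k : SO2) :
    HasDerivAt (fun s : ℝ => ψ.1 (k * rot s)) ((D ψ).1 k) 0 := by
  have hψ := (zetaBasis ε).mem_span ψ
  rw [coe_zetaBasis] at hψ
  induction hψ using Submodule.span_induction with
  | mem ψ h =>
    obtain ⟨n, rfl⟩ := h
    obtain ⟨r, rfl⟩ := exists_rot_eq k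
    have h1 : ∀ s : ℝ, (zetaK n).1 (rot r * rot s) = Complex.exp (Complex.I * n.1 * (r + s : ℝ)) :=
      fun s => by rw [rot_mul_rot]; exact zeta_rot _ _
    have h2 : (zetaK n).1 (rot r) = Complex.exp (Complex.I * n.1 * r) := zeta_rot _ _
    rw [hD, funext h1]
    show HasDerivAt _ ((Complex.I * n.1) * (zetaK n).1 (rot r)) 0
    rw [h2]
    have h3 := hasDerivAt_exp_I_mul n.1 (r + 0)
    have h4 := h3.comp_const_add r 0
    rw [add_zero, mul_comm (Complex.exp _)] at h4
    exact h4
  | zero =>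
    rw [map_zero]
    exact hasDerivAt_const _ _
  | add ψ φ _ _ hψ hφ =>
    rw [map_add]
    exact hψ.add hφ
  | smul c ψ _ hψ =>
    rw [map_smul]
    exact hψ.const_mul c

end Trigonometric

/-! ### Values of the coefficients -/

section Values

variable {l : AAˣ} (hl : ∀ t : ℝ, evalAt 1 t one_pos (l : AA) = 1)
include hl

theorem partialQ_inv_one (t : ℝ) : partialQ ((l⁻¹ : AAˣ) : AA) 1 t = -partialQ l 1 t := by
  have h := partialQ_mul (l : AA) ((l⁻¹ : AAˣ) : AA) t one_pos
  rw [Units.mul_inv, partialQ_one t one_pos, hl, evalAt_inv_one hl] at h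
  linear_combination -h

/-- The two terms of `kapPA` contribute opposite derivatives to a difference, so their sum is
doubled, which offsets the `2` in `η ~ 2 (q - 1)`. This is where `∂λ(1, t)` enters the limit. -/
theorem evalAt_divEta_kapPA_one (n : ℤ) (t : ℝ) :
    evalAt 1 t one_pos (divEta (kapPA l n)) = partialQ l 1 t + (1 + n) * t := by
  rw [evalAt_divEta_one (evalAt_kapPA_one hl n), kapPA, partialQ_sub _ _ t one_pos,
    partialQ_mul _ _ t one_pos, partialQ_mul _ _ t one_pos, partialQ_inv_one hl,
    partialQ_powA_one, partialQ_powA_one, hl, evalAt_inv_one hl, evalAt_powA_one, evalAt_powA_one]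
  push_cast
  ring

/-- The sums `λ + λ⁻¹` and `{n}` are stationary at `q = 1`, each being a function equal to `1` there
plus its inverse. Hence `x` has no diagonal part in the limit. -/
theorem evalAt_divEta_mid_one (n : ℤ) (t : ℝ) :
    evalAt 1 t one_pos (divEta (brA 1 * kapA l - brA (n + 1) * brA (n - 1))) = 0 := by
  rw [evalAt_divEta_one (evalAt_mid_one hl n)]
  simp only [brA, kapA, partialQ_sub _ _ t one_pos, partialQ_mul _ _ t one_pos,
    partialQ_add _ _ t one_pos, partialQ_inv_one hl, partialQ_powA_one, map_add, hl,
    evalAt_inv_one hl, evalAt_powA_one]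
  push_cast
  ring

omit hl

theorem evalAt_divEta_powZ_sub_one (n : ℤ) (t : ℝ) :
    evalAt 1 t one_pos (divEta (powZ n - powZ (-n))) = n * t := by
  rw [evalAt_divEta_one (evalAt_powZ_sub_one n), partialQ_sub _ _ t one_pos, partialQ_powA_one,
    partialQ_powA_one]
  push_cast
  ring

theorem evalAt_invBr_one (n : ℤ) (t : ℝ) : evalAt 1 t one_pos (invBr n) = 2⁻¹ := by
  rw [evalAt_invBr, brA, map_add, evalAt_powA_one, evalAt_powA_one, one_add_one_eq_two]

theorem evalAt_powA_zero (q c : ℝ) (hq : 0 < q) : evalAt q 0 hq (powA c) = 1 := by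
  simp [evalAt_powA]

theorem evalAt_invBr_zero (q : ℝ) (hq : 0 < q) (n : ℤ) : evalAt q 0 hq (invBr n) = 2⁻¹ := by
  rw [evalAt_invBr, brA, map_add, evalAt_powA_zero, evalAt_powA_zero, one_add_one_eq_two]

include hl

/-! ### Values of the coefficients on the line `q = 1`. -/

section One

variable (n : ℤ) (t : ℝ)

theorem evalAt_xUp_one :
    evalAt 1 t one_pos (xUp l n) = (partialQ l 1 t + (1 + n) * t) / 4 := by
  rw [xUp, map_mul, map_mul, map_mul, evalAt_divEta_kapPA_one hl, evalAt_invBr_one,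
    evalAt_invBr_one, evalAt_powA_one]
  ring

theorem evalAt_xMid_one : evalAt 1 t one_pos (xMid l n) = 0 := by
  rw [xMid, map_mul, evalAt_divEta_mid_one hl, zero_mul]

theorem evalAt_xDown_one :
    evalAt 1 t one_pos (xDown l n) = (partialQ l 1 t + (1 - n) * t) / 4 := by
  rw [xDown, map_mul, map_mul, map_mul, evalAt_divEta_kapPA_one hl, evalAt_invBr_one,
    evalAt_invBr_one, evalAt_powA_one]
  push_cast
  ring

theorem evalAt_zUp_one :
    evalAt 1 t one_pos (zUp l n) = -(partialQ l 1 t + (1 + n) * t) / 4 := by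
  rw [zUp, map_mul, map_neg, map_mul, evalAt_divEta_kapPA_one hl, evalAt_invBr_one,
    evalAt_invBr_one]
  ring

theorem evalAt_zMid_one : evalAt 1 t one_pos (zMid l n) = n * t / 2 := by
  rw [zMid, map_mul, map_mul, map_mul, evalAt_divEta_powZ_sub_one, evalAt_invBr_one,
    evalAt_invBr_one, kapA, map_add, hl, evalAt_inv_one hl]
  ring

theorem evalAt_zDown_one :
    evalAt 1 t one_pos (zDown l n) = (partialQ l 1 t + (1 - n) * t) / 4 := by
  rw [zDown, map_mul, map_mul, evalAt_divEta_kapPA_one hl, evalAt_invBr_one, evalAt_invBr_one]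
  push_cast
  ring

end One

/-! ### Values of the coefficients on the line `t = 0`. -/

section Zero

variable {q : ℝ} (hq : 0 < q) (n : ℤ)

theorem evalAt_units_inv (t : ℝ) :
    evalAt q t hq ((l⁻¹ : AAˣ) : AA) = (evalAt q t hq l)⁻¹ :=
  eq_inv_of_mul_eq_one_right (by rw [← map_mul, Units.mul_inv, map_one])

/-- Keeping the factor `η(q, 0) = 2 log q` on the left avoids division and is the form needed to
compute `X = 1 + η x` and `Z = η z`. -/
theorem evalAt_mul_divEta {f : AA} (hf : ∀ t, evalAt 1 t one_pos f = 0) :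
    ((2 * Real.log q : ℝ) : ℂ) * evalAt q 0 hq (divEta f) = evalAt q 0 hq f := by
  conv_rhs => rw [← etaA_mul_divEta hf, map_mul, evalAt_etaA, etaFun_zero]

theorem mul_evalAt_kapPA : ((2 * Real.log q : ℝ) : ℂ) * evalAt q 0 hq (divEta (kapPA l n))
    = evalAt q 0 hq l - (evalAt q 0 hq l)⁻¹ := by
  rw [evalAt_mul_divEta hl hq (evalAt_kapPA_one hl n), kapPA, map_sub, map_mul, map_mul,
    evalAt_powA_zero, evalAt_powA_zero, evalAt_units_inv hl, mul_one, mul_one]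

theorem mul_evalAt_xUp : ((2 * Real.log q : ℝ) : ℂ) * evalAt q 0 hq (xUp l n)
    = (evalAt q 0 hq l - (evalAt q 0 hq l)⁻¹) / 4 := by
  rw [← mul_evalAt_kapPA hl hq n, xUp, map_mul, map_mul, map_mul, evalAt_invBr_zero,
    evalAt_invBr_zero, evalAt_powA_zero]
  ring

theorem mul_evalAt_xDown : ((2 * Real.log q : ℝ) : ℂ) * evalAt q 0 hq (xDown l n)
    = (evalAt q 0 hq l - (evalAt q 0 hq l)⁻¹) / 4 := by
  rw [← mul_evalAt_kapPA hl hq (-n), xDown, map_mul, map_mul, map_mul, evalAt_invBr_zero,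
    evalAt_invBr_zero, evalAt_powA_zero]
  ring

theorem mul_evalAt_xMid : ((2 * Real.log q : ℝ) : ℂ) * evalAt q 0 hq (xMid l n)
    = (evalAt q 0 hq l + (evalAt q 0 hq l)⁻¹) / 2 - 1 := by
  have h := evalAt_mul_divEta hl hq (evalAt_mid_one hl n)
  rw [xMid, map_mul, map_mul, evalAt_invBr_zero, evalAt_invBr_zero, ← mul_assoc, h]
  simp only [brA, kapA, map_sub, map_mul, map_add, evalAt_powA_zero, evalAt_units_inv hl]
  ring

theorem mul_evalAt_yUp : ((2 * Real.log q : ℝ) : ℂ) * evalAt q 0 hq (yUp l n)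
    = -(evalAt q 0 hq l - (evalAt q 0 hq l)⁻¹) / 4 := by
  rw [← mul_evalAt_kapPA hl hq n, yUp, map_mul, map_neg, map_mul, map_mul, evalAt_invBr_zero,
    evalAt_invBr_zero, evalAt_powA_zero]
  ring

theorem mul_evalAt_yDown : ((2 * Real.log q : ℝ) : ℂ) * evalAt q 0 hq (yDown l n)
    = -(evalAt q 0 hq l - (evalAt q 0 hq l)⁻¹) / 4 := by
  rw [← mul_evalAt_kapPA hl hq (-n), yDown, map_mul, map_neg, map_mul, map_mul, evalAt_invBr_zero,
    evalAt_invBr_zero, evalAt_powA_zero]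
  ring

theorem mul_evalAt_zUp : ((2 * Real.log q : ℝ) : ℂ) * evalAt q 0 hq (zUp l n)
    = -(evalAt q 0 hq l - (evalAt q 0 hq l)⁻¹) / 4 := by
  rw [← mul_evalAt_kapPA hl hq n, zUp, map_mul, map_neg, map_mul, evalAt_invBr_zero,
    evalAt_invBr_zero]
  ring

theorem mul_evalAt_zMid : ((2 * Real.log q : ℝ) : ℂ) * evalAt q 0 hq (zMid l n) = 0 := by
  have h := evalAt_mul_divEta hl hq (evalAt_powZ_sub_one n)
  rw [zMid, map_mul, map_mul, ← mul_assoc, ← mul_assoc, h, map_sub, evalAt_powA_zero,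
    evalAt_powA_zero, sub_self, zero_mul, zero_mul]

theorem mul_evalAt_zDown : ((2 * Real.log q : ℝ) : ℂ) * evalAt q 0 hq (zDown l n)
    = (evalAt q 0 hq l - (evalAt q 0 hq l)⁻¹) / 4 := by
  rw [← mul_evalAt_kapPA hl hq (-n), zDown, map_mul, map_mul, evalAt_invBr_zero,
    evalAt_invBr_zero]
  ring

end Zero

end Values

end

section

open Matrix

attribute [local instance 100] LieRing.ofAssociativeRing

/-! ### Identification of the specializations -/

section Rows

variable {ε : ℤˣ} {l : AAˣ} {α : AU →ₐ[AA] Module.End AA (AO ε)}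

theorem zetaK_apply (n : ZPar ε) (k : SO2) : (zetaK n).1 k = zeta n.1 k := rfl

theorem zeta_base_mul (k : SO2) :
    (((k.1.1 0 0 : ℝ) : ℂ) + ((k.1.1 1 0 : ℝ) : ℂ) * Complex.I)
      * (((k.1.1 0 0 : ℝ) : ℂ) - ((k.1.1 1 0 : ℝ) : ℂ) * Complex.I) = 1 := by
  obtain ⟨s, rfl⟩ := exists_rot_eq k
  show ((Real.cos s : ℂ) + (Real.sin s : ℂ) * Complex.I)
    * ((Real.cos s : ℂ) - (Real.sin s : ℂ) * Complex.I) = 1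
  have h : ((Real.cos s : ℝ) : ℂ) ^ 2 + ((Real.sin s : ℝ) : ℂ) ^ 2 = 1 := by
    exact_mod_cast Real.cos_sq_add_sin_sq s
  linear_combination h - ((Real.sin s : ℝ) : ℂ) ^ 2 * Complex.I_sq

theorem zetaK_shift_one (n : ZPar ε) (k : SO2) : (zetaK (n.shift 1)).1 k
    = (((k.1.1 0 0 : ℝ) : ℂ) + ((k.1.1 1 0 : ℝ) : ℂ) * Complex.I) ^ 2 * (zetaK n).1 k := by
  have h0 := left_ne_zero_of_mul_eq_one (zeta_base_mul k)
  rw [zetaK_apply, zetaK_apply, zeta, zeta, IndQ.shift_val, zpow_add₀ h0, mul_one, mul_comm]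
  rfl

theorem zetaK_shift_neg_one (n : ZPar ε) (k : SO2) : (zetaK (n.shift (-1))).1 k
    = (((k.1.1 0 0 : ℝ) : ℂ) - ((k.1.1 1 0 : ℝ) : ℂ) * Complex.I) ^ 2 * (zetaK n).1 k := by
  have h0 := left_ne_zero_of_mul_eq_one (zeta_base_mul k)
  have h1 := eq_inv_of_mul_eq_one_right (zeta_base_mul k)
  rw [zetaK_apply, zetaK_apply, zeta, zeta, IndQ.shift_val, zpow_add₀ h0, h1, mul_comm]
  congr 1
  rw [inv_pow, mul_neg_one, _root_.zpow_neg]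
  rfl

/-- A combination of three characters is the product of a character by a function on `K`. -/
theorem tri_zetaK_apply (n : ZPar ε) (a b c : ℂ) (k : SO2) :
    (a • zetaK (n.shift 1) + b • zetaK n + c • zetaK (n.shift (-1))).1 k
      = (a * (((k.1.1 0 0 : ℝ) : ℂ) + ((k.1.1 1 0 : ℝ) : ℂ) * Complex.I) ^ 2 + b
        + c * (((k.1.1 0 0 : ℝ) : ℂ) - ((k.1.1 1 0 : ℝ) : ℂ) * Complex.I) ^ 2) * (zetaK n).1 k := by
  show a * (zetaK (n.shift 1)).1 k + b * (zetaK n).1 k + c * (zetaK (n.shift (-1))).1 k = _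
  rw [zetaK_shift_one, zetaK_shift_neg_one]
  ring

/-- For a fixed `k`, both sides are linear functionals of `ψ`, so multiplication operators are
recognized on characters. -/
theorem apply_eq_mul {D : Module.End ℂ (OK ε)} {k : SO2} {u : ℂ}
    (h : ∀ n : ZPar ε, (D (zetaK n)).1 k = u * (zetaK n).1 k) (ψ : OK ε) :
    (D ψ).1 k = u * ψ.1 k := by
  let ev : OK ε →ₗ[ℂ] ℂ := (LinearMap.proj k).comp (OK ε).subtype
  have : ev.comp D = u • ev := (zetaBasis ε).ext fun n => by rw [coe_zetaBasis]; exact h n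
  exact DFunLike.congr_fun this ψ

theorem translate_pStar_rot (μ : ℂ) (s : ℝ) : translate (pStar μ) (rot s)
    = !![Complex.I * Real.cos s * Real.sin s * (μ⁻¹ - μ),
        Complex.I * (μ⁻¹ * Real.cos s ^ 2 + μ * Real.sin s ^ 2);
        -Complex.I * (μ * Real.cos s ^ 2 + μ⁻¹ * Real.sin s ^ 2),
        Complex.I * Real.cos s * Real.sin s * (μ - μ⁻¹)] := by
  have hinv : ((rot s).1⁻¹).1 = (rot (-s)).1.1 := congrArg (fun k : SO2 => k.1.1) (rot_inv s)
  rw [translate, hinv]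
  show !![Real.cos (-s), -Real.sin (-s); Real.sin (-s), Real.cos (-s)].map Complex.ofReal * pStar μ
    * !![Real.cos s, -Real.sin s; Real.sin s, Real.cos s].map Complex.ofReal = _
  rw [Real.cos_neg, Real.sin_neg, pStar]
  ext i j
  fin_cases i <;> fin_cases j <;> simp [Matrix.mul_apply, Fin.sum_univ_two] <;> ring

theorem toEnv_g0p_modK (Y : sl2) : toEnv (g0p (modK Y))
    = (Y.1 0 0 : ℂ) • toEnv (g0p (modK eH))
      + ((Y.1 0 1 + Y.1 1 0 : ℝ) : ℂ) • toEnv (g0p (modK eE)) := by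
  rw [← toEnv_smul, ← toEnv_smul, ← toEnv_add, ← g0p_smul, ← g0p_smul, ← g0p_add, ← modK_eq]

theorem evModule_opθA {V : Type} [AddCommGroup V] [Module ℂ V] (ζ : ZPar ε → V) (φ : AA →+* ℂ)
    (n : ZPar ε) : evModule φ ζ (opθA ε (Finsupp.single n 1)) = φ (qIntA n.1) • ζ n := by
  rw [evModule_triA_single]
  show φ 0 • _ + _ + φ 0 • _ = _
  rw [map_zero, zero_smul, zero_smul, zero_add, add_zero]

theorem evModule_zetaK (φ : AA →+* ℂ) (n : ZPar ε) :
    evModule φ zetaK (Finsupp.single n 1) = zetaK n := by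
  rw [evModule_single, map_one, one_smul]

variable (hl : ∀ t : ℝ, evalAt 1 t one_pos (l : AA) = 1) (hx : α xA = opxA ε l)
  (hy : α (star xA) = opyA ε l) (hz : α zA = opzA ε l) (hθ : α θA = opθA ε)
include hl hx hy hz hθ

/-- The general construction provides a module; it agrees with the quantum induced module because
both act on generators by the same tridiagonal coefficients, evaluated at `(q, t)`. -/
theorem exists_specialization_quantum {q t : ℝ} (hq : 0 < q) (hq1 : q ≠ 1) (ht : t ≠ 0) :
    ∃ ev : AU →+* Uq (qC q t hq hq1 ht),
      IsEv.{w} q t hq ((etaFun q t : ℂ)⁻¹ • (Uq.X (qC q t hq hq1 ht) - 1))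
        ((etaFun q t : ℂ)⁻¹ • Uq.Z (qC q t hq hq1 ht)) (Uq.θ (qC q t hq hq1 ht)) ev ∧
      IsTheSpecialization.{w} q t hq ev α (zetaq ℂ)
        (indQ (qC q t hq hq1 ht) ε (Units.map (evalAt q t hq : AA →* ℂ) l)) := by
  have h0 : (etaFun q t : ℂ) ≠ 0 := Complex.ofReal_ne_zero.mpr (etaFun_ne_zero t hq hq1)
  have hsZ : star ((etaFun q t : ℂ)⁻¹ • Uq.Z (qC q t hq hq1 ht))
      = (etaFun q t : ℂ)⁻¹ • Uq.Z (qC q t hq hq1 ht) := by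
    rw [star_smul, star_inv₀, UqOps.star_Z]
    congr 2
    exact Complex.conj_ofReal _
  have htop := adjoin_star_presented_eq_top (rel := UqRel (qC q t hq hq1 ht).val) h0
    (UqOps.star_Z _) (UqOps.star_θ _)
  obtain ⟨ev, hev, ρ, hρ, ρx, ρy, ρz, ρθ⟩ := exists_specialization.{w} (specRelAt_uq hq1 ht) hsZ
    (UqOps.star_θ _) htop (fun D _ _ _ _ _ _ h => exists_algHom_uq hq1 ht h)
    (fun D _ _ _ _ _ _ h => exists_algHom_uq hq1 ht h)
    (Finsupp.basisSingleOne : Module.Basis (ZPar ε) ℂ (OqK ℂ ε)) α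
  refine ⟨ev, hev, ?_⟩
  rw [Finsupp.coe_basisSingleOne] at hρ ρx ρy ρz ρθ
  have hstar : star ((etaFun q t : ℂ)⁻¹ • (Uq.X (qC q t hq hq1 ht) - 1))
      = (etaFun q t : ℂ)⁻¹ • (star (Uq.X (qC q t hq hq1 ht)) - 1) := by
    rw [star_smul, star_sub, star_one, star_inv₀]
    congr 2
    exact Complex.conj_ofReal _
  have hqC : evalAt q t hq (powA 1) = (qC q t hq hq1 ht).val := evalAt_powA_one_eq q t hq
  have hs : ∀ n : ZPar ε, evModule (evalAt q t hq) (fun i => Finsupp.single i (1 : ℂ))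
      (Finsupp.single n 1) = zetaq ℂ n := fun n => by
    rw [evModule_single, map_one, one_smul]
  suffices h : ρ = indQ (qC q t hq hq1 ht) ε (Units.map (evalAt q t hq : AA →* ℂ) l) by
    rw [← h]
    exact hρ
  refine AlgHom.ext_of_adjoin_eq_top htop ?_
  rintro _ (rfl | rfl | rfl | rfl) <;> refine IndQ.end_ext fun n => ?_
  · have h : indQ (qC q t hq hq1 ht) ε (Units.map (evalAt q t hq : AA →* ℂ) l)
        ((etaFun q t : ℂ)⁻¹ • (Uq.X (qC q t hq hq1 ht) - 1)) = IndQ.tri ε (fun n => evalAt q t hq (xUp l n))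
          (fun n => evalAt q t hq (xMid l n)) (fun n => evalAt q t hq (xDown l n)) := by
      rw [map_smul, map_sub, map_one, indQ_X]
      exact smul_opX_sub_one ε hl hqC h0
    refine (congrArg (ρ _) (hs n).symm).trans ((ρx _).trans ?_)
    rw [h, IndQ.tri_zetaq, hx, evModule_triA_single]
  · have h : indQ (qC q t hq hq1 ht) ε (Units.map (evalAt q t hq : AA →* ℂ) l)
        (star ((etaFun q t : ℂ)⁻¹ • (Uq.X (qC q t hq hq1 ht) - 1))) = IndQ.tri ε (fun n => evalAt q t hq (yUp l n))
          (fun n => evalAt q t hq (xMid l n)) (fun n => evalAt q t hq (yDown l n)) := by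
      rw [hstar, map_smul, map_sub, map_one, indQ_star_X]
      exact smul_opXs_sub_one ε hl hqC h0
    refine (congrArg (ρ _) (hs n).symm).trans ((ρy _).trans ?_)
    rw [h, IndQ.tri_zetaq, hy, evModule_triA_single]
  · have h : indQ (qC q t hq hq1 ht) ε (Units.map (evalAt q t hq : AA →* ℂ) l)
        ((etaFun q t : ℂ)⁻¹ • Uq.Z (qC q t hq hq1 ht)) = IndQ.tri ε (fun n => evalAt q t hq (zUp l n))
          (fun n => evalAt q t hq (zMid l n)) (fun n => evalAt q t hq (zDown l n)) := by
      rw [map_smul, indQ_Z]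
      exact smul_opZ ε hl hqC h0
    refine (congrArg (ρ _) (hs n).symm).trans ((ρz _).trans ?_)
    rw [h, IndQ.tri_zetaq, hz, evModule_triA_single]
  · refine (congrArg (ρ _) (hs n).symm).trans ((ρθ _).trans ?_)
    rw [hθ, evModule_opθA, map_qIntA hqC]
    exact (indQ_θ _ _ _ n).symm

theorem exists_specialization_groupoid {q : ℝ} (hq : 0 < q) (hq1 : q ≠ 1) :
    ∃ ev : AU →+* UG0star,
      IsEv.{w} q 0 hq (((2 * Real.log q : ℝ) : ℂ)⁻¹ • (UG0star.X - 1))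
        (((2 * Real.log q : ℝ) : ℂ)⁻¹ • UG0star.Z) UG0star.θ ev ∧
      ∃ ρ, IsGroupoidInd ε (evalAt q 0 hq l) ρ ∧
        IsTheSpecialization.{w} q 0 hq ev α zetaK ρ := by
  have hc : ((2 * Real.log q : ℝ) : ℂ) ≠ 0 := Complex.ofReal_ne_zero.mpr
    (mul_ne_zero two_ne_zero fun h => hq1 (Real.eq_one_of_pos_of_log_eq_zero hq h))
  have hsZ : star (((2 * Real.log q : ℝ) : ℂ)⁻¹ • UG0star.Z)
      = ((2 * Real.log q : ℝ) : ℂ)⁻¹ • UG0star.Z := by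
    rw [star_smul, star_inv₀, GroupoidOps.star_Z]
    congr 2
    exact Complex.conj_ofReal _
  have htop := adjoin_star_presented_eq_top (rel := G0starRel) hc GroupoidOps.star_Z
    GroupoidOps.star_θ
  obtain ⟨ev, hev, ρ, hρ, ρx, ρy, ρz, ρθ⟩ := exists_specialization.{w} (specRelAt_uG0star (hq := hq) hc) hsZ
    GroupoidOps.star_θ htop (fun D _ _ _ _ _ _ h => exists_algHom_uG0star hc h)
    (fun D _ _ _ _ _ _ h => exists_algHom_uG0star hc h) (zetaBasis ε) α
  rw [coe_zetaBasis] at hρ ρx ρy ρz ρθ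
  -- The coordinate functions are recovered from the rescaled generators, whose coefficients are
  -- known from the integral form.
  have hX : ρ UG0star.X = 1 + ((2 * Real.log q : ℝ) : ℂ)
      • ρ (((2 * Real.log q : ℝ) : ℂ)⁻¹ • (UG0star.X - 1)) := by
    rw [map_smul, smul_inv_smul₀ hc, map_sub, map_one, add_sub_cancel]
  have hY : ρ (star UG0star.X) = 1 + ((2 * Real.log q : ℝ) : ℂ)
      • ρ (star (((2 * Real.log q : ℝ) : ℂ)⁻¹ • (UG0star.X - 1))) := by
    rw [star_inv_smul_X_sub_one, map_smul, smul_inv_smul₀ hc, map_sub, map_one, add_sub_cancel]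
  have hZ : ρ UG0star.Z = ((2 * Real.log q : ℝ) : ℂ)
      • ρ (((2 * Real.log q : ℝ) : ℂ)⁻¹ • UG0star.Z) := by
    rw [map_smul, smul_inv_smul₀ hc]
  have hx' : ∀ n : ZPar ε, ρ UG0star.X (zetaK n) = 
      ((evalAt q 0 hq l - (evalAt q 0 hq l)⁻¹) / 4) • zetaK (n.shift 1)
      + ((evalAt q 0 hq l + (evalAt q 0 hq l)⁻¹) / 2) • zetaK n
      + ((evalAt q 0 hq l - (evalAt q 0 hq l)⁻¹) / 4) • zetaK (n.shift (-1)) := fun n => by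
    have h := ρx (Finsupp.single n 1)
    rw [evModule_zetaK, hx, evModule_triA_single] at h
    rw [hX, LinearMap.add_apply, LinearMap.smul_apply, h, Module.End.one_apply,
      smul_add, smul_add, smul_smul, smul_smul, smul_smul, mul_evalAt_xUp hl hq,
      mul_evalAt_xMid hl hq, mul_evalAt_xDown hl hq]
    module
  have hy' : ∀ n : ZPar ε, ρ (star UG0star.X) (zetaK n) = 
      (-(evalAt q 0 hq l - (evalAt q 0 hq l)⁻¹) / 4) • zetaK (n.shift 1)
      + ((evalAt q 0 hq l + (evalAt q 0 hq l)⁻¹) / 2) • zetaK n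
      + (-(evalAt q 0 hq l - (evalAt q 0 hq l)⁻¹) / 4) • zetaK (n.shift (-1)) := fun n => by
    have h := ρy (Finsupp.single n 1)
    rw [evModule_zetaK, hy, evModule_triA_single] at h
    rw [hY, LinearMap.add_apply, LinearMap.smul_apply, h, Module.End.one_apply,
      smul_add, smul_add, smul_smul, smul_smul, smul_smul, mul_evalAt_yUp hl hq,
      mul_evalAt_xMid hl hq, mul_evalAt_yDown hl hq]
    module
  have hz' : ∀ n : ZPar ε, ρ UG0star.Z (zetaK n) = 
      (-(evalAt q 0 hq l - (evalAt q 0 hq l)⁻¹) / 4) • zetaK (n.shift 1) + (0 : ℂ) • zetaK n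
      + ((evalAt q 0 hq l - (evalAt q 0 hq l)⁻¹) / 4) • zetaK (n.shift (-1)) := fun n => by
    have h := ρz (Finsupp.single n 1)
    rw [evModule_zetaK, hz, evModule_triA_single] at h
    rw [hZ, LinearMap.smul_apply, h, smul_add, smul_add, smul_smul, smul_smul, smul_smul,
      mul_evalAt_zUp hl hq, mul_evalAt_zMid hl hq, mul_evalAt_zDown hl hq]
  have hθ' : ∀ n : ZPar ε, ρ UG0star.θ (zetaK n) = (n.1 : ℂ) • zetaK n := fun n => by
    have h := ρθ (Finsupp.single n 1)
    rwa [evModule_zetaK, hθ, evModule_opθA, evalAt_qIntA _ _ _ (evalAt_powA_zero _ _ _)] at h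
  refine ⟨ev, hev, ρ, ⟨fun ψ k => ?_, fun ψ k => ?_⟩, hρ⟩
  · exact hasDerivAt_mul_rot (Complex.I • ρ UG0star.θ)
      (fun n => by rw [LinearMap.smul_apply, hθ', smul_smul]) ψ k
  · have hI := Complex.I_mul_I
    have hb := zeta_base_mul k
    obtain ⟨s, rfl⟩ := exists_rot_eq k
    have hk00 : (rot s).1.1 0 0 = Real.cos s := rfl
    have hk10 : (rot s).1.1 1 0 = Real.sin s := rfl
    rw [hk00, hk10] at hb
    rw [translate_pStar_rot]
    show (ρ UG0star.X ψ).1 (rot s) = Complex.I * (-Complex.I * (_ * (Real.cos s : ℂ) ^ 2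
        + _ * (Real.sin s : ℂ) ^ 2)) * ψ.1 (rot s) ∧
      (ρ (star UG0star.X) ψ).1 (rot s) = -Complex.I * (Complex.I * (_ * (Real.cos s : ℂ) ^ 2
        + _ * (Real.sin s : ℂ) ^ 2)) * ψ.1 (rot s) ∧
      (ρ UG0star.Z ψ).1 (rot s)
        = Complex.I * (Real.cos s : ℂ) * (Real.sin s : ℂ) * _ * ψ.1 (rot s)
    generalize evalAt q 0 hq l = μ at *
    have h1 : ((Real.cos s : ℝ) : ℂ) ^ 2 + ((Real.sin s : ℝ) : ℂ) ^ 2 = 1 := by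
      exact_mod_cast Real.cos_sq_add_sin_sq s
    refine ⟨?_, ?_, ?_⟩
    -- Since the sum of the characters `ζ_{±2}` is `2 (cos² s - sin² s)`, the multiplier is `(μ -
    -- μ⁻¹)/2 (cos² s - sin² s) + (μ + μ⁻¹)/2 = μ cos² s + μ⁻¹ sin² s`.
    · refine apply_eq_mul (fun n => ?_) ψ
      rw [hx', tri_zetaK_apply, hk00, hk10]
      congr 1
      linear_combination ((μ - μ⁻¹) / 2 * (Real.sin s : ℂ) ^ 2
        + (μ * (Real.cos s : ℂ) ^ 2 + μ⁻¹ * (Real.sin s : ℂ) ^ 2)) * hI - (μ + μ⁻¹) / 2 * h1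
    · refine apply_eq_mul (fun n => ?_) ψ
      rw [hy', tri_zetaK_apply, hk00, hk10]
      congr 1
      linear_combination (-(μ - μ⁻¹) / 2 * (Real.sin s : ℂ) ^ 2
        + (μ⁻¹ * (Real.cos s : ℂ) ^ 2 + μ * (Real.sin s : ℂ) ^ 2)) * hI - (μ + μ⁻¹) / 2 * h1
    · refine apply_eq_mul (fun n => ?_) ψ
      rw [hz', tri_zetaK_apply, hk00, hk10]
      congr 1
      ring

/-- At `t = 0` the coefficients on `q = 1` lose their dependence on `n`, so the classes of `H` and
`E` act as multiplication by combinations of `ζ_{±2}`; these are the matrix coefficients of the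
adjoint action of `K` on `𝔤/𝔨`. -/
theorem exists_specialization_motion :
    ∃ ev : AU →+* CEnv g0,
      IsEv.{w} 1 0 one_pos ((1 / 2 : ℂ) • toEnv (g0p (modK eH)))
        (Complex.I • toEnv (g0p (modK eE))) (-Complex.I • toEnv (g0k iθk)) ev ∧
      ∃ ρ, IsMotionInd ε (partialQ l 1 0) ρ ∧
        IsTheSpecialization.{w} 1 0 one_pos ev α zetaK ρ := by
  have hI := Complex.I_mul_I
  obtain ⟨ev, hev, ρ, hρ, ρx, -, ρz, ρθ⟩ := exists_specialization.{w} specRelAt_g0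
    (star_I_smul_toEnv _) (star_neg_I_smul_toEnv _) adjoin_g0_eq_top
    (fun D _ _ _ _ _ _ h => exists_algHom_g0 h) (fun D _ _ _ _ _ _ h => exists_algHom_g0 h)
    (zetaBasis ε) α
  rw [coe_zetaBasis] at hρ ρx ρz ρθ
  have hH : ∀ n : ZPar ε, ρ (toEnv (g0p (modK eH))) (zetaK n)
      = (partialQ l 1 0 / 2) • zetaK (n.shift 1) + (0 : ℂ) • zetaK n
        + (partialQ l 1 0 / 2) • zetaK (n.shift (-1)) := fun n => by
    have h := ρx (Finsupp.single n 1)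
    rw [evModule_zetaK, hx, evModule_triA_single, map_smul, LinearMap.smul_apply,
      evalAt_xUp_one hl, evalAt_xMid_one hl, evalAt_xDown_one hl, Complex.ofReal_zero, mul_zero,
      mul_zero, add_zero] at h
    linear_combination (norm := module) (2 : ℂ) • h
  have hE : ∀ n : ZPar ε, ρ (toEnv (g0p (modK eE))) (zetaK n)
      = (Complex.I * partialQ l 1 0 / 4) • zetaK (n.shift 1) + (0 : ℂ) • zetaK n
        + (-Complex.I * partialQ l 1 0 / 4) • zetaK (n.shift (-1)) := fun n => by
    have h := ρz (Finsupp.single n 1)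
    rw [evModule_zetaK, hz, evModule_triA_single, map_smul, LinearMap.smul_apply,
      evalAt_zUp_one hl, evalAt_zMid_one hl, evalAt_zDown_one hl, Complex.ofReal_zero, mul_zero,
      mul_zero, mul_zero, zero_div, add_zero] at h
    have h' := congrArg (fun v => -Complex.I • v) h
    simp only [smul_smul, neg_mul, hI, neg_neg, one_smul] at h'
    rw [h']
    module
  have hθ' : ∀ n : ZPar ε, ρ (toEnv (g0k iθk)) (zetaK n)
      = (Complex.I * n.1) • zetaK n := fun n => by
    have h := ρθ (Finsupp.single n 1)
    rw [evModule_zetaK, hθ, evModule_opθA, evalAt_qIntA _ _ _ (evalAt_powA_zero _ _ _), map_smul,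
      LinearMap.smul_apply] at h
    rw [← smul_smul, ← h, smul_smul, mul_neg, hI, neg_neg, one_smul]
  refine ⟨ev, hev, ρ, ⟨fun ψ k => hasDerivAt_mul_rot _ hθ' ψ k, fun Y ψ k => ?_⟩, hρ⟩
  obtain ⟨s, rfl⟩ := exists_rot_eq k
  have hinv : ((rot s).1⁻¹).1 = (rot (-s)).1.1 := congrArg (fun k : SO2 => k.1.1) (rot_inv s)
  have hk00 : (rot s).1.1 0 0 = Real.cos s := rfl
  have hk10 : (rot s).1.1 1 0 = Real.sin s := rfl
  have hk : ((rot s).1.1 * Y.1 * ((rot s).1⁻¹).1) 0 0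
      = (Real.cos s ^ 2 - Real.sin s ^ 2) * Y.1 0 0
        - Real.cos s * Real.sin s * (Y.1 0 1 + Y.1 1 0) := by
    rw [hinv]
    show (!![Real.cos s, -Real.sin s; Real.sin s, Real.cos s] * Y.1
      * !![Real.cos (-s), -Real.sin (-s); Real.sin (-s), Real.cos (-s)]) 0 0 = _
    rw [Real.cos_neg, Real.sin_neg]
    have h11 := sl2_apply_one_one Y
    simp [Matrix.mul_apply, Fin.sum_univ_two, Matrix.vecMul, Matrix.vecHead, Matrix.vecTail]
    rw [h11]
    ring
  have hY : ρ (toEnv (g0p (modK Y))) = (Y.1 0 0 : ℂ) • ρ (toEnv (g0p (modK eH)))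
      + ((Y.1 0 1 + Y.1 1 0 : ℝ) : ℂ) • ρ (toEnv (g0p (modK eE))) := by
    rw [toEnv_g0p_modK, map_add, map_smul, map_smul]
  -- By double angles, the class of `H` acts by `μ (cos² s - sin² s)` and that of `E` by `-μ cos s
  -- sin s`, in agreement with `hk`.
  refine apply_eq_mul (fun n => ?_) ψ
  rw [hY, hk]
  show (Y.1 0 0 : ℂ) * (ρ (toEnv (g0p (modK eH))) (zetaK n)).1 (rot s)
    + ((Y.1 0 1 + Y.1 1 0 : ℝ) : ℂ) * (ρ (toEnv (g0p (modK eE))) (zetaK n)).1 (rot s) = _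
  rw [hH, hE, tri_zetaK_apply, tri_zetaK_apply, hk00, hk10]
  generalize (zetaK n).1 (rot s) = v
  push_cast
  generalize partialQ l 1 0 = μ
  linear_combination (μ * Y.1 0 0 * (Complex.sin s) ^ 2
    + (Y.1 0 1 + Y.1 1 0) * μ * Complex.cos s * Complex.sin s) * v * hI

end Rows

end

section

open Matrix

attribute [local instance 100] LieRing.ofAssociativeRing

/-! ### The principal series in the compact picture -/

section PrincipalSeries

/-- The bottom row of a matrix, as a complex number. -/
def bottomRow (g : SL2) : ℂ := (g.1 1 1 : ℂ) + (g.1 1 0 : ℂ) * Complex.I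

theorem bottomRow_re (g : SL2) : (bottomRow g).re = g.1 1 1 := by simp [bottomRow]

theorem bottomRow_im (g : SL2) : (bottomRow g).im = g.1 1 0 := by simp [bottomRow]

theorem bottomRow_ne_zero (g : SL2) : bottomRow g ≠ 0 := fun h => by
  have h1 := g.2
  rw [Matrix.det_fin_two, ← bottomRow_re, ← bottomRow_im, h] at h1
  simp at h1

theorem norm_bottomRow_pos (g : SL2) : 0 < ‖bottomRow g‖ := norm_pos_iff.mpr (bottomRow_ne_zero g)

/-- The component in `K` of an element of `G = P K`. -/
def kPart (g : SL2) : SO2 := rot (Complex.arg (bottomRow g))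

theorem kPart_zero_zero (g : SL2) : (kPart g).1.1 0 0 = g.1 1 1 / ‖bottomRow g‖ := by
  rw [← bottomRow_re, ← Complex.cos_arg (bottomRow_ne_zero g)]
  rfl

theorem kPart_one_zero (g : SL2) : (kPart g).1.1 1 0 = g.1 1 0 / ‖bottomRow g‖ := by
  rw [← bottomRow_im g, ← Complex.sin_arg]
  rfl

theorem kPart_base (g : SL2) : (((kPart g).1.1 0 0 : ℝ) : ℂ)
    + (((kPart g).1.1 1 0 : ℝ) : ℂ) * Complex.I = bottomRow g / ‖bottomRow g‖ := by
  rw [kPart_zero_zero, kPart_one_zero, Complex.ofReal_div, Complex.ofReal_div]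
  have h : bottomRow g = (g.1 1 1 : ℂ) + (g.1 1 0 : ℂ) * Complex.I := rfl
  generalize ‖bottomRow g‖ = r at *
  rw [h]
  ring

theorem kPart_base_conj (g : SL2) : (((kPart g).1.1 0 0 : ℝ) : ℂ)
    - (((kPart g).1.1 1 0 : ℝ) : ℂ) * Complex.I
    = ((g.1 1 1 : ℂ) - (g.1 1 0 : ℂ) * Complex.I) / ‖bottomRow g‖ := by
  rw [kPart_zero_zero, kPart_one_zero, Complex.ofReal_div, Complex.ofReal_div]
  ring

theorem zeta_kPart (n : ℤ) (g : SL2) : zeta n (kPart g) = (bottomRow g / ‖bottomRow g‖) ^ n := by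
  rw [zeta, kPart_base]

theorem SO2_ext {k k' : SO2} (h0 : k.1.1 0 0 = k'.1.1 0 0) (h1 : k.1.1 1 0 = k'.1.1 1 0) :
    k = k' := by
  obtain ⟨s, rfl⟩ := exists_rot_eq k
  obtain ⟨t, rfl⟩ := exists_rot_eq k'
  have h0' : Real.cos s = Real.cos t := h0
  have h1' : Real.sin s = Real.sin t := h1
  apply Subtype.ext
  apply Subtype.ext
  show !![Real.cos s, -Real.sin s; Real.sin s, Real.cos s]
    = !![Real.cos t, -Real.sin t; Real.sin t, Real.cos t]
  rw [h0', h1']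

theorem norm_bottomRow_SO2 (k : SO2) : ‖bottomRow k.1‖ = 1 := by
  obtain ⟨s, rfl⟩ := exists_rot_eq k
  show ‖((Real.cos s : ℝ) : ℂ) + ((Real.sin s : ℝ) : ℂ) * Complex.I‖ = 1
  rw [Complex.norm_add_mul_I, Real.cos_sq_add_sin_sq, Real.sqrt_one]

theorem kPart_SO2 (k : SO2) : kPart k.1 = k := by
  refine SO2_ext ?_ ?_
  · rw [kPart_zero_zero, norm_bottomRow_SO2, div_one]
    obtain ⟨s, rfl⟩ := exists_rot_eq k
    rfl
  · rw [kPart_one_zero, norm_bottomRow_SO2, div_one]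

/-- Left multiplication by an upper triangular matrix only rescales the bottom row. Its argument
thus carries the component in `K`, up to sign, and its norm carries the factor `|a|`. -/
theorem upper_mul_apply {p : SL2} (hp : p.1 1 0 = 0) (g : SL2) :
    bottomRow (p * g) = (p.1 1 1 : ℂ) * bottomRow g := by
  have h : ∀ j, (p * g).1 1 j = p.1 1 1 * g.1 1 j := fun j => by
    show (p.1 * g.1) 1 j = _
    rw [Matrix.mul_apply, Fin.sum_univ_two, hp, zero_mul, zero_add]
  rw [bottomRow, bottomRow, h, h]
  push_cast
  ring

theorem neg_one_zpow_ZPar {ε : ℤˣ} (n : ZPar ε) : (-1 : ℂ) ^ n.1 = ((ε : ℤ) : ℂ) := by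
  obtain ⟨n, hn⟩ := n
  rcases Int.units_eq_one_or ε with rfl | rfl
  · have : Even n := by
      rw [Int.even_iff]
      simpa [Int.ModEq] using hn
    simpa using this.neg_one_zpow
  · have : Odd n := by
      rw [Int.odd_iff]
      simpa [Int.ModEq] using hn
    simpa using this.neg_one_zpow

variable (ε : ℤˣ) (μ : ℂ)

/-- The extension to `G` of a function on `K`. -/
def extendK : OK ε →ₗ[ℂ] (SL2 → ℂ) where
  toFun ψ g := ((‖bottomRow g‖⁻¹ : ℝ) : ℂ) ^ (μ + 1) * ψ.1 (kPart g)
  map_add' _ _ := funext fun _ => mul_add _ _ _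
  map_smul' _ _ := funext fun _ => mul_left_comm _ _ _

theorem extendK_apply (ψ : OK ε) (g : SL2) :
    extendK ε μ ψ g = ((‖bottomRow g‖⁻¹ : ℝ) : ℂ) ^ (μ + 1) * ψ.1 (kPart g) := rfl

theorem extendK_SO2 (ψ : OK ε) (k : SO2) : extendK ε μ ψ k.1 = ψ.1 k := by
  rw [extendK_apply, norm_bottomRow_SO2, kPart_SO2, inv_one, Complex.ofReal_one,
    Complex.one_cpow, one_mul]

/-- A negative diagonal entry reverses the unit vector of the bottom row, and `ζ_n` then picks up
`(-1)^n = ε`. The two diagonal entries have the same sign, their product being `1`. -/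
theorem apply_kPart_upper_mul {p : SL2} (hp : p.1 1 0 = 0) (g : SL2) (ψ : OK ε) :
    ψ.1 (kPart (p * g)) = (if p.1 0 0 < 0 then ((ε : ℤ) : ℂ) else 1) * ψ.1 (kPart g) := by
  let f : SO2 → (OK ε →ₗ[ℂ] ℂ) := fun k => (LinearMap.proj k).comp (OK ε).subtype
  have : f (kPart (p * g)) = (if p.1 0 0 < 0 then ((ε : ℤ) : ℂ) else 1) • f (kPart g) := by
    refine (zetaBasis ε).ext fun n => ?_
    rw [coe_zetaBasis]
    show zeta n.1 (kPart (p * g)) = _ * zeta n.1 (kPart g)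
    have hdet := p.2
    rw [Matrix.det_fin_two, hp, mul_zero, sub_zero] at hdet
    have h1 : bottomRow (p * g) / ‖bottomRow (p * g)‖
        = ((p.1 1 1 : ℂ) / |p.1 1 1|) * (bottomRow g / ‖bottomRow g‖) := by
      rw [upper_mul_apply hp, norm_mul, Complex.norm_real, Real.norm_eq_abs, Complex.ofReal_mul,
        mul_div_mul_comm]
    rw [zeta_kPart, zeta_kPart, h1, mul_zpow]
    congr 1
    split_ifs with h0
    · have h2 : p.1 1 1 < 0 := by nlinarith
      have h3 : (p.1 1 1 : ℂ) ≠ 0 := Complex.ofReal_ne_zero.mpr h2.ne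
      rw [abs_of_neg h2, Complex.ofReal_neg, div_neg, div_self h3, neg_one_zpow_ZPar]
    · have h2 : 0 < p.1 1 1 := by
        by_contra h
        nlinarith
      have h3 : (p.1 1 1 : ℂ) ≠ 0 := Complex.ofReal_ne_zero.mpr h2.ne'
      rw [abs_of_pos h2, div_self h3, _root_.one_zpow]
  exact DFunLike.congr_fun this ψ

theorem extendK_mem (ψ : OK ε) : extendK ε μ ψ ∈ IndSpace ε μ := by
  refine ⟨fun p g hp => ?_, ?_⟩
  · have hdet := p.2
    rw [Matrix.det_fin_two, hp, mul_zero, sub_zero] at hdet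
    have h1 : ‖bottomRow (p * g)‖⁻¹ = |p.1 0 0| * ‖bottomRow g‖⁻¹ := by
      rw [upper_mul_apply hp, norm_mul, Complex.norm_real, Real.norm_eq_abs, mul_inv,
        eq_inv_of_mul_eq_one_left hdet, abs_inv]
    rw [extendK_apply, extendK_apply, apply_kPart_upper_mul ε hp, h1, Complex.ofReal_mul,
      Complex.mul_cpow_ofReal_nonneg (abs_nonneg _) (inv_nonneg.mpr (norm_nonneg _))]
    ring
  · have : (fun k : SO2 => extendK ε μ ψ k.1) = ψ.1 := funext (extendK_SO2 ε μ ψ)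
    rw [this]
    exact ψ.2

/-- The element of `P` in the decomposition of an element of `G = P K`. -/
theorem mul_inv_kPart (g : SL2) : (g * (kPart g).1⁻¹).1 1 0 = 0 ∧
    (g * (kPart g).1⁻¹).1 0 0 = ‖bottomRow g‖⁻¹ := by
  have hr := (norm_bottomRow_pos g).ne'
  have hn : ‖bottomRow g‖ ^ 2 = g.1 1 1 ^ 2 + g.1 1 0 ^ 2 := by
    rw [← Complex.normSq_eq_norm_sq, Complex.normSq_apply, bottomRow_re, bottomRow_im]
    ring
  have hinv : ((kPart g).1⁻¹).1 = (rot (-Complex.arg (bottomRow g))).1.1 :=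
    congrArg (fun k : SO2 => k.1.1) (rot_inv _)
  have hp : (g * (kPart g).1⁻¹).1 = g.1 * !![Real.cos (Complex.arg (bottomRow g)),
      Real.sin (Complex.arg (bottomRow g)); -Real.sin (Complex.arg (bottomRow g)),
      Real.cos (Complex.arg (bottomRow g))] := by
    show g.1 * ((kPart g).1⁻¹).1 = _
    rw [hinv]
    show g.1 * !![Real.cos (-_), -Real.sin (-_); Real.sin (-_), Real.cos (-_)] = _
    rw [Real.cos_neg, Real.sin_neg, neg_neg]
  rw [Complex.cos_arg (bottomRow_ne_zero g), Complex.sin_arg, bottomRow_re, bottomRow_im] at hp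
  have hdet := g.2
  rw [Matrix.det_fin_two] at hdet
  rw [hp]
  constructor
  · simp [Matrix.mul_apply, Fin.sum_univ_two]
    ring
  · simp [Matrix.mul_apply, Fin.sum_univ_two]
    field_simp
    linear_combination hdet

/-- By the decomposition `G = P K` with positive diagonal entry in `P`, equivariance determines `f`
from its restriction to `K`. -/
theorem extendK_eq {f : SL2 → ℂ} (hf : f ∈ IndSpace ε μ) :
    extendK ε μ ⟨fun k => f k.1, hf.2⟩ = f := funext fun g => by
  obtain ⟨h1, h2⟩ := mul_inv_kPart g
  have h := hf.1 (g * (kPart g).1⁻¹) (kPart g).1 h1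
  have h0 : 0 < ‖bottomRow g‖⁻¹ := inv_pos.mpr (norm_bottomRow_pos g)
  rw [inv_mul_cancel_right, h2, if_neg h0.not_gt, one_mul, abs_of_pos h0] at h
  rw [extendK_apply, h]

/-- The compact picture of the principal series. -/
def compactPicture : OK ε ≃ₗ[ℂ] IndSpace ε μ :=
  LinearEquiv.ofBijective ((extendK ε μ).codRestrict _ (extendK_mem ε μ))
    ⟨fun ψ φ h => Subtype.ext (funext fun k => by
      rw [← extendK_SO2 ε μ ψ, ← extendK_SO2 ε μ φ]
      exact congrFun (congrArg Subtype.val h) k.1),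
    fun f => ⟨⟨fun k => f.1 k.1, f.2.2⟩, Subtype.ext (extendK_eq ε μ f.2)⟩⟩

theorem compactPicture_apply (ψ : OK ε) : (compactPicture ε μ ψ).1 = extendK ε μ ψ := rfl

/-- This form contains only an integral power of a linear function of the entries and the logarithm
of a positive quadratic form, so it can be differentiated directly, without moduli or complex
powers. -/
theorem extendK_zetaK (n : ZPar ε) (g : SL2) : extendK ε μ (zetaK n) g = bottomRow g ^ n.1
    * Complex.exp (-(μ + 1 + n.1) / 2 * (Real.log (g.1 1 1 ^ 2 + g.1 1 0 ^ 2) : ℝ)) := by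
  have hr := norm_bottomRow_pos g
  have hr0 : ((‖bottomRow g‖ : ℝ) : ℂ) ≠ 0 := Complex.ofReal_ne_zero.mpr hr.ne'
  have hn : g.1 1 1 ^ 2 + g.1 1 0 ^ 2 = ‖bottomRow g‖ ^ 2 := by
    rw [← Complex.normSq_eq_norm_sq, Complex.normSq_apply, bottomRow_re, bottomRow_im]
    ring
  have h1 : ((‖bottomRow g‖ : ℝ) : ℂ) = Complex.exp (Real.log ‖bottomRow g‖ : ℝ) := by
    rw [← Complex.ofReal_exp, Real.exp_log hr]
  rw [extendK_apply, zetaK_apply, zeta_kPart, div_zpow, hn, Real.log_pow, Complex.ofReal_inv,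
    Complex.inv_cpow _ _ (by rw [Complex.arg_ofReal_of_nonneg hr.le]; exact Real.pi_ne_zero.symm),
    Complex.cpow_def_of_ne_zero hr0, ← Complex.ofReal_log hr.le]
  conv_lhs => rw [h1, ← Complex.exp_int_mul]
  rw [← Complex.exp_neg, div_eq_mul_inv, ← Complex.exp_neg, mul_left_comm, ← Complex.exp_add]
  congr 2
  push_cast
  ring

/-- With `m = μ + 1`, bottom row `(c, d)` and `Y` of entries `a, b, e, -a`, the left-hand side is
the logarithmic derivative of the extended character along `Y`, multiplied by `c² + d²`. The
right-hand side expands it on the squares of `d ± ic` and their product, that is, on `ζ_2`, `ζ_{-2}`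
and `1`. -/
theorem principal_identity (m n a b e c d : ℂ) :
    n * ((c * b - d * a) + (c * a + d * e) * Complex.I) * (d - c * Complex.I)
      + -(m + n) / 2 * (2 * d * (c * b - d * a) + 2 * c * (c * a + d * e))
    = (m + n) * (a / 2 + Complex.I * (b + e) / 4) * (d + c * Complex.I) ^ 2
      + Complex.I * n * (e - b) / 2 * ((d + c * Complex.I) * (d - c * Complex.I))
      + (m - n) * (a / 2 - Complex.I * (b + e) / 4) * (d - c * Complex.I) ^ 2 := by
  have h3 : Complex.I ^ 3 = -Complex.I := by rw [pow_succ, Complex.I_sq, neg_one_mul]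
  ring_nf
  simp only [h3, Complex.I_sq]
  ring

/-- The bottom row of `g γ(s)` is linear in the entries of `γ(s)`, so only the derivative of `γ` at
`0` is involved. The product rule for `extendK_zetaK` reduces the formula to `principal_identity`.
-/
theorem hasDerivAt_extendK_zetaK {γ : Multiplicative ℝ →* SL2} {Y : sl2} (hγ : IsOneParam γ Y)
    (n : ZPar ε) (g : SL2) :
    HasDerivAt (fun s : ℝ => extendK ε μ (zetaK n) (g * γ (Multiplicative.ofAdd s)))
      (extendK ε μ (((μ + 1 + n.1) * (Y.1 0 0 / 2 + Complex.I * (Y.1 0 1 + Y.1 1 0) / 4)) •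
          zetaK (n.shift 1) + (Complex.I * n.1 * (Y.1 1 0 - Y.1 0 1) / 2) • zetaK n
        + ((μ + 1 - n.1) * (Y.1 0 0 / 2 - Complex.I * (Y.1 0 1 + Y.1 1 0) / 4)) •
          zetaK (n.shift (-1))) g) 0 := by
  have hγ0 : γ (Multiplicative.ofAdd 0) = 1 := map_one γ
  have hent : ∀ (h : SL2) (j : Fin 2), (g * h).1 1 j = g.1 1 0 * h.1 0 j + g.1 1 1 * h.1 1 j :=
    fun h j => by
      show (g.1 * h.1) 1 j = _
      rw [Matrix.mul_apply, Fin.sum_univ_two]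
  have hd : ∀ j, HasDerivAt (fun s : ℝ => (g * γ (Multiplicative.ofAdd s)).1 1 j)
      (g.1 1 0 * Y.1 0 j + g.1 1 1 * Y.1 1 j) 0 := fun j => by
    simp only [hent]
    exact ((hγ 0 j).const_mul _).add ((hγ 1 j).const_mul _)
  have hc := hd 0
  have hdd := hd 1
  rw [sl2_apply_one_one] at hdd
  have hv0 : (g * γ (Multiplicative.ofAdd 0)) = g := by rw [hγ0, mul_one]
  have hu0 := bottomRow_ne_zero g
  have hN : g.1 1 1 ^ 2 + g.1 1 0 ^ 2 ≠ 0 := by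
    have := (norm_bottomRow_pos g).ne'
    rw [← bottomRow_re, ← bottomRow_im, pow_two, pow_two, ← Complex.normSq_apply]
    exact (map_ne_zero Complex.normSq).mpr hu0
  have h1 : HasDerivAt (fun s : ℝ => bottomRow (g * γ (Multiplicative.ofAdd s)))
      (((g.1 1 0 * Y.1 0 1 + g.1 1 1 * -Y.1 0 0 : ℝ) : ℂ)
        + ((g.1 1 0 * Y.1 0 0 + g.1 1 1 * Y.1 1 0 : ℝ) : ℂ) * Complex.I) 0 :=
    hdd.ofReal_comp.add (hc.ofReal_comp.mul_const _)
  have h2 := (hasDerivAt_zpow n.1 (bottomRow (g * γ (Multiplicative.ofAdd (0 : ℝ))))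
    (Or.inl (bottomRow_ne_zero _))).comp (0 : ℝ) h1
  have h3 := ((hdd.pow 2).add (hc.pow 2)).log (by
    simp only [Pi.add_apply, Pi.pow_apply, hv0]
    exact hN)
  have h4 := (h3.ofReal_comp.const_mul (-(μ + 1 + n.1) / 2)).cexp
  have h5 := h2.mul h4
  have hR : extendK ε μ (((μ + 1 + n.1) * (Y.1 0 0 / 2 + Complex.I * (Y.1 0 1 + Y.1 1 0) / 4)) •
          zetaK (n.shift 1) + (Complex.I * n.1 * (Y.1 1 0 - Y.1 0 1) / 2) • zetaK n
        + ((μ + 1 - n.1) * (Y.1 0 0 / 2 - Complex.I * (Y.1 0 1 + Y.1 1 0) / 4)) •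
          zetaK (n.shift (-1))) g
      = ((μ + 1 + n.1) * (Y.1 0 0 / 2 + Complex.I * (Y.1 0 1 + Y.1 1 0) / 4)
          * (bottomRow g / ‖bottomRow g‖) ^ 2 + Complex.I * n.1 * (Y.1 1 0 - Y.1 0 1) / 2
        + (μ + 1 - n.1) * (Y.1 0 0 / 2 - Complex.I * (Y.1 0 1 + Y.1 1 0) / 4)
          * (((g.1 1 1 : ℂ) - (g.1 1 0 : ℂ) * Complex.I) / ‖bottomRow g‖) ^ 2)
        * extendK ε μ (zetaK n) g := by
    rw [extendK_apply, extendK_apply, tri_zetaK_apply, kPart_base, kPart_base_conj]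
    ring
  rw [hR]
  simp only [extendK_zetaK]
  refine h5.congr_deriv ?_
  have hr2 : ((‖bottomRow g‖ : ℝ) : ℂ) ^ 2
      = bottomRow g * ((g.1 1 1 : ℂ) - (g.1 1 0 : ℂ) * Complex.I) := by
    rw [← Complex.ofReal_pow, ← Complex.normSq_eq_norm_sq, Complex.normSq_apply, bottomRow_re,
      bottomRow_im, bottomRow]
    push_cast
    linear_combination ((g.1 1 0 : ℂ) ^ 2) * Complex.I_sq
  have hNC : ((g.1 1 1 : ℂ)) ^ 2 + ((g.1 1 0 : ℂ)) ^ 2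
      = bottomRow g * ((g.1 1 1 : ℂ) - (g.1 1 0 : ℂ) * Complex.I) := by
    rw [bottomRow]
    linear_combination ((g.1 1 0 : ℂ) ^ 2) * Complex.I_sq
  have hub : (g.1 1 1 : ℂ) - (g.1 1 0 : ℂ) * Complex.I ≠ 0 := by
    refine right_ne_zero_of_mul (a := bottomRow g) ?_
    rw [← hNC]
    exact_mod_cast hN
  have key := principal_identity (μ + 1) n.1 (Y.1 0 0) (Y.1 0 1) (Y.1 1 0) (g.1 1 0) (g.1 1 1)
  rw [show (g.1 1 1 : ℂ) + (g.1 1 0 : ℂ) * Complex.I = bottomRow g from rfl] at key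
  simp only [Function.comp_apply, Pi.add_apply, Pi.pow_apply, hv0, div_pow, hr2,
    _root_.zpow_sub_one₀ hu0]
  push_cast
  rw [hNC]
  generalize Complex.exp _ = E
  generalize bottomRow g ^ n.1 = P
  generalize bottomRow g = u at *
  generalize (g.1 1 1 : ℂ) - (g.1 1 0 : ℂ) * Complex.I = v at *
  field_simp
  linear_combination 8 * P * E * key

end PrincipalSeries

end

section

open Matrix

attribute [local instance 100] LieRing.ofAssociativeRing

/-! ### The principal series of `SL(2, ℝ)` as the specialization at `q = 1`, `t ≠ 0`. -/

section Classical

variable {ε : ℤˣ} {l : AAˣ} {α : AU →ₐ[AA] Module.End AA (AO ε)}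

/-- The action of `𝔤` on the principal series is determined by its values on the characters. -/
theorem isPrincipalSeries_of_zetaK (μ : ℂ) {ρ : CEnv sl2 →ₐ[ℂ] Module.End ℂ (OK ε)}
    (hρ : ∀ (Y : sl2) (n : ZPar ε), ρ (toEnv Y) (zetaK n)
      = ((μ + 1 + n.1) * (Y.1 0 0 / 2 + Complex.I * (Y.1 0 1 + Y.1 1 0) / 4)) • zetaK (n.shift 1)
        + (Complex.I * n.1 * (Y.1 1 0 - Y.1 0 1) / 2) • zetaK n
        + ((μ + 1 - n.1) * (Y.1 0 0 / 2 - Complex.I * (Y.1 0 1 + Y.1 1 0) / 4)) •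
          zetaK (n.shift (-1))) :
    IsPrincipalSeries ε μ ρ := by
  refine ⟨compactPicture ε μ, fun ψ k => extendK_SO2 ε μ ψ k, fun Y γ hγ ψ g => ?_⟩
  simp only [compactPicture_apply]
  have hψ := (zetaBasis ε).mem_span ψ
  rw [coe_zetaBasis] at hψ
  induction hψ using Submodule.span_induction with
  | mem ψ h =>
    obtain ⟨n, rfl⟩ := h
    rw [hρ]
    exact hasDerivAt_extendK_zetaK ε μ hγ n g
  | zero =>
    simp only [map_zero]
    exact hasDerivAt_const _ _
  | add ψ φ _ _ hψ hφ =>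
    simp only [map_add]
    exact hψ.add hφ
  | smul c ψ _ hψ =>
    simp only [map_smul]
    exact hψ.const_mul c

/-- The off-diagonal coefficients on `q = 1` are multiples of `∂λ(1, t) + (1 ± n) t = t (μ + 1 ±
n)`; dividing out `t` gives the principal series with its normalizing shift. -/
theorem exists_specialization_classical
    (hl : ∀ t : ℝ, evalAt 1 t one_pos (l : AA) = 1) (hx : α xA = opxA ε l)
    (hz : α zA = opzA ε l) (hθ : α θA = opθA ε) {t : ℝ} (ht : t ≠ 0) :
    ∃ ev : AU →+* CEnv sl2,
      IsEv.{w} 1 t one_pos ((t / 2 : ℂ) • toEnv eH) ((Complex.I * t) • toEnv eE)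
        (Complex.I • toEnv (eE - eF)) ev ∧
      ∃ ρ, IsPrincipalSeries ε ((t : ℂ)⁻¹ * partialQ l 1 t) ρ ∧
        IsTheSpecialization.{w} 1 t one_pos ev α zetaK ρ := by
  have hI := Complex.I_mul_I
  have ht' : (t : ℂ) ≠ 0 := Complex.ofReal_ne_zero.mpr ht
  have hsθ : star (Complex.I • toEnv (eE - eF)) = Complex.I • toEnv (eE - eF) := by
    have h := star_I_mul_smul_toEnv 1 (eE - eF)
    rwa [Complex.ofReal_one, mul_one] at h
  obtain ⟨ev, hev, ρ, hρ, ρx, -, ρz, ρθ⟩ := exists_specialization.{w} specRelAt_sl2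
    (star_I_mul_smul_toEnv t eE) hsθ (adjoin_sl2_eq_top ht)
    (fun D _ _ _ _ _ _ h => exists_algHom_sl2 ht h)
    (fun D _ _ _ _ _ _ h => exists_algHom_sl2 ht h) (zetaBasis ε) α
  rw [coe_zetaBasis] at hρ ρx ρz ρθ
  obtain ⟨μ, hμ⟩ : ∃ μ : ℂ, partialQ l 1 t = t * μ := ⟨(t : ℂ)⁻¹ * partialQ l 1 t, by
    rw [mul_inv_cancel_left₀ ht']⟩
  have hH : ∀ n : ZPar ε, ρ (toEnv eH) (zetaK n) = ((μ + 1 + n.1) / 2) • zetaK (n.shift 1)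
      + ((μ + 1 - n.1) / 2) • zetaK (n.shift (-1)) := fun n => by
    have h := ρx (Finsupp.single n 1)
    rw [evModule_zetaK, hx, evModule_triA_single, map_smul, LinearMap.smul_apply,
      evalAt_xUp_one hl, evalAt_xMid_one hl, evalAt_xDown_one hl, hμ] at h
    refine smul_right_injective _ (div_ne_zero ht' two_ne_zero) ?_
    refine h.trans ?_
    module
  have hE : ∀ n : ZPar ε, ρ (toEnv eE) (zetaK n)
      = (Complex.I * (μ + 1 + n.1) / 4) • zetaK (n.shift 1) + (-Complex.I * n.1 / 2) • zetaK n
        + (-Complex.I * (μ + 1 - n.1) / 4) • zetaK (n.shift (-1)) := fun n => by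
    have h := ρz (Finsupp.single n 1)
    rw [evModule_zetaK, hz, evModule_triA_single, map_smul, LinearMap.smul_apply,
      evalAt_zUp_one hl, evalAt_zMid_one hl, evalAt_zDown_one hl, hμ] at h
    refine smul_right_injective _ (mul_ne_zero Complex.I_ne_zero ht') ?_
    refine h.trans ?_
    simp only [smul_add, smul_smul]
    congr 1
    · congr 2
      · linear_combination (-(t * (μ + 1 + n.1) / 4 : ℂ)) * hI
      · linear_combination (t * n.1 / 2 : ℂ) * hI
    · congr 1
      linear_combination (t * (μ + 1 - n.1) / 4 : ℂ) * hI
  -- Since `θ = i (E - F)` acts on `ζ_n` by `n`, the action of `F = E + iθ` follows from that of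
  -- `E`.
  have hF : ∀ n : ZPar ε, ρ (toEnv eF) (zetaK n)
      = ρ (toEnv eE) (zetaK n) + (Complex.I * n.1) • zetaK n := fun n => by
    have h := ρθ (Finsupp.single n 1)
    rw [evModule_zetaK, hθ, evModule_opθA, evalAt_qIntA _ _ _ (evalAt_powA_one _ _), map_smul,
      LinearMap.smul_apply, toEnv_sub, map_sub, LinearMap.sub_apply] at h
    rw [← smul_smul, ← h, smul_smul, hI]
    module
  refine ⟨ev, hev, ρ, isPrincipalSeries_of_zetaK _ fun Y n => ?_, hρ⟩
  have hY : toEnv Y = (Y.1 0 0 : ℂ) • toEnv eH + (Y.1 0 1 : ℂ) • toEnv eE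
      + (Y.1 1 0 : ℂ) • toEnv eF := by
    rw [← toEnv_smul, ← toEnv_smul, ← toEnv_smul, ← toEnv_add, ← toEnv_add, ← sl2_eq]
  rw [hμ, inv_mul_cancel_left₀ ht', hY]
  simp only [map_add, map_smul, LinearMap.add_apply, LinearMap.smul_apply]
  rw [hF, hH, hE]
  module

end Classical

end

end QMackey

end

theorem mainTheorem9 (ε : ℤˣ) (l : AAˣ) (hl : ∀ t : ℝ, evalAt 1 t one_pos (l : AA) = 1) :
    ∃ α : AU →ₐ[AA] Module.End AA (AO ε), IsIntegralInd ε l α ∧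
      ∀ (q t : ℝ) (hq : 0 < q),
        (∀ (hq1 : q ≠ 1) (ht : t ≠ 0), ∃ ev : AU →+* Uq (qC q t hq hq1 ht),
          IsEv.{w} q t hq ((etaFun q t : ℂ)⁻¹ • (Uq.X (qC q t hq hq1 ht) - 1))
            ((etaFun q t : ℂ)⁻¹ • Uq.Z (qC q t hq hq1 ht)) (Uq.θ (qC q t hq hq1 ht)) ev ∧
          IsTheSpecialization.{w} q t hq ev α (zetaq ℂ)
            (indQ (qC q t hq hq1 ht) ε (Units.map (evalAt q t hq : AA →* ℂ) l))) ∧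
        (q = 1 → t ≠ 0 → ∃ ev : AU →+* CEnv sl2,
          IsEv.{w} q t hq ((t / 2 : ℂ) • toEnv eH) ((Complex.I * t) • toEnv eE)
            (Complex.I • toEnv (eE - eF)) ev ∧
          ∃ ρ, IsPrincipalSeries ε ((t : ℂ)⁻¹ * partialQ l 1 t) ρ ∧
            IsTheSpecialization.{w} q t hq ev α zetaK ρ) ∧
        (q ≠ 1 → t = 0 → ∃ ev : AU →+* UG0star,
          IsEv.{w} q t hq (((2 * Real.log q : ℝ) : ℂ)⁻¹ • (UG0star.X - 1))
            (((2 * Real.log q : ℝ) : ℂ)⁻¹ • UG0star.Z) UG0star.θ ev ∧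
          ∃ ρ, IsGroupoidInd ε (evalAt q 0 hq l) ρ ∧
            IsTheSpecialization.{w} q t hq ev α zetaK ρ) ∧
        (q = 1 → t = 0 → ∃ ev : AU →+* CEnv g0,
          IsEv.{w} q t hq ((1 / 2 : ℂ) • toEnv (g0p (modK eH))) (Complex.I • toEnv (g0p (modK eE)))
            (-Complex.I • toEnv (g0k iθk)) ev ∧
          ∃ ρ, IsMotionInd ε (partialQ l 1 0) ρ ∧
            IsTheSpecialization.{w} q t hq ev α zetaK ρ) := by
  -- The integral module is fixed before `(q, t)`; its explicit operators are all that the four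
  -- cases need.
  obtain ⟨α, hα, hx, hy, hz, hθ⟩ := exists_isIntegralInd ε hl
  refine ⟨α, hα, fun q t hq => ⟨fun hq1 ht => ?_, ?_, ?_, ?_⟩⟩
  · exact exists_specialization_quantum hl hx hy hz hθ hq hq1 ht
  · rintro rfl ht
    exact exists_specialization_classical hl hx hz hθ ht
  · rintro hq1 rfl
    exact exists_specialization_groupoid hl hx hy hz hθ hq hq1
  · rintro rfl rfl
    exact exists_specialization_motion hl hx hy hz hθ
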